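/- **Setting.** Let $a_n>0$, $b_n\in\mathbb R$ ($n\in\mathbb Z_+$), let $J$ be a self-adjoint extension in $\ell^2(\mathbb Z_+)$ of the minimal Jacobi operator $(J_0u)_n=a_{n-1}u_{n-1}+b_nu_n+a_nu_{n+1}$ ($a_{-1}=0$) defined on finitely supported sequences, let $E$ be its spectral family and let $P_n$ be the orthonormal polynomials, given by $P_0=1$ and $a_{n-1}P_{n-1}(\lambda)+b_nP_n(\lambda)+a_nP_{n+1}(\lambda)=\lambda P_n(\lambda)$. Let $\Lambda\subset\mathbb R$ be an open interval on which the spectral measure $d(E(\lambda)e_0,e_0)$, $e_0=(1,0,0,\dots)$, equals $w(\lambda)\,d\lambda$ with $w\in C^\infty(\Lambda)$, $w>0$. **Assumption ASY.** For $\lambda\in\Lambda$, $$P_n(\lambda)=2\kappa(\lambda)v_n\cos\big(\omega(\lambda)x_n+\Phi_n(\lambda)\big)+\epsilon_n(\lambda),$$ where $x_n<x_{n+1}$, $x_n\to\infty$, $v_n>0$, $\sum_{n\ge1} v_n^2x_n^{-2k}<\infty$ for some $k>0$ (the finitely many $n$ with $x_n\le0$ being disregarded); $\omega,\kappa,\Phi_n\in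 C^\infty(\Lambda)$ are real, $\kappa>0$, $\omega'>0$; as $n\to\infty$, uniformly on compact subsets of $\Lambda$, $\Phi_n^{(k)}=o(x_n)$ for $k=1,2$ and $\Phi_n^{(k)}=O(x_n)$ for each $k\ge3$; and $\sum_n|\epsilon_n(\lambda)|^2$ is bounded uniformly on compact subsets of $\Lambda$. **Notation.** Let $\Delta=\omega(\Lambda)$, let $\theta\in C^\infty(\Delta)$ be real with $\theta'>0$ and $\theta''\ne0$ on $\Delta$, let $\tau=\operatorname{sgn}\theta''$, $\mathcal I=\theta'(\Delta)$, and let $h:\mathcal I\to\Delta$ be the inverse function of $\theta'$. Let $\Theta$ be a real Borel function on $\mathbb R$ with $\Theta=\theta\circ\omega$ on $\Lambda$. For $f\in C_0^\infty(\Lambda)$ put $(Uf)_n=\int_\Lambda P_n(\lambda)\sqrt{w(\lambda)}f(\lambda)\,d\lambda$ and, for $\mu=\omega(\lambda)$ with $\lambda\in\Lambda$ and for $\xi\in\mathcal I$, $$\varphi_n(\mu)=\Phi_n(\lambda),\qquad F(\mu)=\omega'(\lambda)^{-1}\kappa(\lambda)\sqrt{w(\lambda)}\,f(\lambda),\qquad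 \mathcal F(\xi)=\sqrt{|h'(\xi)|}\,F(h(\xi)).$$ A function $\mu_n(t)$ is called a stationary branch if for every compact $K\subset\mathcal I$ one has, for all sufficiently large $t$ and all $n$ with $x_n/t\in K$, that $\mu_n(t)\in\Delta$ and $x_n+\varphi_n'(\mu_n(t))-\theta'(\mu_n(t))t=0$, and moreover $\mu_n(t)=h(x_n/t)+o(1)$ as $t\to+\infty$, uniformly in $n$ with $x_n/t\in K$. Put $\Psi_n(t)=\mu_n(t)x_n+\varphi_n(\mu_n(t))-\theta(\mu_n(t))t$. **Theorem 4.4.** Under these assumptions $u=Uf$ belongs to $\ell^2(\mathbb Z_+)$, a stationary branch exists, and for every stationary branch and all $t>0$, $n\in\mathbb Z_+$, $$\big(e^{-i\Theta(J)t}u\big)_n=\sqrt{2\pi}\,v_n\,e^{-\pi i\tau/4}e^{i\Psi_n(t)}t^{-1/2}\mathcal F(x_n/t)\,\mathbb 1(x_n/t\in\mathcal I)+\varrho_n(t),$$ where $\sum_{n\ge0}|\varrho_n(t)|^2<\infty$ for every $t>0$ and $\lim_{t\to+\infty}\sum_{n\ge0}|\varrho_n(t)|^2=0$. -/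

import Mathlib

open MeasureTheory Filter Topology
open scoped ContDiff ENNReal

/-- The Hilbert space `ℓ²(ℤ₊)` of complex square-summable sequences. -/
abbrev EllTwo : Type := lp (fun _ : ℕ => ℂ) 2

section Spectral

variable {H : Type*} [NormedAddCommGroup H] [InnerProductSpace ℂ H] [CompleteSpace H]

/-- A projection-valued measure on the Borel sets of `ℝ` (a resolution of the identity):
orthogonal projections, normalized, multiplicative and strongly countably additive. -/
structure ProjMeasure (H : Type*) [NormedAddCommGroup H] [InnerProductSpace ℂ H]
    [CompleteSpace H] where
  proj : Set ℝ → (H →L[ℂ] H)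
  isStarProjection : ∀ B, MeasurableSet B → IsStarProjection (proj B)
  proj_univ : proj Set.univ = 1
  proj_inter : ∀ A B, MeasurableSet A → MeasurableSet B → proj (A ∩ B) = proj A * proj B
  hasSum_proj : ∀ B : ℕ → Set ℝ, (∀ i, MeasurableSet (B i)) → Pairwise (Function.onFun Disjoint B) →
    ∀ u : H, HasSum (fun i => proj (B i) u) (proj (⋃ i, B i) u)

namespace ProjMeasure

theorem inner_nonneg (E : ProjMeasure H) (u : H) {B : Set ℝ} (hB : MeasurableSet B) :
    0 ≤ (inner ℂ u (E.proj B u)).re := by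
  have h := E.isStarProjection B hB
  have h1 : E.proj B (E.proj B u) = E.proj B u := by
    have := h.isIdempotentElem.eq
    exact congrArg (fun T : H →L[ℂ] H => T u) this
  have h2 : ContinuousLinearMap.adjoint (E.proj B) = E.proj B := h.isSelfAdjoint
  rw [← h1]
  nth_rewrite 1 [← h2]
  rw [ContinuousLinearMap.adjoint_inner_right]
  exact inner_self_nonneg (𝕜 := ℂ)

theorem proj_empty (E : ProjMeasure H) (u : H) : E.proj ∅ u = 0 := by
  have h := (E.hasSum_proj (fun _ => ∅) (fun _ => MeasurableSet.empty)
    (fun _ _ _ => disjoint_bot_left) u).summable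
  exact tendsto_nhds_unique tendsto_const_nhds h.tendsto_atTop_zero

/-- The scalar measure `B ↦ (E(B) u, u)`. -/
noncomputable def scalarMeasure (E : ProjMeasure H) (u : H) : Measure ℝ :=
  Measure.ofMeasurable (fun B _ => ENNReal.ofReal (inner ℂ u (E.proj B u)).re)
    (by simp [proj_empty])
    (by
      intro B hB hd
      have h := (E.hasSum_proj B hB hd u).mapL (innerSL ℂ u)
      have h' := Complex.reCLM.hasSum h
      simp only [innerSL_apply_apply, Complex.reCLM_apply] at h'
      rw [← h'.tsum_eq]
      exact ENNReal.ofReal_tsum_of_nonneg (fun i => E.inner_nonneg u (hB i)) h'.summable)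

/-- `A` is the operator `∫ g dE`: its quadratic form is `(A u, u) = ∫ g(x) d(E(x) u, u)`. Over the
complex field the quadratic form determines `A`. -/
def IsIntegral (E : ProjMeasure H) (g : ℝ → ℂ) (A : H →L[ℂ] H) : Prop :=
  ∀ u : H, inner ℂ u (A u) = ∫ x, g x ∂(E.scalarMeasure u)

open Classical in
/-- The bounded operator `∫ g dE`, for a bounded Borel function `g`
(for such `g` there is exactly one operator satisfying `IsIntegral`). -/
noncomputable def integral (E : ProjMeasure H) (g : ℝ → ℂ) : H →L[ℂ] H :=
  if h : ∃ A, E.IsIntegral g A then h.choose else 0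

/-- `E` is the spectral family of the (unbounded) operator `J`, that is, `J = ∫ x dE(x)`. -/
structure IsSpectralFamilyOf (E : ProjMeasure H) (J : H →ₗ.[ℂ] H) : Prop where
  mem_domain_iff : ∀ u : H, u ∈ J.domain ↔ Integrable (fun x : ℝ => x ^ 2) (E.scalarMeasure u)
  inner_eq : ∀ u : J.domain, inner ℂ (u : H) (J u) = ((∫ x, x ∂(E.scalarMeasure (u : H)) : ℝ) : ℂ)

end ProjMeasure

end Spectral

section Jacobi

/-- The Jacobi expression `a (n-1) u (n-1) + b n u n + a n u (n+1)`, with `a (-1) = 0`. -/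
noncomputable def jacobiSeq (a b : ℕ → ℝ) (u : ℕ → ℂ) : ℕ → ℂ
  | 0 => (b 0 : ℂ) * u 0 + (a 0 : ℂ) * u 1
  | n + 1 => (a n : ℂ) * u n + (b (n + 1) : ℂ) * u (n + 1) + (a (n + 1) : ℂ) * u (n + 2)

theorem jacobiSeq_memlp (a b : ℕ → ℝ) {u : ℕ → ℂ} (hu : {n | u n ≠ 0}.Finite) :
    Memℓp (E := fun _ : ℕ => ℂ) (jacobiSeq a b u) 2 := by
  refine (memℓp_zero ?_).of_exponent_ge zero_le
  refine ((hu.union (hu.image Nat.succ)).union (hu.image Nat.pred)).subset ?_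
  intro n hn
  by_contra hc
  simp only [Set.mem_union, Set.mem_image, Set.mem_ofPred_eq, not_or, not_exists, not_and,
    not_not] at hc
  obtain ⟨⟨h0, h1⟩, h2⟩ := hc
  have h3 : u (n + 1) = 0 := by
    by_contra h
    exact h2 (n + 1) h rfl
  apply hn
  cases n with
  | zero => simp [jacobiSeq, h0, h3]
  | succ n =>
    have h4 : u n = 0 := by
      by_contra h
      exact h1 n h rfl
    simp [jacobiSeq, h0, h3, h4]

/-- The minimal symmetric Jacobi operator, defined on the sequences with finitely many
non-zero components. -/
noncomputable def jacobiMin (a b : ℕ → ℝ) : EllTwo →ₗ.[ℂ] EllTwo where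
  domain :=
    { carrier := {u | {n | u n ≠ 0}.Finite}
      add_mem' := by
        intro u v hu hv
        refine (Set.Finite.union hu hv).subset ?_
        intro n hn
        by_contra hc
        simp only [Set.mem_union, Set.mem_ofPred_eq, not_or, not_not] at hc
        exact hn (by simp [hc.1, hc.2])
      zero_mem' := by simp
      smul_mem' := by
        intro c u hu
        refine Set.Finite.subset hu ?_
        intro n hn h
        exact hn (by simp [h]) }
  toFun :=
    { toFun := fun u => ⟨jacobiSeq a b (u : EllTwo), jacobiSeq_memlp a b u.2⟩
      map_add' := by
        intro u v
        ext n
        rw [lp.coeFn_add, Pi.add_apply]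
        cases n <;> simp [jacobiSeq] <;> ring
      map_smul' := by
        intro c u
        ext n
        rw [lp.coeFn_smul, Pi.smul_apply]
        cases n <;> simp [jacobiSeq] <;> ring }

/-- `J` is a self-adjoint Jacobi operator with coefficients `a`, `b`: a self-adjoint extension of
the minimal operator. -/
def IsJacobiOperator (a b : ℕ → ℝ) (J : EllTwo →ₗ.[ℂ] EllTwo) : Prop :=
  jacobiMin a b ≤ J ∧ IsSelfAdjoint J

/-- The orthonormal polynomials: `P 0 = 1` and
`a (n-1) P (n-1) + b n P n + a n P (n+1) = X P n`, with `a (-1) = 0`. -/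
noncomputable def jacobiPoly (a b : ℕ → ℝ) : ℕ → Polynomial ℝ
  | 0 => 1
  | 1 => Polynomial.C (a 0)⁻¹ * (Polynomial.X - Polynomial.C (b 0))
  | n + 2 => Polynomial.C (a (n + 1))⁻¹ *
      ((Polynomial.X - Polynomial.C (b (n + 1))) * jacobiPoly a b (n + 1)
        - Polynomial.C (a n) * jacobiPoly a b n)

/-- The vector `e₀ = (1, 0, 0, …)`. -/
noncomputable def vecZero : EllTwo := lp.single 2 0 (1 : ℂ)

/-- The spectral measure `d(E e₀, e₀)`. -/
noncomputable def spectralMeasure (E : ProjMeasure EllTwo) : Measure ℝ := E.scalarMeasure vecZero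

/-- The components `∫_Λ P_n(l) √τ(l) f(l) dl` of `U f`. -/
noncomputable def diagCoord (a b : ℕ → ℝ) (L : Set ℝ) (tau : ℝ → ℝ) (f : ℝ → ℂ) (n : ℕ) : ℂ :=
  ∫ l in L, (((jacobiPoly a b n).eval l * √(tau l) : ℝ) : ℂ) * f l

end Jacobi

section Asymptotics

/-- The assumption on the asymptotics of the functions `P n` on the open set `L`:
`P n = 2 κ v_n cos (ω x_n + Φ_n) + ε_n`. All estimates are uniform on compact subsets of `L`. -/
structure AsymptoticAssumption (P : ℕ → ℝ → ℝ) (L : Set ℝ) (kappa omega : ℝ → ℝ) (x v : ℕ → ℝ)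
    (Phi : ℕ → ℝ → ℝ) : Prop where
  x_strictMono : StrictMono x
  x_tendsto : Tendsto x atTop atTop
  v_pos : ∀ n, 0 < v n
  summable_v : ∃ k : ℝ, 0 < k ∧ Summable fun n => v n ^ 2 * x n ^ (-(2 * k))
  omega_smooth : ContDiffOn ℝ ∞ omega L
  omega_deriv_pos : ∀ l ∈ L, 0 < deriv omega l
  kappa_smooth : ContDiffOn ℝ ∞ kappa L
  kappa_pos : ∀ l ∈ L, 0 < kappa l
  Phi_smooth : ∀ n, ContDiffOn ℝ ∞ (Phi n) L
  Phi_low : ∀ K ⊆ L, IsCompact K → ∀ k ∈ ({1, 2} : Set ℕ), ∀ r > 0, ∀ᶠ n in atTop, ∀ l ∈ K,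
    |iteratedDeriv k (Phi n) l| ≤ r * x n
  Phi_high : ∀ K ⊆ L, IsCompact K → ∀ k : ℕ, 3 ≤ k → ∃ C : ℝ, ∀ᶠ n in atTop, ∀ l ∈ K,
    |iteratedDeriv k (Phi n) l| ≤ C * x n
  remainder : ∀ K ⊆ L, IsCompact K → ∃ C : ℝ, ∀ l ∈ K,
    Summable (fun n => |P n l - 2 * kappa l * v n * Real.cos (omega l * x n + Phi n l)| ^ 2) ∧
    ∑' n, |P n l - 2 * kappa l * v n * Real.cos (omega l * x n + Phi n l)| ^ 2 ≤ C

/-- The phase `φ_n(μ) = Φ_n(l)` where `μ = ω(l)`, `l ∈ L`. -/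
noncomputable def phaseMu (L : Set ℝ) (omega : ℝ → ℝ) (Phi : ℕ → ℝ → ℝ) (n : ℕ) (mu : ℝ) : ℝ :=
  Phi n (Function.invFunOn omega L mu)

/-- The amplitude `F(μ) = ω'(l)⁻¹ κ(l) √τ(l) f(l)` where `μ = ω(l)`, `l ∈ L`. -/
noncomputable def amplMu (L : Set ℝ) (omega kappa tau : ℝ → ℝ) (f : ℝ → ℂ) (mu : ℝ) : ℂ :=
  let l := Function.invFunOn omega L mu
  (((deriv omega l)⁻¹ * (kappa l * √(tau l)) : ℝ) : ℂ) * f l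

/-- The inverse function `h : θ'(D) → D` of `θ'`. -/
noncomputable def derivInv (theta : ℝ → ℝ) (D : Set ℝ) : ℝ → ℝ :=
  Function.invFunOn (deriv theta) D

/-- `𝓕(ξ) = √|h'(ξ)| F(h(ξ))`. -/
noncomputable def calF (theta : ℝ → ℝ) (D : Set ℝ) (F : ℝ → ℂ) (xi : ℝ) : ℂ :=
  ((√|deriv (derivInv theta D) xi| : ℝ) : ℂ) * F (derivInv theta D xi)

/-- `m n t` is the stationary point `μ_n(t) = h(x_n/t) + o(1)`, solving
`x_n + φ_n'(μ) - θ'(μ) t = 0`; on every compact subset of `θ'(D)` it is required to exist for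
sufficiently large `t` and the estimate is uniform. -/
structure IsStationaryBranch (theta : ℝ → ℝ) (D : Set ℝ) (phi : ℕ → ℝ → ℝ) (x : ℕ → ℝ)
    (m : ℕ → ℝ → ℝ) : Prop where
  stationary : ∀ K ⊆ deriv theta '' D, IsCompact K → ∀ᶠ t in atTop, ∀ n, x n / t ∈ K →
    m n t ∈ D ∧ x n + deriv (phi n) (m n t) - deriv theta (m n t) * t = 0
  asymp : ∀ K ⊆ deriv theta '' D, IsCompact K → ∀ r > 0, ∀ᶠ t in atTop, ∀ n, x n / t ∈ K →
    |m n t - derivInv theta D (x n / t)| < r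

/-- `Ψ_n(t) = μ_n(t) x_n + φ_n(μ_n(t)) - θ(μ_n(t)) t`. -/
noncomputable def totalPhase (theta : ℝ → ℝ) (phi : ℕ → ℝ → ℝ) (x : ℕ → ℝ) (m : ℕ → ℝ → ℝ)
    (n : ℕ) (t : ℝ) : ℝ :=
  m n t * x n + phi n (m n t) - theta (m n t) * t

/-- The leading term `√(2π) v_n e^{-πi s/4} e^{iΨ_n(t)} t^{-1/2} 𝓕(x_n/t) 𝟙(x_n/t ∈ θ'(D))`. -/
noncomputable def leadingTerm (theta : ℝ → ℝ) (D : Set ℝ) (F : ℝ → ℂ) (phi : ℕ → ℝ → ℝ)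
    (x v : ℕ → ℝ) (m : ℕ → ℝ → ℝ) (s : ℝ) (n : ℕ) (t : ℝ) : ℂ :=
  ((√(2 * Real.pi) * v n : ℝ) : ℂ) * Complex.exp (-(Real.pi * Complex.I * s / 4)) *
    Complex.exp (Complex.I * totalPhase theta phi x m n t) * ((t ^ (-(1 / 2) : ℝ) : ℝ) : ℂ) *
    (deriv theta '' D).indicator (calF theta D F) (x n / t)

end Asymptotics

/-! In the spectral representation the evolution becomes a family of oscillatory integrals. With
$\phi=f/\sqrt w$ one has $Uf=\int\phi\,dE\,e_0$, and the three-term recurrence identifies the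
components of $\int g\,dE\,e_0$ with integrals of $g$ against $P_n$ (`integral_vecZero_apply`,
`exists_spectral_evolution`). So the $n$-th component of $e^{-i\Theta(J)t}Uf$ is $\int P_n\sqrt w f
e^{-i\Theta t}d\lambda$. Inserting the asymptotics of $P_n$ and splitting the cosine leaves three
pieces (`evolution_decomposition`): the contribution of $\epsilon_n$, and two integrals with phases
$\pm(\omega x_n+\Phi_n)-\theta(\omega)t$.

The $\epsilon_n$ piece tends to zero in $\ell^2$ by dominated convergence. The minus phase is never
stationary since $\theta'>0$, and the plus phase is not stationary when $x_n/t$ lies off the image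
under $\theta'\circ\omega$ of an interval around the support of $f$. Repeated integration by parts
then gives powers of $(x_n+t)^{-1}$, which beat $v_n$ because $\sum v_n^2x_n^{-2k}<\infty$.

For $x_n/t$ in a compact window the stationary phase method gives the leading term with an error
$o(v_nt^{-1/2})$, uniformly in $n$ (`stationary_phase_uniform`). Uniformity comes from compactness:
it is enough to treat sequences with $x_{n_j}/t_j$ convergent. After rescaling by $t^{-1/2}$ one
integration by parts makes the integrals absolutely convergent, and dominated convergence yields the
Fresnel integral.

To sum the squares of these errors one needs $\sum v_n^2=O(t)$ over the window, although no
regularity of $v_n$ is assumed. This bound (`exists_sum_sq_le`) comes from the operator side: the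
evolution is bounded in $\ell^2$, and for an amplitude equal to one on the window its components
there have size at least a constant times $v_nt^{-1/2}$, up to a small sequence in $\ell^2$. -/

section BoundedMeasurable

/-! ### Bounded Borel functions and uniform approximation by simple functions. -/

/-- A bounded Borel function on the line. -/
structure BddMeas (g : ℝ → ℂ) : Prop where
  measurable : Measurable g
  bdd : ∃ C, ∀ x, ‖g x‖ ≤ C

theorem BddMeas.add {g h : ℝ → ℂ} (hg : BddMeas g) (hh : BddMeas h) : BddMeas (g + h) := by
  obtain ⟨C, hC⟩ := hg.bdd
  obtain ⟨D, hD⟩ := hh.bdd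
  exact ⟨hg.measurable.add hh.measurable, C + D,
    fun x => (norm_add_le _ _).trans (add_le_add (hC x) (hD x))⟩

theorem BddMeas.smul {g : ℝ → ℂ} (c : ℂ) (hg : BddMeas g) : BddMeas (c • g) := by
  obtain ⟨C, hC⟩ := hg.bdd
  refine ⟨hg.measurable.const_smul c, ‖c‖ * C, fun x => ?_⟩
  simpa using mul_le_mul_of_nonneg_left (hC x) (norm_nonneg c)

theorem BddMeas.mul {g h : ℝ → ℂ} (hg : BddMeas g) (hh : BddMeas h) : BddMeas (g * h) := by
  obtain ⟨C, hC⟩ := hg.bdd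
  obtain ⟨D, hD⟩ := hh.bdd
  refine ⟨hg.measurable.mul hh.measurable, C * D, fun x => ?_⟩
  simpa using mul_le_mul (hC x) (hD x) (norm_nonneg _) ((norm_nonneg _).trans (hC x))

theorem BddMeas.indicator_one {B : Set ℝ} (hB : MeasurableSet B) :
    BddMeas (B.indicator (1 : ℝ → ℂ)) := by
  refine ⟨measurable_one.indicator hB, 1, fun x => ?_⟩
  by_cases h : x ∈ B <;> simp [h]

theorem BddMeas.integrable {g : ℝ → ℂ} (hg : BddMeas g) (μ : Measure ℝ) [IsFiniteMeasure μ] :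
    Integrable g μ := by
  obtain ⟨C, hC⟩ := hg.bdd
  exact Integrable.of_bound hg.measurable.aestronglyMeasurable C (Eventually.of_forall hC)

theorem SimpleFunc.bddMeas (s : SimpleFunc ℝ ℂ) : BddMeas s := by
  refine ⟨s.measurable, ?_⟩
  obtain ⟨C, hC⟩ := s.exists_forall_norm_le
  exact ⟨C, hC⟩

/-- Round down to the nearest multiple of `r`; boundedness leaves finitely many values. -/
theorem exists_simpleFunc_near_real {g : ℝ → ℝ} (hg : Measurable g) {C : ℝ} (hC : ∀ x, |g x| ≤ C)
    {r : ℝ} (hr : 0 < r) : ∃ s : SimpleFunc ℝ ℝ, ∀ x, |g x - s x| ≤ r := by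
  let s : ℝ → ℝ := fun x => (⌊g x / r⌋ : ℝ) * r
  have hs : Measurable s := by
    have h1 : Measurable fun x => ⌊g x / r⌋ := (hg.div_const r).floor
    exact ((measurable_from_top (f := fun z : ℤ => (z : ℝ))).comp h1).mul_const r
  have hfin : (Set.range s).Finite := by
    refine ((Set.finite_Icc (⌊-C / r⌋) (⌊C / r⌋)).image (fun z : ℤ => (z : ℝ) * r)).subset ?_
    rintro _ ⟨x, rfl⟩
    have := abs_le.1 (hC x)
    refine ⟨⌊g x / r⌋, ⟨Int.floor_le_floor ?_, Int.floor_le_floor ?_⟩, rfl⟩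
    · gcongr
      exact this.1
    · gcongr
      exact this.2
  refine ⟨⟨s, fun y => hs (measurableSet_singleton y), hfin⟩, fun x => ?_⟩
  change |g x - (⌊g x / r⌋ : ℝ) * r| ≤ r
  have h1 := Int.floor_le (g x / r)
  have h2 := Int.lt_floor_add_one (g x / r)
  rw [le_div_iff₀ hr] at h1
  rw [div_lt_iff₀ hr] at h2
  rw [abs_le]
  constructor <;> nlinarith

theorem BddMeas.exists_simpleFunc_near {g : ℝ → ℂ} (hg : BddMeas g) {r : ℝ} (hr : 0 < r) :
    ∃ s : SimpleFunc ℝ ℂ, ∀ x, ‖g x - s x‖ ≤ r := by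
  obtain ⟨C, hC⟩ := hg.bdd
  obtain ⟨s1, h1⟩ := exists_simpleFunc_near_real (Complex.measurable_re.comp hg.measurable)
    (fun x => (Complex.abs_re_le_norm _).trans (hC x)) (half_pos hr)
  obtain ⟨s2, h2⟩ := exists_simpleFunc_near_real (Complex.measurable_im.comp hg.measurable)
    (fun x => (Complex.abs_im_le_norm _).trans (hC x)) (half_pos hr)
  refine ⟨(s1.pair s2).map fun p => (p.1 : ℂ) + p.2 * Complex.I, fun x => ?_⟩
  have := Complex.norm_le_abs_re_add_abs_im (g x - ((s1 x : ℂ) + s2 x * Complex.I))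
  simp at this
  have h1' := h1 x
  have h2' := h2 x
  simp at h1' h2'
  simp
  linarith

/-- Induction principle for bounded Borel functions: a property of indicator functions which is
stable under linear combinations and uniform limits holds for all of them. -/
theorem BddMeas.induction {P : (ℝ → ℂ) → Prop}
    (ind : ∀ B, MeasurableSet B → P (B.indicator 1))
    (add : ∀ g h, BddMeas g → BddMeas h → P g → P h → P (g + h))
    (smul : ∀ (c : ℂ) g, BddMeas g → P g → P (c • g))
    (lim : ∀ g, BddMeas g → (∀ r > 0, ∃ h, BddMeas h ∧ P h ∧ ∀ x, ‖g x - h x‖ ≤ r) → P g)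
    {g : ℝ → ℂ} (hg : BddMeas g) : P g := by
  have hs : ∀ s : SimpleFunc ℝ ℂ, P s := by
    intro s
    induction s using SimpleFunc.induction with
    | const c hB =>
      rename_i B
      have := smul c _ (BddMeas.indicator_one hB) (ind B hB)
      convert this using 1
      ext x
      by_cases h : x ∈ B <;> simp [h]
    | add _ hf hg =>
      exact add _ _ (SimpleFunc.bddMeas _) (SimpleFunc.bddMeas _) hf hg
  refine lim g hg fun r hr => ?_
  obtain ⟨s, h⟩ := hg.exists_simpleFunc_near hr
  exact ⟨s, SimpleFunc.bddMeas s, hs s, h⟩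

/-- Two linear maps on bounded Borel functions that are continuous in the sup norm and agree on
indicators coincide. This is how identities pass from projections to the functional calculus. -/
theorem BddMeas.eq_of_eq_indicator {H : Type*} [NormedAddCommGroup H] [NormedSpace ℂ H]
    {S T : (ℝ → ℂ) → H →L[ℂ] H} {M : ℝ} (hM : 0 ≤ M)
    (hSadd : ∀ g h, BddMeas g → BddMeas h → S (g + h) = S g + S h)
    (hTadd : ∀ g h, BddMeas g → BddMeas h → T (g + h) = T g + T h)
    (hSsmul : ∀ (c : ℂ) g, BddMeas g → S (c • g) = c • S g)
    (hTsmul : ∀ (c : ℂ) g, BddMeas g → T (c • g) = c • T g)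
    (hS : ∀ g C, BddMeas g → (∀ x, ‖g x‖ ≤ C) → ‖S g‖ ≤ M * C)
    (hT : ∀ g C, BddMeas g → (∀ x, ‖g x‖ ≤ C) → ‖T g‖ ≤ M * C)
    (h : ∀ B, MeasurableSet B → S (B.indicator 1) = T (B.indicator 1))
    {g : ℝ → ℂ} (hg : BddMeas g) : S g = T g := by
  refine BddMeas.induction (P := fun g => S g = T g) h ?_ ?_ ?_ hg
  · intro g h hg hh h1 h2
    rw [hSadd g h hg hh, hTadd g h hg hh, h1, h2]
  · intro c g hg h1
    rw [hSsmul c g hg, hTsmul c g hg, h1]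
  · intro g hg h1
    rw [← sub_eq_zero, ← norm_le_zero_iff]
    refine le_of_forall_pos_le_add fun r hr => ?_
    -- The difference is at most `2 * M` times this accuracy; the added `1` covers `M = 0`.
    obtain ⟨s, hs, hs1, hs2⟩ := h1 (r / (2 * M + 1)) (by positivity)
    have hd : BddMeas (g + (-1 : ℂ) • s) := hg.add (hs.smul _)
    have hdC : ∀ x, ‖(g + (-1 : ℂ) • s) x‖ ≤ r / (2 * M + 1) := by
      intro x
      simpa [sub_eq_add_neg] using hs2 x
    have hg' : g = (g + (-1 : ℂ) • s) + s := by ext x; simp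
    have e1 : S g - T g = S (g + (-1 : ℂ) • s) - T (g + (-1 : ℂ) • s) := by
      conv_lhs => rw [hg']
      rw [hSadd _ _ hd hs, hTadd _ _ hd hs, hs1]
      abel
    rw [e1]
    refine (norm_sub_le _ _).trans ((add_le_add (hS _ _ hd hdC) (hT _ _ hd hdC)).trans ?_)
    have e5 : (2 * M + 1) * (r / (2 * M + 1)) = r := by field_simp
    have e6 : 0 < r / (2 * M + 1) := by positivity
    linarith

end BoundedMeasurable

/-! ### Functional calculus of a projection-valued measure. -/

namespace ProjMeasure

variable {H : Type*} [NormedAddCommGroup H] [InnerProductSpace ℂ H] [CompleteSpace H]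

theorem inner_proj (E : ProjMeasure H) (u : H) {B : Set ℝ} (hB : MeasurableSet B) :
    inner ℂ u (E.proj B u) = ((‖E.proj B u‖ ^ 2 : ℝ) : ℂ) := by
  have h := E.isStarProjection B hB
  have h1 : E.proj B (E.proj B u) = E.proj B u :=
    congrArg (fun T : H →L[ℂ] H => T u) h.isIdempotentElem.eq
  have h2 : ContinuousLinearMap.adjoint (E.proj B) = E.proj B := h.isSelfAdjoint
  nth_rewrite 1 [← h1]
  nth_rewrite 1 [← h2]
  rw [ContinuousLinearMap.adjoint_inner_right, inner_self_eq_norm_sq_to_K]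
  simp

theorem scalarMeasure_apply (E : ProjMeasure H) (u : H) {B : Set ℝ} (hB : MeasurableSet B) :
    E.scalarMeasure u B = ENNReal.ofReal (‖E.proj B u‖ ^ 2) := by
  rw [scalarMeasure, Measure.ofMeasurable_apply B hB, E.inner_proj u hB]
  simp only [Complex.ofReal_re]

instance (E : ProjMeasure H) (u : H) : IsFiniteMeasure (E.scalarMeasure u) :=
  ⟨by rw [E.scalarMeasure_apply u MeasurableSet.univ]; exact ENNReal.ofReal_lt_top⟩

theorem scalarMeasure_real_univ (E : ProjMeasure H) (u : H) :
    (E.scalarMeasure u).real Set.univ = ‖u‖ ^ 2 := by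
  rw [Measure.real, E.scalarMeasure_apply u MeasurableSet.univ, E.proj_univ,
    ENNReal.toReal_ofReal (by positivity)]
  simp

theorem isIntegral_indicator (E : ProjMeasure H) {B : Set ℝ} (hB : MeasurableSet B) :
    E.IsIntegral (B.indicator 1) (E.proj B) := by
  intro u
  rw [E.inner_proj u hB, MeasureTheory.integral_indicator hB]
  simp only [Pi.one_apply, integral_const, MeasurableSet.univ, measureReal_restrict_apply,
    Set.univ_inter]
  rw [Measure.real, E.scalarMeasure_apply u hB, ENNReal.toReal_ofReal (by positivity)]
  simp

theorem IsIntegral.add {E : ProjMeasure H} {g h : ℝ → ℂ} {A B : H →L[ℂ] H}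
    (hg : BddMeas g) (hh : BddMeas h) (hA : E.IsIntegral g A) (hB : E.IsIntegral h B) :
    E.IsIntegral (g + h) (A + B) := by
  intro u
  rw [add_apply, inner_add_right, hA u, hB u,
    ← integral_add (hg.integrable _) (hh.integrable _)]
  rfl

theorem IsIntegral.smul {E : ProjMeasure H} {g : ℝ → ℂ} {A : H →L[ℂ] H} (c : ℂ)
    (hA : E.IsIntegral g A) : E.IsIntegral (c • g) (c • A) := by
  intro u
  rw [smul_apply, inner_smul_right, hA u, ← integral_const_mul]
  rfl

/-- The quadratic form is at most `C * ‖u‖ ^ 2`, and polarization transfers this to the sesquilinear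
form. The factor `2` is the price of polarization; only some uniform constant is needed later. -/
theorem IsIntegral.norm_le {E : ProjMeasure H} {g : ℝ → ℂ} {A : H →L[ℂ] H}
    (hA : E.IsIntegral g A) {C : ℝ} (hC : ∀ x, ‖g x‖ ≤ C) : ‖A‖ ≤ 2 * C := by
  have hC0 : 0 ≤ C := (norm_nonneg _).trans (hC 0)
  have hq : ∀ u, ‖inner ℂ (A u) u‖ ≤ C * ‖u‖ ^ 2 := by
    intro u
    rw [norm_inner_symm, hA u, ← E.scalarMeasure_real_univ u]
    exact norm_integral_le_of_norm_le_const (Eventually.of_forall hC)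
  have hp : ∀ x y, ‖inner ℂ (A x) y‖ ≤ C * (‖x‖ ^ 2 + ‖y‖ ^ 2) := by
    intro x y
    have h0 := inner_map_polarization' (A : H →ₗ[ℂ] H) x y
    simp only [ContinuousLinearMap.coe_coe] at h0
    rw [h0, norm_div]
    have e1 := hq (x + y)
    have e2 := hq (x - y)
    have e3 := hq (x + Complex.I • y)
    have e4 := hq (x - Complex.I • y)
    have p1 := parallelogram_law_with_norm ℂ x y
    have p2 := parallelogram_law_with_norm ℂ x (Complex.I • y)
    have hn : ‖Complex.I • y‖ = ‖y‖ := by rw [norm_smul]; simp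
    rw [hn] at p2
    have t1 := norm_sub_le (inner ℂ (A (x + y)) (x + y) - inner ℂ (A (x - y)) (x - y)
      - Complex.I * inner ℂ (A (x + Complex.I • y)) (x + Complex.I • y))
      (-(Complex.I * inner ℂ (A (x - Complex.I • y)) (x - Complex.I • y)))
    have t2 := norm_sub_le (inner ℂ (A (x + y)) (x + y) - inner ℂ (A (x - y)) (x - y))
      (Complex.I * inner ℂ (A (x + Complex.I • y)) (x + Complex.I • y))
    have t3 := norm_sub_le (inner ℂ (A (x + y)) (x + y)) (inner ℂ (A (x - y)) (x - y))
    rw [sub_neg_eq_add] at t1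
    simp only [norm_neg, norm_mul, Complex.norm_I, one_mul] at t1 t2
    have : ‖(4 : ℂ)‖ = 4 := by simp
    rw [this, div_le_iff₀ (by norm_num)]
    nlinarith
  refine ContinuousLinearMap.opNorm_le_bound _ (by positivity) fun x => ?_
  by_cases hx : A x = 0
  · rw [hx, norm_zero]; positivity
  have hAx : 0 < ‖A x‖ := norm_pos_iff.2 hx
  -- The scaling gives the second vector the norm of `x`, which turns the sum of squares into `2 *
  -- ‖x‖ ^ 2`.
  have h := hp x (((‖x‖ / ‖A x‖ : ℝ) : ℂ) • A x)
  rw [inner_smul_right, norm_smul, norm_mul, inner_self_eq_norm_sq_to_K] at h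
  simp only [Complex.norm_real, norm_div, norm_norm, norm_pow, RCLike.norm_ofReal, abs_norm] at h
  have h2 : ‖x‖ / ‖A x‖ * ‖A x‖ = ‖x‖ := by field_simp
  have h3 : ‖x‖ / ‖A x‖ * ‖A x‖ ^ 2 = ‖x‖ * ‖A x‖ := by field_simp
  have h4 : ‖x‖ * ‖A x‖ ≤ C * (‖x‖ ^ 2 + ‖x‖ ^ 2) := by
    rw [h2, h3] at h
    exact h
  have hx0 : 0 < ‖x‖ := by
    rcases (norm_nonneg x).eq_or_lt with h | h
    · exact absurd (by rw [norm_eq_zero.1 h.symm]; simp) hx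
    · exact h
  nlinarith

theorem IsIntegral.unique {E : ProjMeasure H} {g : ℝ → ℂ} {A B : H →L[ℂ] H}
    (hA : E.IsIntegral g A) (hB : E.IsIntegral g B) : A = B := by
  have : (A : H →ₗ[ℂ] H) = B := by
    rw [← ext_inner_map]
    intro x
    rw [← inner_conj_symm, ← inner_conj_symm ((B : H →ₗ[ℂ] H) x)]
    exact congrArg (starRingEnd ℂ) ((hA x).trans (hB x).symm)
  exact ContinuousLinearMap.coe_injective this

/-- By `IsIntegral.norm_le`, uniform approximation of `g` makes the approximating operators Cauchy
in norm; dominated convergence identifies the quadratic form of the limit. -/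
theorem exists_isIntegral (E : ProjMeasure H) {g : ℝ → ℂ} (hg : BddMeas g) :
    ∃ A, E.IsIntegral g A := by
  refine BddMeas.induction (P := fun g => ∃ A, E.IsIntegral g A) ?_ ?_ ?_ ?_ hg
  · exact fun B hB => ⟨_, E.isIntegral_indicator hB⟩
  · rintro g h hg hh ⟨A, hA⟩ ⟨B, hB⟩
    exact ⟨_, hA.add hg hh hB⟩
  · rintro c g _ ⟨A, hA⟩
    exact ⟨_, hA.smul c⟩
  · intro g hg h
    choose s hs hA hbd using fun k : ℕ => (h (1 / ((k : ℝ) + 1)) (by positivity))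
    choose A hA using hA
    have hc : CauchySeq A := by
      refine cauchySeq_of_le_tendsto_0 (fun k : ℕ => 4 * (1 / ((k : ℝ) + 1))) ?_ ?_
      · intro n m N hn hm
        have hsub : E.IsIntegral (s n + (-1 : ℂ) • s m) (A n + (-1 : ℂ) • A m) :=
          (hA n).add (hs n) ((hs m).smul _) ((hA m).smul _)
        have : dist (A n) (A m) = ‖A n + (-1 : ℂ) • A m‖ := by
          rw [dist_eq_norm]; congr 1; simp [sub_eq_add_neg]
        rw [this]
        refine (hsub.norm_le (C := 2 * (1 / ((N : ℝ) + 1))) fun x => ?_).trans (by linarith)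
        have e1 := hbd n x
        have e2 := hbd m x
        have e3 : 1 / ((n : ℝ) + 1) ≤ 1 / ((N : ℝ) + 1) := by gcongr
        have e4 : 1 / ((m : ℝ) + 1) ≤ 1 / ((N : ℝ) + 1) := by gcongr
        have : (s n + (-1 : ℂ) • s m) x = (g x - s m x) - (g x - s n x) := by simp; ring
        rw [this]
        refine (norm_sub_le _ _).trans ?_
        linarith
      · simpa using (tendsto_one_div_add_atTop_nhds_zero_nat (𝕜 := ℝ)).const_mul 4
    obtain ⟨A₀, hA₀⟩ := cauchySeq_tendsto_of_complete hc
    refine ⟨A₀, fun u => ?_⟩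
    have l1 : Tendsto (fun k => inner ℂ u (A k u)) atTop (𝓝 (inner ℂ u (A₀ u))) := by
      have : Tendsto (fun k => A k u) atTop (𝓝 (A₀ u)) :=
        ((ContinuousLinearMap.apply ℂ H u).continuous.tendsto A₀).comp hA₀
      exact tendsto_const_nhds.inner this
    have l2 : Tendsto (fun k => ∫ x, s k x ∂(E.scalarMeasure u)) atTop
        (𝓝 (∫ x, g x ∂(E.scalarMeasure u))) := by
      obtain ⟨C, hC⟩ := hg.bdd
      refine tendsto_integral_of_dominated_convergence (fun _ => C + 1)
        (fun k => (hs k).measurable.aestronglyMeasurable) (integrable_const _) ?_ ?_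
      · refine fun k => Eventually.of_forall fun x => ?_
        have e1 := hbd k x
        have e2 : 1 / ((k : ℝ) + 1) ≤ 1 := by
          rw [div_le_one (by positivity)]; linarith [k.cast_nonneg (α := ℝ)]
        have : s k x = g x - (g x - s k x) := by ring
        rw [this]
        exact (norm_sub_le _ _).trans (add_le_add (hC x) (e1.trans e2))
      · refine Eventually.of_forall fun x => ?_
        rw [tendsto_iff_norm_sub_tendsto_zero]
        refine squeeze_zero (fun _ => norm_nonneg _) (fun k => ?_)
          (tendsto_one_div_add_atTop_nhds_zero_nat (𝕜 := ℝ))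
        rw [norm_sub_rev]
        exact hbd k x
    refine tendsto_nhds_unique l1 ?_
    simpa only [fun k => hA k u] using l2

theorem isIntegral_integral (E : ProjMeasure H) {g : ℝ → ℂ} (hg : BddMeas g) :
    E.IsIntegral g (E.integral g) := by
  have h := E.exists_isIntegral hg
  rw [ProjMeasure.integral, dif_pos h]
  exact h.choose_spec

theorem integral_add (E : ProjMeasure H) {g h : ℝ → ℂ} (hg : BddMeas g) (hh : BddMeas h) :
    E.integral (g + h) = E.integral g + E.integral h :=
  (E.isIntegral_integral (hg.add hh)).unique
    ((E.isIntegral_integral hg).add hg hh (E.isIntegral_integral hh))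

theorem integral_smul (E : ProjMeasure H) (c : ℂ) {g : ℝ → ℂ} (hg : BddMeas g) :
    E.integral (c • g) = c • E.integral g :=
  (E.isIntegral_integral (hg.smul c)).unique ((E.isIntegral_integral hg).smul c)

theorem integral_indicator (E : ProjMeasure H) {B : Set ℝ} (hB : MeasurableSet B) :
    E.integral (B.indicator 1) = E.proj B :=
  (E.isIntegral_integral (BddMeas.indicator_one hB)).unique (E.isIntegral_indicator hB)

theorem norm_integral_le (E : ProjMeasure H) {g : ℝ → ℂ} (hg : BddMeas g) {C : ℝ}
    (hC : ∀ x, ‖g x‖ ≤ C) : ‖E.integral g‖ ≤ 2 * C :=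
  (E.isIntegral_integral hg).norm_le hC

/-- Extends multiplicativity in the second factor from indicators to bounded Borel functions; `A` is
left general so that both uses in `integral_mul` are covered. -/
theorem integral_mul_of_indicator (E : ProjMeasure H) {k : ℝ → ℂ} (hk : BddMeas k)
    {A : H →L[ℂ] H}
    (h : ∀ B, MeasurableSet B → E.integral (k * B.indicator 1) = A * E.proj B)
    {g : ℝ → ℂ} (hg : BddMeas g) : E.integral (k * g) = A * E.integral g := by
  obtain ⟨K, hK⟩ := hk.bdd
  have hK0 : 0 ≤ K := (norm_nonneg _).trans (hK 0)
  have hA0 := norm_nonneg A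
  refine BddMeas.eq_of_eq_indicator (S := fun g => E.integral (k * g)) (T := fun g => A * E.integral g)
    (M := 2 * K + 2 * ‖A‖) (by positivity) ?_ ?_ ?_ ?_ ?_ ?_ ?_ hg
  · intro g h hg hh
    rw [mul_add, E.integral_add (hk.mul hg) (hk.mul hh)]
  · intro g h hg hh
    rw [E.integral_add hg hh, mul_add]
  · intro c g hg
    rw [mul_smul_comm, E.integral_smul c (hk.mul hg)]
  · intro c g hg
    rw [E.integral_smul c hg, mul_smul_comm]
  · intro g C hg hC
    have hC0 : 0 ≤ C := (norm_nonneg _).trans (hC 0)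
    refine (E.norm_integral_le (hk.mul hg) (C := K * C) fun x => by
      simpa using mul_le_mul (hK x) (hC x) (norm_nonneg _) hK0).trans ?_
    nlinarith [mul_nonneg hA0 hC0]
  · intro g C hg hC
    have hC0 : 0 ≤ C := (norm_nonneg _).trans (hC 0)
    refine (norm_mul_le _ _).trans ?_
    have := mul_le_mul_of_nonneg_left (E.norm_integral_le hg hC) hA0
    nlinarith [mul_nonneg hK0 hC0]
  · intro B hB
    rw [h B hB, E.integral_indicator hB]

/-- For two indicators this is `proj_inter`; it is then extended in each factor in turn. -/
theorem integral_mul (E : ProjMeasure H) {k g : ℝ → ℂ} (hk : BddMeas k) (hg : BddMeas g) :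
    E.integral (k * g) = E.integral k * E.integral g := by
  refine E.integral_mul_of_indicator hk (fun B hB => ?_) hg
  have h1 : ∀ {k}, BddMeas k → E.integral (B.indicator 1 * k) = E.proj B * E.integral k := by
    refine E.integral_mul_of_indicator (BddMeas.indicator_one hB) (fun C hC => ?_)
    rw [← E.proj_inter B C hB hC, ← E.integral_indicator (hB.inter hC), Set.inter_indicator_one]
  have hB0 := norm_nonneg (E.proj B)
  refine BddMeas.eq_of_eq_indicator (S := fun k => E.integral (k * B.indicator 1))
    (T := fun k => E.integral k * E.proj B)
    (M := 2 * ‖E.proj B‖) (by positivity) ?_ ?_ ?_ ?_ ?_ ?_ ?_ hk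
  · intro g h hg hh
    simp only [mul_comm _ (B.indicator (1 : ℝ → ℂ))]
    rw [h1 hg, h1 hh, h1 (hg.add hh), E.integral_add hg hh, mul_add]
  · intro g h hg hh
    rw [E.integral_add hg hh, add_mul]
  · intro c g hg
    simp only [mul_comm _ (B.indicator (1 : ℝ → ℂ))]
    rw [h1 hg, h1 (hg.smul c), E.integral_smul c hg, mul_smul_comm]
  · intro c g hg
    rw [E.integral_smul c hg, smul_mul_assoc]
  · intro g C hg hC
    rw [mul_comm g, h1 hg]
    refine (norm_mul_le _ _).trans ?_
    have := mul_le_mul_of_nonneg_left (E.norm_integral_le hg hC) hB0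
    linarith
  · intro g C hg hC
    refine (norm_mul_le _ _).trans ?_
    have := mul_le_mul_of_nonneg_right (E.norm_integral_le hg hC) hB0
    linarith
  · intro C hC
    rw [E.integral_indicator hC, ← E.proj_inter C B hC hB, ← E.integral_indicator (hC.inter hB),
      Set.inter_indicator_one]

end ProjMeasure

/-! ### The operator `J` on spectral subspaces of bounded intervals. -/

namespace ProjMeasure

variable {H : Type*} [NormedAddCommGroup H] [InnerProductSpace ℂ H] [CompleteSpace H]

theorem scalarMeasure_restrict_congr (E : ProjMeasure H) {u v : H} {S : Set ℝ}
    (hS : MeasurableSet S) (h : ∀ B, MeasurableSet B → B ⊆ S → E.proj B u = E.proj B v) :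
    (E.scalarMeasure u).restrict S = (E.scalarMeasure v).restrict S := by
  ext B hB
  rw [Measure.restrict_apply hB, Measure.restrict_apply hB, E.scalarMeasure_apply _ (hB.inter hS),
    E.scalarMeasure_apply _ (hB.inter hS), h _ (hB.inter hS) Set.inter_subset_right]

/-- The product of `g` with the indicator of `B` vanishes, so multiplicativity applies. -/
theorem proj_integral_eq_zero (E : ProjMeasure H) {g : ℝ → ℂ} (hg : BddMeas g) (u : H) {B : Set ℝ}
    (hB : MeasurableSet B) (h : ∀ x ∈ B, g x = 0) : E.proj B (E.integral g u) = 0 := by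
  have h1 : B.indicator (1 : ℝ → ℂ) * g = (0 : ℂ) • g := by
    ext x
    by_cases hx : x ∈ B <;> simp [hx, h]
  have h2 := E.integral_mul (BddMeas.indicator_one hB) hg
  rw [h1, E.integral_smul 0 hg, E.integral_indicator hB, zero_smul] at h2
  exact (congrArg (fun T : H →L[ℂ] H => T u) h2).symm

theorem integral_mem_domain (E : ProjMeasure H) {J : H →ₗ.[ℂ] H} (hE : E.IsSpectralFamilyOf J)
    {g : ℝ → ℂ} (hg : BddMeas g) {R : ℝ} (hR : ∀ x, x ∉ Set.Icc (-R) R → g x = 0) (u : H) :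
    E.integral g u ∈ J.domain := by
  rw [hE.mem_domain_iff]
  have hS : MeasurableSet (Set.Icc (-R) R) := measurableSet_Icc
  have h0 : (E.scalarMeasure (E.integral g u)) (Set.Icc (-R) R)ᶜ = 0 := by
    rw [E.scalarMeasure_apply _ hS.compl, E.proj_integral_eq_zero hg u hS.compl hR]
    simp
  have hae : ∀ᵐ x ∂(E.scalarMeasure (E.integral g u)), x ∈ Set.Icc (-R) R := h0
  refine Integrable.of_bound (by fun_prop) (R ^ 2) (hae.mono fun x hx => ?_)
  rw [Real.norm_of_nonneg (sq_nonneg x)]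
  exact sq_le_sq' hx.1 hx.2

theorem integrable_id_of_mem_domain (E : ProjMeasure H) {J : H →ₗ.[ℂ] H}
    (hE : E.IsSpectralFamilyOf J) {u : H} (hu : u ∈ J.domain) :
    Integrable (fun x : ℝ => (x : ℂ)) (E.scalarMeasure u) := by
  have h := (hE.mem_domain_iff u).1 hu
  refine ((integrable_const (1 : ℝ)).add h).mono' (by fun_prop) (Eventually.of_forall fun x => ?_)
  simp only [Complex.norm_real, Pi.add_apply, Real.norm_eq_abs]
  nlinarith [sq_abs x, sq_nonneg (|x| - 1)]

/-- On the range of a spectral projection of a bounded interval the operator `J` acts as the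
bounded operator of multiplication by `x`. -/
theorem inner_apply_integral (E : ProjMeasure H) {J : H →ₗ.[ℂ] H} (hJ : IsSelfAdjoint J)
    (hE : E.IsSpectralFamilyOf J) {g : ℝ → ℂ} (hg : BddMeas g) {R : ℝ}
    (hR : ∀ x, x ∉ Set.Icc (-R) R → g x = 0) (u : H) (v : J.domain) :
    inner ℂ (J v) (E.integral g u) = inner ℂ (v : H) (E.integral (fun x => (x : ℂ) * g x) u) := by
  set S : Set ℝ := Set.Icc (-R) R with hSdef
  have hS : MeasurableSet S := measurableSet_Icc
  let k : ℝ → ℂ := S.indicator fun x => (x : ℂ)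
  have hk : BddMeas k := by
    refine ⟨Measurable.indicator (by fun_prop) hS, |R|, fun x => ?_⟩
    by_cases hx : x ∈ S
    · simp only [k, Set.indicator_of_mem hx, Complex.norm_real, Real.norm_eq_abs]
      exact (abs_le.2 hx).trans (le_abs_self R)
    · simp only [k, Set.indicator_of_notMem hx, norm_zero, abs_nonneg]
  have hkg : (fun x : ℝ => (x : ℂ) * g x) = k * g := by
    ext x
    by_cases hx : x ∈ S
    · simp [k, hx]
    · simp [k, hx, hR x hx]
  let w : J.domain := ⟨E.integral g u, E.integral_mem_domain hE hg hR u⟩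
  -- The spectral family is linked to `J` only through quadratic forms. The form of `D` sees only
  -- the part of the scalar measure outside `S`, while `w` has no spectral mass there.
  let D : J.domain →ₗ[ℂ] H := J.toFun - (E.integral k : H →ₗ[ℂ] H) ∘ₗ J.domain.subtype
  have hD : ∀ y, D y = J y - E.integral k (y : H) := fun y => rfl
  have hquad : ∀ y : J.domain, inner ℂ (y : H) (D y) =
      ∫ x in Sᶜ, (x : ℂ) ∂(E.scalarMeasure (y : H)) := by
    intro y
    have hi := E.integrable_id_of_mem_domain hE y.2
    rw [hD, inner_sub_right, hE.inner_eq y, E.isIntegral_integral hk, ← integral_complex_ofReal,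
      ← integral_add_compl hS hi, MeasureTheory.integral_indicator hS]
    ring
  have hinv : ∀ c : ℂ, inner ℂ ((v + c • w : J.domain) : H) (D (v + c • w)) =
      inner ℂ (v : H) (D v) := by
    intro c
    rw [hquad, hquad, E.scalarMeasure_restrict_congr hS.compl]
    intro B hB hBS
    have : E.proj B (w : H) = 0 :=
      E.proj_integral_eq_zero hg u hB fun x hx => hR x (hBS hx)
    rw [Submodule.coe_add, Submodule.coe_smul, map_add, map_smul, this, smul_zero, add_zero]
  -- Adding multiples of `w` leaves the form of `D` at `v` unchanged; the multipliers `1`, `-1`, `I`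
  -- separate the cross terms and kill each of them.
  have hpol : inner ℂ (v : H) (D w) = 0 := by
    have e1 := hinv 1
    have e2 := hinv (-1)
    have e3 := hinv Complex.I
    simp only [Submodule.coe_add, Submodule.coe_smul, map_add, map_smul, inner_add_left,
      inner_add_right, inner_smul_left, inner_smul_right, map_one, map_neg, Complex.conj_I] at e1 e2 e3
    have hI := Complex.I_mul_I
    set A := inner ℂ (v : H) (D w)
    set B := inner ℂ (w : H) (D v)
    set C := inner ℂ (w : H) (D w)
    have f1 : A + B + C = 0 := by linear_combination e1
    have f2 : -A - B + C = 0 := by linear_combination e2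
    have f3 : Complex.I * A - Complex.I * B + C = 0 := by
      linear_combination e3 + C * hI
    have fC : C = 0 := by linear_combination (1 / 2) * (f1 + f2)
    have fAB : A - B = 0 := by
      linear_combination (-Complex.I) * f3 + Complex.I * fC + (A - B) * hI
    linear_combination (1 / 2) * (f1 - fC + fAB)
  have hsym : inner ℂ (J v) (w : H) = inner ℂ (v : H) (J w) := by
    have h := LinearPMap.adjoint_isFormalAdjoint hJ.dense_domain
    rw [LinearPMap.isSelfAdjoint_def.1 hJ] at h
    exact h v w
  rw [hD, inner_sub_right, sub_eq_zero] at hpol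
  rw [hkg, E.integral_mul hk hg]
  exact hsym.trans hpol

end ProjMeasure

/-! ### Spectral representation of a Jacobi operator by its orthonormal polynomials. -/

section Jacobi

/-- The standard basis vectors of `ℓ²`. -/
noncomputable def basisVec (n : ℕ) : EllTwo := lp.single 2 n (1 : ℂ)

theorem basisVec_apply (n m : ℕ) : basisVec n m = if m = n then 1 else 0 := by
  rw [basisVec, lp.single_apply, Pi.single_apply]

theorem inner_basisVec (n : ℕ) (u : EllTwo) : inner ℂ (basisVec n) u = u n := by
  rw [basisVec, lp.inner_single_left]
  simp

theorem basisVec_mem_domain (a b : ℕ → ℝ) (n : ℕ) : basisVec n ∈ (jacobiMin a b).domain := by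
  refine Set.Finite.subset (Set.finite_singleton n) ?_
  intro m hm
  by_contra h
  exact hm (by rw [basisVec_apply]; exact if_neg h)

theorem jacobiMin_basisVec_zero (a b : ℕ → ℝ) :
    jacobiMin a b ⟨basisVec 0, basisVec_mem_domain a b 0⟩ =
      (b 0 : ℂ) • basisVec 0 + (a 0 : ℂ) • basisVec 1 := by
  ext m
  rw [lp.coeFn_add, Pi.add_apply, lp.coeFn_smul, lp.coeFn_smul, Pi.smul_apply, Pi.smul_apply]
  change jacobiSeq a b (basisVec 0) m = _
  rcases m with _ | _ | m <;> simp [jacobiSeq, basisVec_apply]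

theorem jacobiMin_basisVec_succ (a b : ℕ → ℝ) (n : ℕ) :
    jacobiMin a b ⟨basisVec (n + 1), basisVec_mem_domain a b (n + 1)⟩ =
      (a n : ℂ) • basisVec n + (b (n + 1) : ℂ) • basisVec (n + 1)
        + (a (n + 1) : ℂ) • basisVec (n + 2) := by
  ext m
  rw [lp.coeFn_add, Pi.add_apply, lp.coeFn_add, Pi.add_apply, lp.coeFn_smul, lp.coeFn_smul,
    lp.coeFn_smul, Pi.smul_apply, Pi.smul_apply, Pi.smul_apply]
  change jacobiSeq a b (basisVec (n + 1)) m = _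
  rcases m with _ | m
  · rcases n with _ | n <;> simp [jacobiSeq, basisVec_apply]
  · simp only [jacobiSeq, basisVec_apply, smul_eq_mul]
    by_cases h1 : m = n + 1
    · subst h1
      simp
      omega
    · by_cases h2 : m = n
      · subst h2
        simp
      · by_cases h3 : m + 1 = n
        · subst h3
          simp
          omega
        · have : m + 2 ≠ n + 1 := by omega
          simp [h1, h2, h3, this]

/-- The components of `∫ g dE e₀` are the integrals of `g` against the orthonormal polynomials. -/
theorem integral_vecZero_apply {a b : ℕ → ℝ} (ha : ∀ n, 0 < a n) {J : EllTwo →ₗ.[ℂ] EllTwo}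
    (hJ : IsJacobiOperator a b J) {E : ProjMeasure EllTwo} (hE : E.IsSpectralFamilyOf J) (n : ℕ)
    {g : ℝ → ℂ} (hg : BddMeas g) {R : ℝ} (hR : ∀ x, x ∉ Set.Icc (-R) R → g x = 0) :
    (E.integral g vecZero) n =
      ∫ l, (((jacobiPoly a b n).eval l : ℝ) : ℂ) * g l ∂(spectralMeasure E) := by
  have hfin : IsFiniteMeasure (spectralMeasure E) :=
    inferInstanceAs (IsFiniteMeasure (E.scalarMeasure vecZero))
  have hint : ∀ (p : Polynomial ℝ) (g : ℝ → ℂ), BddMeas g →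
      (∀ x, x ∉ Set.Icc (-R) R → g x = 0) →
      BddMeas (fun l => ((p.eval l : ℝ) : ℂ) * g l) := by
    intro p g hg hR
    have hpc : Continuous fun l => ((p.eval l : ℝ) : ℂ) := Complex.continuous_ofReal.comp p.continuous
    obtain ⟨C, hC⟩ := (isCompact_Icc (a := -R) (b := R)).exists_bound_of_continuousOn
      hpc.continuousOn
    obtain ⟨D, hD⟩ := hg.bdd
    refine ⟨hpc.measurable.mul hg.measurable, |C| * D, fun x => ?_⟩
    by_cases hx : x ∈ Set.Icc (-R) R
    · rw [norm_mul]
      exact mul_le_mul ((hC x hx).trans (le_abs_self C)) (hD x) (norm_nonneg _) (abs_nonneg _)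
    · rw [hR x hx, mul_zero, norm_zero]
      exact mul_nonneg (abs_nonneg _) ((norm_nonneg _).trans (hD 0))
  -- Moving `J` from a basis vector onto the integral multiplies `g` by the independent variable:
  -- this is the recurrence in weak form.
  have hJe : ∀ n, ∀ g : ℝ → ℂ, BddMeas g → (∀ x, x ∉ Set.Icc (-R) R → g x = 0) →
      inner ℂ (jacobiMin a b ⟨basisVec n, basisVec_mem_domain a b n⟩) (E.integral g vecZero) =
        (E.integral (fun x => (x : ℂ) * g x) vecZero) n := by
    intro n g hg hR
    have hdom := hJ.1.1 (basisVec_mem_domain a b n)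
    have h1 : jacobiMin a b ⟨basisVec n, basisVec_mem_domain a b n⟩ = J ⟨basisVec n, hdom⟩ :=
      hJ.1.2 rfl
    rw [h1, E.inner_apply_integral hJ.2 hE hg hR vecZero, inner_basisVec]
  have hX : ∀ g : ℝ → ℂ, BddMeas g → (∀ x, x ∉ Set.Icc (-R) R → g x = 0) →
      BddMeas (fun x : ℝ => (x : ℂ) * g x) ∧
        ∀ x : ℝ, x ∉ Set.Icc (-R) R → (x : ℂ) * g x = 0 := by
    intro g hg hR
    refine ⟨by simpa using hint Polynomial.X g hg hR, fun x hx => by rw [hR x hx, mul_zero]⟩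
  -- The recurrence has order two, so the induction carries two consecutive indices; it replaces `g`
  -- by `x * g`, so it must range over all `g`.
  have main : ∀ n, (∀ g : ℝ → ℂ, BddMeas g → (∀ x, x ∉ Set.Icc (-R) R → g x = 0) →
      (E.integral g vecZero) n =
        ∫ l, (((jacobiPoly a b n).eval l : ℝ) : ℂ) * g l ∂(spectralMeasure E)) ∧
      (∀ g : ℝ → ℂ, BddMeas g → (∀ x, x ∉ Set.Icc (-R) R → g x = 0) →
      (E.integral g vecZero) (n + 1) =
        ∫ l, (((jacobiPoly a b (n + 1)).eval l : ℝ) : ℂ) * g l ∂(spectralMeasure E)) := by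
    intro n
    induction n with
    | zero =>
      have h0 : ∀ g : ℝ → ℂ, BddMeas g → (∀ x, x ∉ Set.Icc (-R) R → g x = 0) →
          (E.integral g vecZero) 0 =
          ∫ l, (((jacobiPoly a b 0).eval l : ℝ) : ℂ) * g l ∂(spectralMeasure E) := by
        intro g hg hR
        rw [← inner_basisVec]
        simpa [jacobiPoly, basisVec, vecZero, spectralMeasure] using E.isIntegral_integral hg vecZero
      refine ⟨h0, fun g hg hR => ?_⟩
      have h1 := hJe 0 g hg hR
      rw [jacobiMin_basisVec_zero, inner_add_left, inner_smul_left, inner_smul_left,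
        inner_basisVec, inner_basisVec, h0 g hg hR, h0 _ (hX g hg hR).1 (hX g hg hR).2] at h1
      have ha0 : (a 0 : ℂ) ≠ 0 := by exact_mod_cast (ha 0).ne'
      have h2 : ∫ l, (((jacobiPoly a b 1).eval l : ℝ) : ℂ) * g l ∂(spectralMeasure E) =
          (a 0 : ℂ)⁻¹ * (∫ l, (((jacobiPoly a b 0).eval l : ℝ) : ℂ) * (l * g l) ∂(spectralMeasure E)
          - b 0 * ∫ l, (((jacobiPoly a b 0).eval l : ℝ) : ℂ) * g l ∂(spectralMeasure E)) := by
        rw [← integral_const_mul, ← integral_sub, ← integral_const_mul]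
        · congr 1
          ext l
          simp [jacobiPoly]
          ring
        · exact (hint _ _ (hX g hg hR).1 (hX g hg hR).2).integrable _
        · exact ((hint _ g hg hR).integrable _).const_mul _
      rw [h2, ← h1]
      simp only [Complex.conj_ofReal]
      field_simp
      ring
    | succ n ih =>
      obtain ⟨ih0, ih1⟩ := ih
      refine ⟨ih1, fun g hg hR => ?_⟩
      have h1 := hJe (n + 1) g hg hR
      rw [jacobiMin_basisVec_succ, inner_add_left, inner_add_left, inner_smul_left,
        inner_smul_left, inner_smul_left, inner_basisVec, inner_basisVec, inner_basisVec,
        ih0 g hg hR, ih1 g hg hR, ih1 _ (hX g hg hR).1 (hX g hg hR).2] at h1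
      have ha0 : (a (n + 1) : ℂ) ≠ 0 := by exact_mod_cast (ha (n + 1)).ne'
      have h2 : ∫ l, (((jacobiPoly a b (n + 2)).eval l : ℝ) : ℂ) * g l ∂(spectralMeasure E) =
          (a (n + 1) : ℂ)⁻¹ *
          (∫ l, (((jacobiPoly a b (n + 1)).eval l : ℝ) : ℂ) * (l * g l) ∂(spectralMeasure E)
          - b (n + 1) * ∫ l, (((jacobiPoly a b (n + 1)).eval l : ℝ) : ℂ) * g l ∂(spectralMeasure E)
          - a n * ∫ l, (((jacobiPoly a b n).eval l : ℝ) : ℂ) * g l ∂(spectralMeasure E)) := by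
        have i1 := (hint (jacobiPoly a b (n + 1)) _ (hX g hg hR).1 (hX g hg hR).2).integrable
          (spectralMeasure E)
        have i2 := ((hint (jacobiPoly a b (n + 1)) g hg hR).integrable
          (spectralMeasure E)).const_mul (b (n + 1) : ℂ)
        have i3 := ((hint (jacobiPoly a b n) g hg hR).integrable
          (spectralMeasure E)).const_mul (a n : ℂ)
        rw [← integral_const_mul, ← integral_const_mul, ← integral_sub i1 i2,
          ← integral_sub (by exact i1.sub i2) i3, ← integral_const_mul]
        congr 1
        ext l
        simp [jacobiPoly]
        ring
      rw [h2, ← h1]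
      simp only [Complex.conj_ofReal]
      field_simp
      ring
  exact (main n).1 g hg hR

/-- Smoothness of `h` on `L` suffices, because the product vanishes near every point outside the
support of `f`. -/
theorem contDiff_mul_of_tsupport_subset {L : Set ℝ} (hL : IsOpen L) {h f : ℝ → ℂ} {n : ℕ∞ω}
    (hh : ContDiffOn ℝ n h L) (hf : ContDiff ℝ n f) (hfL : tsupport f ⊆ L) :
    ContDiff ℝ n fun l => h l * f l := by
  rw [contDiff_iff_contDiffAt]
  intro l
  by_cases hl : l ∈ tsupport f
  · exact (hh.contDiffAt (hL.mem_nhds (hfL hl))).mul hf.contDiffAt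
  · have : (fun l => h l * f l) =ᶠ[𝓝 l] fun _ => 0 := by
      filter_upwards [notMem_tsupport_iff_eventuallyEq.1 hl] with x hx
      simp [hx]
    exact contDiffAt_const.congr_of_eventuallyEq this

/-- The evolution `exp (-iΘ(J)t) U f` in the spectral representation. -/
theorem exists_spectral_evolution {a b : ℕ → ℝ} (ha : ∀ n, 0 < a n) {J : EllTwo →ₗ.[ℂ] EllTwo}
    (hJ : IsJacobiOperator a b J) {E : ProjMeasure EllTwo} (hE : E.IsSpectralFamilyOf J)
    {L : Set ℝ} (hLo : IsOpen L) {tau : ℝ → ℝ} (htau : ContDiffOn ℝ ∞ tau L)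
    (htau_pos : ∀ l ∈ L, 0 < tau l)
    (hrho : (spectralMeasure E).restrict L =
      (volume.restrict L).withDensity (fun l => ENNReal.ofReal (tau l)))
    {Theta : ℝ → ℝ} (hTheta : Measurable Theta)
    {f : ℝ → ℂ} (hf : ContDiff ℝ ∞ f) (hfc : HasCompactSupport f) (hfL : tsupport f ⊆ L) :
    ∃ u : EllTwo, (∀ n, u n = diagCoord a b L tau f n) ∧
      (∀ t : ℝ, ‖E.integral (fun l => Complex.exp (-(Complex.I * Theta l * t))) u‖ ≤ 2 * ‖u‖) ∧
      ∀ (t : ℝ) n, (E.integral (fun l => Complex.exp (-(Complex.I * Theta l * t))) u) n =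
        ∫ l in L, (((jacobiPoly a b n).eval l * √(tau l) : ℝ) : ℂ) * f l *
          Complex.exp (-(Complex.I * Theta l * t)) := by
  have hsq : ContDiffOn ℝ ∞ (fun l => (((√(tau l))⁻¹ : ℝ) : ℂ)) L := by
    have h1 : ContDiffOn ℝ ∞ (fun l => (√(tau l))⁻¹) L :=
      (htau.sqrt fun l hl => (htau_pos l hl).ne').inv
        fun l hl => (Real.sqrt_pos.2 (htau_pos l hl)).ne'
    exact Complex.ofRealCLM.contDiff.comp_contDiffOn h1
  -- Dividing by the square root turns the weight `tau` of the spectral measure into the factor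
  -- `√tau` of `diagCoord`.
  set phi : ℝ → ℂ := fun l => (((√(tau l))⁻¹ : ℝ) : ℂ) * f l with hphi
  have hphi_smooth : ContDiff ℝ ∞ phi := contDiff_mul_of_tsupport_subset hLo hsq hf hfL
  have hphi_comp : HasCompactSupport phi := hfc.mul_left
  have hphi_bdd : BddMeas phi :=
    ⟨hphi_smooth.continuous.measurable, hphi_comp.exists_bound_of_continuous hphi_smooth.continuous⟩
  obtain ⟨R, hR⟩ : ∃ R : ℝ, ∀ x, x ∉ Set.Icc (-R) R → phi x = 0 := by
    obtain ⟨R, hR⟩ := hphi_comp.isCompact.isBounded.subset_closedBall 0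
    refine ⟨R, fun x hx => image_eq_zero_of_notMem_tsupport fun h => hx ?_⟩
    simpa [Real.closedBall_eq_Icc] using hR h
  have hphiL : ∀ l, l ∉ L → phi l = 0 := fun l hl => by
    have : f l = 0 := image_eq_zero_of_notMem_tsupport fun h => hl (hfL h)
    simp [hphi, this]
  have key : ∀ (g : ℝ → ℂ), BddMeas g → ∀ n, (E.integral (g * phi) vecZero) n =
      ∫ l in L, (((jacobiPoly a b n).eval l * √(tau l) : ℝ) : ℂ) * f l * g l := by
    intro g hg n
    rw [integral_vecZero_apply ha hJ hE n (hg.mul hphi_bdd) (R := R)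
      (fun x hx => by simp [hR x hx]),
      ← setIntegral_eq_integral_of_forall_compl_eq_zero (s := L)
        (fun l hl => by simp [hphiL l hl]), hrho,
      integral_withDensity_eq_integral_toReal_smul₀]
    · refine setIntegral_congr_fun hLo.measurableSet fun l hl => ?_
      have h1 := htau_pos l hl
      have h2 : (√(tau l) : ℂ) ≠ 0 := by exact_mod_cast (Real.sqrt_pos.2 h1).ne'
      have h3 : (tau l : ℂ) = (√(tau l) : ℂ) * (√(tau l) : ℂ) := by
        exact_mod_cast (Real.mul_self_sqrt h1.le).symm
      simp only [ENNReal.toReal_ofReal h1.le, hphi, Pi.mul_apply, Complex.real_smul,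
        Complex.ofReal_mul, Complex.ofReal_inv]
      rw [h3]
      field_simp
    · exact (htau.continuousOn.aemeasurable hLo.measurableSet).ennreal_ofReal
    · exact Eventually.of_forall fun _ => ENNReal.ofReal_lt_top
  have hexp : ∀ t : ℝ, BddMeas fun l => Complex.exp (-(Complex.I * Theta l * t)) := by
    intro t
    refine ⟨by fun_prop, 1, fun x => ?_⟩
    rw [Complex.norm_exp]
    simp
  refine ⟨E.integral phi vecZero, fun n => ?_, fun t => ?_, fun t n => ?_⟩
  · have h1 : BddMeas (1 : ℝ → ℂ) := ⟨measurable_one, 1, fun x => by simp⟩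
    have := key 1 h1 n
    rw [one_mul] at this
    rw [this, diagCoord]
    simp
  · refine (ContinuousLinearMap.le_opNorm _ _).trans ?_
    gcongr
    refine (E.norm_integral_le (hexp t) (C := 1) fun x => ?_).trans (by norm_num)
    rw [Complex.norm_exp]
    simp
  · rw [← key _ (hexp t) n, E.integral_mul (hexp t) hphi_bdd]
    rfl

end Jacobi

/-! ### Oscillatory integrals with a phase comparable to a quadratic one, and the Fresnel integral.
-/

section QuadraticPhase

theorem norm_one_add_I_mul_ge (y : ℝ) : 1 ≤ ‖(1 + Complex.I * y : ℂ)‖ ∧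
    |y| ≤ ‖(1 + Complex.I * y : ℂ)‖ := by
  constructor
  · simpa using Complex.abs_re_le_norm (1 + Complex.I * y : ℂ)
  · simpa using Complex.abs_im_le_norm (1 + Complex.I * y : ℂ)

theorem one_add_I_mul_ne_zero (y : ℝ) : (1 + Complex.I * y : ℂ) ≠ 0 := by
  intro h
  have := (norm_one_add_I_mul_ge y).1
  rw [h, norm_zero] at this
  linarith

theorem integrable_inv_one_add_mul_sq {c : ℝ} (hc : 0 < c) :
    Integrable fun s : ℝ => (1 + c * s ^ 2)⁻¹ := by
  have h := integrable_inv_one_add_sq.comp_mul_left' (Real.sqrt_pos.2 hc).ne'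
  refine h.congr (Eventually.of_forall fun s => ?_)
  simp only [mul_pow, Real.sq_sqrt hc.le]

/-- The remainder `(s G e^{iψ} / (1 + i s ψ'))' - G e^{iψ}`. -/
noncomputable def phaseRemainder (s g g1 : ℂ) (p p1 p2 : ℂ) : ℂ :=
  s * g1 * Complex.exp (Complex.I * p) / (1 + Complex.I * (s * p1)) -
    Complex.I * s * g * (p1 + s * p2) * Complex.exp (Complex.I * p) /
      (1 + Complex.I * (s * p1)) ^ 2

/-- Since `p1` is comparable with `s`, the denominator has modulus at least `max 1 (c * s ^ 2)`. In
the second term the numerator grows like `s ^ 2` but the denominator enters squared, so both terms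
decay like an integrable function depending only on `c` and `C`. -/
theorem norm_phaseRemainder_le {s p p1 p2 : ℝ} {g g1 : ℂ} {c C : ℝ} (hc : 0 < c)
    (h1 : c * |s| ≤ |p1|) (h2 : |p1| ≤ C * |s|) (h3 : |p2| ≤ C) (hg : ‖g‖ ≤ C)
    (hg1 : ‖(s : ℂ) * g1‖ ≤ C) :
    ‖phaseRemainder s g g1 p p1 p2‖ ≤ 2 * (C + 2 * C ^ 2 / c) * (1 + c * s ^ 2)⁻¹ := by
  have hC : 0 ≤ C := (norm_nonneg _).trans hg
  obtain ⟨n1, n2⟩ := norm_one_add_I_mul_ge (s * p1)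
  push_cast at n1 n2
  set N := ‖(1 + Complex.I * (s * p1) : ℂ)‖ with hN
  have hN0 : 0 < N := by linarith
  have hexp : ‖Complex.exp (Complex.I * p)‖ = 1 := by
    rw [mul_comm, Complex.norm_exp_ofReal_mul_I]
  have hs2 : c * s ^ 2 ≤ N := by
    refine le_trans ?_ n2
    rw [abs_mul, ← sq_abs s]
    nlinarith [abs_nonneg s]
  have hinv : N⁻¹ ≤ 2 * (1 + c * s ^ 2)⁻¹ := by
    rw [← div_eq_mul_inv, inv_eq_one_div, div_le_div_iff₀ hN0 (by positivity)]
    linarith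
  have e1 : ‖(s : ℂ) * g1 * Complex.exp (Complex.I * p) / (1 + Complex.I * (s * p1))‖ ≤ C * N⁻¹ := by
    rw [norm_div, norm_mul, hexp, mul_one, ← hN, div_eq_mul_inv]
    gcongr
  have e2 : ‖Complex.I * s * g * (p1 + s * p2) * Complex.exp (Complex.I * p) /
      (1 + Complex.I * (s * p1)) ^ 2‖ ≤ (2 * C ^ 2 / c) * N⁻¹ := by
    rw [norm_div, norm_mul, norm_mul, norm_mul, norm_mul, hexp, mul_one, norm_pow, ← hN,
      Complex.norm_I, one_mul, Complex.norm_real, Real.norm_eq_abs]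
    have f1 : ‖(p1 + s * p2 : ℂ)‖ ≤ 2 * C * |s| := by
      refine (norm_add_le _ _).trans ?_
      rw [norm_mul, Complex.norm_real, Complex.norm_real, Complex.norm_real, Real.norm_eq_abs,
        Real.norm_eq_abs, Real.norm_eq_abs]
      nlinarith [mul_le_mul_of_nonneg_left h3 (abs_nonneg s)]
    have f2 : |s| * ‖g‖ * ‖(p1 + s * p2 : ℂ)‖ ≤ 2 * C ^ 2 * s ^ 2 := by
      calc |s| * ‖g‖ * ‖(p1 + s * p2 : ℂ)‖ ≤ |s| * C * (2 * C * |s|) := by gcongr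
        _ = 2 * C ^ 2 * s ^ 2 := by rw [← sq_abs s]; ring
    rw [div_mul_eq_mul_div, ← div_eq_mul_inv, div_div, div_le_div_iff₀ (by positivity) (by positivity)]
    calc |s| * ‖g‖ * ‖(p1 + s * p2 : ℂ)‖ * (N * c) ≤ 2 * C ^ 2 * s ^ 2 * (N * c) := by gcongr
      _ = 2 * C ^ 2 * N * (c * s ^ 2) := by ring
      _ ≤ 2 * C ^ 2 * N * N := by gcongr
      _ = 2 * C ^ 2 * N ^ 2 := by ring
  calc _ ≤ C * N⁻¹ + (2 * C ^ 2 / c) * N⁻¹ := (norm_sub_le _ _).trans (add_le_add e1 e2)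
    _ = (C + 2 * C ^ 2 / c) * N⁻¹ := by ring
    _ ≤ (C + 2 * C ^ 2 / c) * (2 * (1 + c * s ^ 2)⁻¹) := by gcongr
    _ = _ := by ring

/-- One integration by parts in an oscillatory integral whose phase is comparable with `s²`. -/
theorem integral_phase_eq_neg_integral_remainder {G G1 : ℝ → ℂ} {p p1 p2 : ℝ → ℝ} {c C : ℝ}
    (hc : 0 < c) (hG : ∀ s, HasDerivAt G (G1 s) s)
    (hp : ∀ s, G =ᶠ[𝓝 s] 0 ∨ (HasDerivAt p (p1 s) s ∧ HasDerivAt p1 (p2 s) s ∧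
      c * |s| ≤ |p1 s| ∧ |p1 s| ≤ C * |s| ∧ |p2 s| ≤ C))
    (hGb : ∀ s, ‖G s‖ ≤ C) (hG1b : ∀ s : ℝ, ‖(s : ℂ) * G1 s‖ ≤ C) (hint : Integrable G) :
    (∀ s : ℝ, ‖phaseRemainder s (G s) (G1 s) (p s) (p1 s) (p2 s)‖ ≤
      2 * (C + 2 * C ^ 2 / c) * (1 + c * s ^ 2)⁻¹) ∧
    AEStronglyMeasurable (fun s : ℝ => phaseRemainder s (G s) (G1 s) (p s) (p1 s) (p2 s)) volume ∧
    ∫ s, G s * Complex.exp (Complex.I * p s) =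
      -∫ s : ℝ, phaseRemainder s (G s) (G1 s) (p s) (p1 s) (p2 s) := by
  have hC : 0 ≤ C := (norm_nonneg _).trans (hGb 0)
  -- Nothing is known about the phase where the amplitude vanishes locally; there the amplitude and
  -- its derivative are zero and every expression is trivial.
  have hG0 : ∀ s, G =ᶠ[𝓝 s] 0 → G s = 0 ∧ G1 s = 0 := by
    intro s hs
    exact ⟨hs.eq_of_nhds, (hG s).unique ((hasDerivAt_const s (0 : ℂ)).congr_of_eventuallyEq hs)⟩
  have hbound : ∀ s : ℝ, ‖phaseRemainder s (G s) (G1 s) (p s) (p1 s) (p2 s)‖ ≤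
      2 * (C + 2 * C ^ 2 / c) * (1 + c * s ^ 2)⁻¹ := by
    intro s
    rcases hp s with h | ⟨_, _, h1, h2, h3⟩
    · obtain ⟨h1, h2⟩ := hG0 s h
      rw [h1, h2, phaseRemainder]
      simp only [mul_zero, zero_mul, zero_div, sub_zero, norm_zero]
      positivity
    · exact norm_phaseRemainder_le hc h1 h2 h3 (hGb s) (hG1b s)
  set F : ℝ → ℂ := fun s => G s * Complex.exp (Complex.I * p s) with hF
  set H : ℝ → ℂ := fun s => s * G s * Complex.exp (Complex.I * p s) /
    (1 + Complex.I * (s * p1 s)) with hHdef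
  have hFc : Continuous F := by
    rw [continuous_iff_continuousAt]
    intro s
    rcases hp s with h | ⟨h1, _⟩
    · have : F =ᶠ[𝓝 s] fun _ => 0 := h.mono fun x hx => by simp [hF, hx]
      exact continuousAt_const.congr this.symm
    · have h2 : ContinuousAt (fun s => (p s : ℂ)) s := h1.ofReal_comp.continuousAt
      exact (hG s).continuousAt.mul ((continuousAt_const.mul h2).cexp)
  have hH : ∀ s, HasDerivAt H (F s + phaseRemainder s (G s) (G1 s) (p s) (p1 s) (p2 s)) s := by
    intro s
    rcases hp s with h | ⟨h1, h2, _⟩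
    · obtain ⟨g1, g2⟩ := hG0 s h
      have h0 : H =ᶠ[𝓝 s] fun _ => 0 := h.mono fun x hx => by simp [hHdef, hx]
      have : F s + phaseRemainder s (G s) (G1 s) (p s) (p1 s) (p2 s) = 0 := by
        simp [hF, phaseRemainder, g1, g2]
      rw [this]
      exact (hasDerivAt_const s (0 : ℂ)).congr_of_eventuallyEq h0
    · have hs : HasDerivAt (fun s : ℝ => (s : ℂ)) 1 s := (hasDerivAt_id s).ofReal_comp
      have hN := one_add_I_mul_ne_zero (s * p1 s)
      push_cast at hN
      have d1 := ((hs.mul (hG s)).mul ((h1.ofReal_comp.const_mul Complex.I).cexp)).div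
        (((hs.mul h2.ofReal_comp).const_mul Complex.I).const_add 1) hN
      refine d1.congr_deriv ?_
      simp only [hF, phaseRemainder, Pi.mul_apply]
      generalize hM : (1 + Complex.I * (s * p1 s) : ℂ) = M at hN ⊢
      field_simp
      rw [← hM]
      ring
  -- No measurability of `p2` is assumed; it is bypassed by writing the remainder through `deriv H`.
  have hRm : AEStronglyMeasurable (fun s : ℝ => phaseRemainder s (G s) (G1 s) (p s) (p1 s) (p2 s))
      volume := by
    have : (fun s : ℝ => phaseRemainder s (G s) (G1 s) (p s) (p1 s) (p2 s)) =
        fun s : ℝ => deriv H s - F s := by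
      ext s
      rw [(hH s).deriv]
      ring
    rw [this]
    exact ((measurable_deriv H).sub hFc.measurable).aestronglyMeasurable
  have hRi : Integrable (fun s : ℝ => phaseRemainder s (G s) (G1 s) (p s) (p1 s) (p2 s)) :=
    ((integrable_inv_one_add_mul_sq hc).const_mul _).mono' hRm (Eventually.of_forall hbound)
  have hFi : Integrable F := by
    refine hint.mono hFc.aestronglyMeasurable (Eventually.of_forall fun s => ?_)
    rw [hF, norm_mul, mul_comm Complex.I, Complex.norm_exp_ofReal_mul_I, mul_one]
  have hHi : Integrable H := by
    refine (hint.norm.const_mul (1 + 1 / c)).mono'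
      (continuous_iff_continuousAt.2 fun s => (hH s).continuousAt).aestronglyMeasurable
      (Eventually.of_forall fun s => ?_)
    rcases hp s with h | ⟨_, _, h1, _⟩
    · rw [hHdef]
      simp [h.eq_of_nhds]
    obtain ⟨n1, n2⟩ := norm_one_add_I_mul_ge (s * p1 s)
    push_cast at n1 n2
    simp only [hHdef]
    rw [norm_div, norm_mul, norm_mul, mul_comm Complex.I (p s : ℂ), Complex.norm_exp_ofReal_mul_I,
      mul_one, Complex.norm_real, Real.norm_eq_abs, div_le_iff₀ (by linarith)]
    set N := ‖(1 + Complex.I * (s * p1 s) : ℂ)‖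
    have hs2 : c * |s| ^ 2 ≤ N := by
      refine le_trans ?_ n2
      rw [abs_mul]
      nlinarith [abs_nonneg s]
    have hs : |s| ≤ (1 + 1 / c) * N := by
      rcases le_total |s| 1 with h | h
      · have : 0 ≤ 1 / c * N := by positivity
        linarith
      · have h3 : |s| ≤ 1 / c * N := by
          rw [div_mul_eq_mul_div, one_mul, le_div_iff₀ hc]
          nlinarith
        linarith
    nlinarith [norm_nonneg (G s)]
  refine ⟨hbound, hRm, ?_⟩
  have h0 := integral_eq_zero_of_hasDerivAt_of_integrable hH (hFi.add hRi) hHi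
  rw [integral_add hFi hRi] at h0
  exact eq_neg_of_add_eq_zero_left h0

/-- The limit value of `∫ e^{i a s² / 2} ds`. -/
noncomputable def fresnelConst (a : ℝ) : ℂ := (2 * Real.pi * Complex.I / a) ^ (1 / 2 : ℂ)

/-- The amplitudes tend to a constant, so the integrals themselves have no common integrable
majorant; their integrated-by-parts forms do. The limit is kept as the integral of a remainder, a
substitute for a conditionally convergent integral. -/
theorem tendsto_integral_phase_aux {G G1 : ℕ → ℝ → ℂ} {p p1 p2 : ℕ → ℝ → ℝ} {c C a : ℝ} {G0 : ℂ}
    (hc : 0 < c) (hG : ∀ j s, HasDerivAt (G j) (G1 j s) s)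
    (hp : ∀ᶠ j in atTop, ∀ s, G j =ᶠ[𝓝 s] 0 ∨ (HasDerivAt (p j) (p1 j s) s ∧
      HasDerivAt (p1 j) (p2 j s) s ∧ c * |s| ≤ |p1 j s| ∧ |p1 j s| ≤ C * |s| ∧ |p2 j s| ≤ C))
    (hGb : ∀ j s, ‖G j s‖ ≤ C) (hG1b : ∀ j, ∀ s : ℝ, ‖(s : ℂ) * G1 j s‖ ≤ C)
    (hint : ∀ j, Integrable (G j))
    (lG : ∀ s, Tendsto (fun j => G j s) atTop (𝓝 G0))
    (lG1 : ∀ s, Tendsto (fun j => G1 j s) atTop (𝓝 0))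
    (lp : ∀ s, Tendsto (fun j => p j s) atTop (𝓝 (a * s ^ 2 / 2)))
    (lp1 : ∀ s, Tendsto (fun j => p1 j s) atTop (𝓝 (a * s)))
    (lp2 : ∀ s, Tendsto (fun j => p2 j s) atTop (𝓝 a)) :
    Tendsto (fun j => ∫ s, G j s * Complex.exp (Complex.I * p j s)) atTop
      (𝓝 (-∫ s : ℝ, phaseRemainder s G0 0 ((a * s ^ 2 / 2 : ℝ)) ((a * s : ℝ)) a)) := by
  have hbp := hp.mono fun j hj =>
    integral_phase_eq_neg_integral_remainder hc (hG j) hj (hGb j) (hG1b j) (hint j)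
  have hlim : Tendsto (fun j => -∫ s : ℝ, phaseRemainder s (G j s) (G1 j s) (p j s) (p1 j s) (p2 j s))
      atTop (𝓝 (-∫ s : ℝ, phaseRemainder s G0 0 ((a * s ^ 2 / 2 : ℝ)) ((a * s : ℝ)) a)) := by
    refine (tendsto_integral_filter_of_dominated_convergence
      (fun s => 2 * (C + 2 * C ^ 2 / c) * (1 + c * s ^ 2)⁻¹)
      (hbp.mono fun j h => h.2.1) (hbp.mono fun j h => Eventually.of_forall h.1)
      ((integrable_inv_one_add_mul_sq hc).const_mul _) (Eventually.of_forall fun s => ?_)).neg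
    have cp := (Complex.continuous_ofReal.tendsto _).comp (lp s)
    have cp1 := (Complex.continuous_ofReal.tendsto _).comp (lp1 s)
    have cp2 := (Complex.continuous_ofReal.tendsto _).comp (lp2 s)
    have ce := (Complex.continuous_exp.tendsto _).comp (cp.const_mul Complex.I)
    have cN := (cp1.const_mul (s : ℂ)).const_mul Complex.I |>.const_add 1
    have hN : (1 + Complex.I * (s * ((a * s : ℝ) : ℂ)) : ℂ) ≠ 0 := by
      exact_mod_cast one_add_I_mul_ne_zero (s * (a * s))
    exact ((((lG1 s).const_mul (s : ℂ)).mul ce).div cN hN).sub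
      (((((lG s).const_mul (Complex.I * s)).mul (cp1.add (cp2.const_mul (s : ℂ)))).mul ce).div
        (cN.pow 2) (pow_ne_zero 2 hN))
  exact hlim.congr' (hbp.mono fun j h => h.2.2.symm)

/-- The value is found by applying the previous limit to Gaussian amplitudes with the exact
quadratic phase, where the integral is explicit, and letting the damping tend to zero. -/
theorem neg_integral_phaseRemainder {a : ℝ} (ha : a ≠ 0) :
    -∫ s : ℝ, phaseRemainder s 1 0 ((a * s ^ 2 / 2 : ℝ)) ((a * s : ℝ)) a = fresnelConst a := by
  let e : ℕ → ℝ := fun j => 1 / ((j : ℝ) + 1)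
  have he : ∀ j, 0 < e j := fun j => by positivity
  have hel : Tendsto e atTop (𝓝 0) := tendsto_one_div_add_atTop_nhds_zero_nat
  let G : ℕ → ℝ → ℂ := fun j s => ((Real.exp (-(e j / 2 * s ^ 2)) : ℝ) : ℂ)
  let G1 : ℕ → ℝ → ℂ := fun j s => ((Real.exp (-(e j / 2 * s ^ 2)) * -(e j * s) : ℝ) : ℂ)
  have h1 : Tendsto (fun j => ∫ s : ℝ, G j s * Complex.exp (Complex.I * ((a * s ^ 2 / 2 : ℝ) : ℂ)))
      atTop (𝓝 (-∫ s : ℝ, phaseRemainder s 1 0 ((a * s ^ 2 / 2 : ℝ)) ((a * s : ℝ)) a)) := by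
    -- The `2` in `C` comes from `s * G1`, which is `-2 * y * exp (-y)` for `y = e j / 2 * s ^ 2`.
    refine tendsto_integral_phase_aux (c := |a|) (C := |a| + 2) (abs_pos.2 ha) (G := G) (G1 := G1)
      (p := fun j s => a * s ^ 2 / 2) (p1 := fun j s => a * s) (p2 := fun j s => a)
      ?_ ?_ ?_ ?_ ?_ ?_ ?_ ?_ ?_ ?_
    · intro j s
      have h : HasDerivAt (fun s : ℝ => -(e j / 2 * s ^ 2)) (-(e j * s)) s := by
        refine (((hasDerivAt_pow 2 s).const_mul (e j / 2)).neg).congr_deriv ?_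
        simp
        ring
      exact h.exp.ofReal_comp
    · refine Eventually.of_forall fun j s => Or.inr ⟨?_, ?_, ?_, ?_, ?_⟩
      · refine (((hasDerivAt_pow 2 s).const_mul a).div_const 2).congr_deriv ?_
        simp
        ring
      · simpa using (hasDerivAt_id s).const_mul a
      · rw [abs_mul]
      · rw [abs_mul]
        have := abs_nonneg s
        nlinarith
      · linarith
    · intro j s
      rw [Complex.norm_real, Real.norm_of_nonneg (Real.exp_pos _).le]
      have : Real.exp (-(e j / 2 * s ^ 2)) ≤ 1 := by
        rw [Real.exp_le_one_iff]
        have := he j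
        nlinarith [mul_nonneg this.le (sq_nonneg s)]
      linarith [abs_nonneg a]
    · intro j s
      rw [← Complex.ofReal_mul, Complex.norm_real, Real.norm_eq_abs]
      set y := e j / 2 * s ^ 2 with hy
      have hy0 : 0 ≤ y := by have := he j; positivity
      have e1 : s * (Real.exp (-y) * -(e j * s)) = -(2 * (y * Real.exp (-y))) := by
        rw [hy]; ring
      have e2 : y * Real.exp (-y) ≤ 1 := by
        rw [Real.exp_neg, ← div_eq_mul_inv, div_le_one (Real.exp_pos _)]
        linarith [Real.add_one_le_exp y]
      rw [e1, abs_neg, abs_of_nonneg (by positivity)]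
      linarith [abs_nonneg a]
    · intro j
      have := (integrable_exp_neg_mul_sq (half_pos (he j))).ofReal (𝕜 := ℂ)
      refine this.congr (Eventually.of_forall fun s => ?_)
      simp only [G, neg_mul]
      rfl
    · intro s
      have : Tendsto (fun j => Real.exp (-(e j / 2 * s ^ 2))) atTop (𝓝 1) := by
        have := (Real.continuous_exp.tendsto _).comp (((hel.div_const 2).mul_const (s ^ 2)).neg)
        simpa [Function.comp_def] using this
      exact_mod_cast (Complex.continuous_ofReal.tendsto _).comp this
    · intro s
      have : Tendsto (fun j => Real.exp (-(e j / 2 * s ^ 2)) * -(e j * s)) atTop (𝓝 0) := by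
        have := ((Real.continuous_exp.tendsto _).comp
          (((hel.div_const 2).mul_const (s ^ 2)).neg)).mul (hel.mul_const s).neg
        simpa using this
      exact_mod_cast (Complex.continuous_ofReal.tendsto _).comp this
    · exact fun s => tendsto_const_nhds
    · exact fun s => tendsto_const_nhds
    · exact fun s => tendsto_const_nhds
  have ha' : (a : ℂ) ≠ 0 := by exact_mod_cast ha
  have h2 : Tendsto (fun j => ∫ s : ℝ, G j s * Complex.exp (Complex.I * ((a * s ^ 2 / 2 : ℝ) : ℂ)))
      atTop (𝓝 (fresnelConst a)) := by
    have h3 : ∀ j, ∫ s : ℝ, G j s * Complex.exp (Complex.I * ((a * s ^ 2 / 2 : ℝ) : ℂ)) =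
        (Real.pi / ((e j - Complex.I * a) / 2)) ^ (1 / 2 : ℂ) := by
      intro j
      rw [← integral_gaussian_complex (b := (e j - Complex.I * a) / 2) (by
        have := he j
        simp
        exact this)]
      congr 1
      ext s
      simp only [G]
      rw [Complex.ofReal_exp, ← Complex.exp_add]
      congr 1
      push_cast
      ring
    simp only [h3]
    have hb : Tendsto (fun j => (Real.pi / ((e j - Complex.I * a) / 2) : ℂ)) atTop
        (𝓝 (2 * Real.pi * Complex.I / a)) := by
      have : (2 * Real.pi * Complex.I / a : ℂ) = Real.pi / ((((0 : ℝ) : ℂ) - Complex.I * a) / 2) := by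
        have := Complex.I_ne_zero
        field_simp
        simp
        ring_nf
        simp
      rw [this]
      refine Tendsto.div tendsto_const_nhds
        ((((Complex.continuous_ofReal.tendsto _).comp hel).sub tendsto_const_nhds).div_const _) ?_
      simpa using ha
    refine (continuousAt_cpow_const ?_).tendsto.comp hb
    refine Or.inr ?_
    have : (2 * Real.pi * Complex.I / a : ℂ) = ((2 * Real.pi / a : ℝ) : ℂ) * Complex.I := by
      push_cast; ring
    rw [this, Complex.im_ofReal_mul]
    simp [ha, Real.pi_ne_zero]
  exact tendsto_nhds_unique h1 h2

theorem phaseRemainder_const_mul (s g p p1 p2 : ℂ) :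
    phaseRemainder s g 0 p p1 p2 = g * phaseRemainder s 1 0 p p1 p2 := by
  simp only [phaseRemainder]
  ring

/-- Stationary phase in rescaled form. -/
theorem tendsto_integral_phase {G G1 : ℕ → ℝ → ℂ} {p p1 p2 : ℕ → ℝ → ℝ} {c C a : ℝ} {G0 : ℂ}
    (ha : a ≠ 0) (hc : 0 < c) (hG : ∀ j s, HasDerivAt (G j) (G1 j s) s)
    (hp : ∀ᶠ j in atTop, ∀ s, G j =ᶠ[𝓝 s] 0 ∨ (HasDerivAt (p j) (p1 j s) s ∧
      HasDerivAt (p1 j) (p2 j s) s ∧ c * |s| ≤ |p1 j s| ∧ |p1 j s| ≤ C * |s| ∧ |p2 j s| ≤ C))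
    (hGb : ∀ j s, ‖G j s‖ ≤ C) (hG1b : ∀ j, ∀ s : ℝ, ‖(s : ℂ) * G1 j s‖ ≤ C)
    (hint : ∀ j, Integrable (G j))
    (lG : ∀ s, Tendsto (fun j => G j s) atTop (𝓝 G0))
    (lG1 : ∀ s, Tendsto (fun j => G1 j s) atTop (𝓝 0))
    (lp : ∀ s, Tendsto (fun j => p j s) atTop (𝓝 (a * s ^ 2 / 2)))
    (lp1 : ∀ s, Tendsto (fun j => p1 j s) atTop (𝓝 (a * s)))
    (lp2 : ∀ s, Tendsto (fun j => p2 j s) atTop (𝓝 a)) :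
    Tendsto (fun j => ∫ s, G j s * Complex.exp (Complex.I * p j s)) atTop
      (𝓝 (G0 * fresnelConst a)) := by
  have h := tendsto_integral_phase_aux hc hG hp hGb hG1b hint lG lG1 lp lp1 lp2
  rw [← neg_integral_phaseRemainder ha]
  simp only [phaseRemainder_const_mul _ G0] at h
  rwa [integral_const_mul, ← mul_neg] at h

/-- On the principal branch the argument of `± I` is `± π / 2`, and the square root halves it. -/
theorem fresnelConst_eq {a : ℝ} (ha : a ≠ 0) :
    fresnelConst a = ((√(2 * Real.pi / |a|) : ℝ) : ℂ) *
      Complex.exp (Real.pi * Complex.I * Real.sign a / 4) := by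
  have hpos : 0 < 2 * Real.pi / |a| := by positivity
  have hsqrt : ((√(2 * Real.pi / |a|) : ℝ) : ℂ) =
      Complex.exp (((Real.log (2 * Real.pi / |a|) : ℝ) : ℂ) * (1 / 2)) := by
    rw [Real.sqrt_eq_rpow, Real.rpow_def_of_pos hpos]
    push_cast
    rfl
  rw [hsqrt, ← Complex.exp_add, fresnelConst]
  rcases ha.lt_or_gt with h | h
  · have e1 : (2 * Real.pi * Complex.I / a : ℂ) = ((2 * Real.pi / |a| : ℝ) : ℂ) * (-Complex.I) := by
      rw [abs_of_neg h]; push_cast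
      have : (a : ℂ) ≠ 0 := by exact_mod_cast ha
      field_simp
    have e2 : ((2 * Real.pi / |a| : ℝ) : ℂ) * (-Complex.I) ≠ 0 :=
      mul_ne_zero (by exact_mod_cast hpos.ne') (neg_ne_zero.2 Complex.I_ne_zero)
    rw [e1, Complex.cpow_def_of_ne_zero e2, Complex.log_ofReal_mul hpos
      (neg_ne_zero.2 Complex.I_ne_zero), Complex.log_neg_I, Real.sign_of_neg h]
    congr 1
    push_cast
    ring
  · have e1 : (2 * Real.pi * Complex.I / a : ℂ) = ((2 * Real.pi / |a| : ℝ) : ℂ) * Complex.I := by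
      rw [abs_of_pos h]; push_cast
      ring
    have e2 : ((2 * Real.pi / |a| : ℝ) : ℂ) * Complex.I ≠ 0 :=
      mul_ne_zero (by exact_mod_cast hpos.ne') Complex.I_ne_zero
    rw [e1, Complex.cpow_def_of_ne_zero e2, Complex.log_ofReal_mul hpos
      Complex.I_ne_zero, Complex.log_I, Real.sign_of_pos h]
    congr 1
    push_cast
    ring

end QuadraticPhase

/-! ### Symbol classes uniform in a parameter, and non-stationary phase. -/

section SymbolClass

variable {ι : Type*}

/-- Families of functions whose derivatives up to order `n` exist and are bounded on `O`, uniformly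
in the parameter. -/
def SymbBdd {V : Type*} [NormedAddCommGroup V] [NormedSpace ℝ V] (O : Set ℝ) :
    ℕ → (ι → ℝ → V) → Prop
  | 0, G => ∃ C, ∀ p, ∀ l ∈ O, ‖G p l‖ ≤ C
  | n + 1, G => (∃ C, ∀ p, ∀ l ∈ O, ‖G p l‖ ≤ C) ∧ (∀ p, ∀ l ∈ O, DifferentiableAt ℝ (G p) l) ∧
      SymbBdd O n fun p => deriv (G p)

namespace SymbBdd

section General

variable {V : Type*} [NormedAddCommGroup V] [NormedSpace ℝ V] {O : Set ℝ} {n : ℕ} {G K : ι → ℝ → V}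

theorem bdd (h : SymbBdd O n G) : ∃ C, ∀ p, ∀ l ∈ O, ‖G p l‖ ≤ C := by
  cases n with
  | zero => exact h
  | succ n => exact h.1

theorem of_succ (h : SymbBdd O (n + 1) G) : SymbBdd O n G := by
  induction n generalizing G with
  | zero => exact h.1
  | succ n ih => exact ⟨h.1, h.2.1, ih h.2.2⟩

theorem congr (hO : IsOpen O) (h : SymbBdd O n G) (hGK : ∀ p, Set.EqOn (G p) (K p) O) :
    SymbBdd O n K := by
  induction n generalizing G K with
  | zero =>
    obtain ⟨C, hC⟩ := h
    exact ⟨C, fun p l hl => by rw [← hGK p hl]; exact hC p l hl⟩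
  | succ n ih =>
    obtain ⟨⟨C, hC⟩, h2, h3⟩ := h
    have hev : ∀ p, ∀ l ∈ O, G p =ᶠ[𝓝 l] K p := fun p l hl => (hGK p).eventuallyEq_of_mem
      (hO.mem_nhds hl)
    refine ⟨⟨C, fun p l hl => by rw [← hGK p hl]; exact hC p l hl⟩,
      fun p l hl => (h2 p l hl).congr_of_eventuallyEq (hev p l hl).symm,
      ih h3 fun p l hl => (hev p l hl).deriv_eq⟩

theorem add (hO : IsOpen O) (h : SymbBdd O n G) (h' : SymbBdd O n K) :
    SymbBdd O n fun p l => G p l + K p l := by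
  induction n generalizing G K with
  | zero =>
    obtain ⟨C, hC⟩ := h
    obtain ⟨D, hD⟩ := h'
    exact ⟨C + D, fun p l hl => (norm_add_le _ _).trans (add_le_add (hC p l hl) (hD p l hl))⟩
  | succ n ih =>
    obtain ⟨⟨C, hC⟩, h2, h3⟩ := h
    obtain ⟨⟨D, hD⟩, h2', h3'⟩ := h'
    refine ⟨⟨C + D, fun p l hl => (norm_add_le _ _).trans (add_le_add (hC p l hl) (hD p l hl))⟩,
      fun p l hl => (h2 p l hl).add (h2' p l hl), ?_⟩
    refine congr hO (ih h3 h3') fun p l hl => ?_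
    exact (deriv_fun_add (h2 p l hl) (h2' p l hl)).symm

theorem const_smul (hO : IsOpen O) {c : ι → ℝ} {M : ℝ} (hc : ∀ p, |c p| ≤ M) (h : SymbBdd O n G) :
    SymbBdd O n fun p l => c p • G p l := by
  induction n generalizing G with
  | zero =>
    obtain ⟨C, hC⟩ := h
    refine ⟨M * C, fun p l hl => ?_⟩
    rw [norm_smul, Real.norm_eq_abs]
    exact mul_le_mul (hc p) (hC p l hl) (norm_nonneg _) ((abs_nonneg _).trans (hc p))
  | succ n ih =>
    obtain ⟨⟨C, hC⟩, h2, h3⟩ := h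
    refine ⟨⟨M * C, fun p l hl => ?_⟩, fun p l hl => (h2 p l hl).const_smul (c p), ?_⟩
    · rw [norm_smul, Real.norm_eq_abs]
      exact mul_le_mul (hc p) (hC p l hl) (norm_nonneg _) ((abs_nonneg _).trans (hc p))
    · refine congr hO (ih h3) fun p l hl => ?_
      exact (deriv_fun_const_smul (c p) (h2 p l hl)).symm

theorem of_iteratedDeriv (hO : IsOpen O) (hs : ∀ p, ContDiffOn ℝ ∞ (G p) O)
    (h : ∀ k ≤ n, ∃ C, ∀ p, ∀ l ∈ O, ‖iteratedDeriv k (G p) l‖ ≤ C) : SymbBdd O n G := by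
  induction n generalizing G with
  | zero => simpa [SymbBdd] using h 0 le_rfl
  | succ n ih =>
    refine ⟨by simpa using h 0 (Nat.zero_le _), fun p l hl =>
      ((hs p).differentiableOn (by simp)).differentiableAt (hO.mem_nhds hl), ?_⟩
    refine ih (fun p => (hs p).deriv_of_isOpen hO (by simp)) fun k hk => ?_
    obtain ⟨C, hC⟩ := h (k + 1) (by omega)
    refine ⟨C, fun p l hl => ?_⟩
    rw [← iteratedDeriv_succ']
    exact hC p l hl

theorem of_contDiffOn {L : Set ℝ} (hL : IsOpen L) {g : ℝ → V} (hg : ContDiffOn ℝ ∞ g L)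
    {Q : Set ℝ} (hQ : IsCompact Q) (hQL : Q ⊆ L) (hOQ : O ⊆ Q) :
    SymbBdd O n fun _ : ι => g := by
  have hb : ∀ {g : ℝ → V}, ContDiffOn ℝ ∞ g L → ∃ C, ∀ _ : ι, ∀ l ∈ O, ‖g l‖ ≤ C := by
    intro g hg
    obtain ⟨C, hC⟩ := hQ.exists_bound_of_continuousOn (hg.continuousOn.mono hQL)
    exact ⟨C, fun _ l hl => hC l (hOQ hl)⟩
  induction n generalizing g with
  | zero => exact hb hg
  | succ n ih =>
    exact ⟨hb hg, fun _ l hl => (hg.differentiableOn (by simp)).differentiableAt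
      (hL.mem_nhds (hQL (hOQ hl))), ih (hg.deriv_of_isOpen hL (by simp))⟩

end General

variable {O : Set ℝ} {n : ℕ}

theorem ofReal (hO : IsOpen O) {G : ι → ℝ → ℝ} (h : SymbBdd O n G) :
    SymbBdd O n fun p l => (G p l : ℂ) := by
  induction n generalizing G with
  | zero =>
    obtain ⟨C, hC⟩ := h
    exact ⟨C, fun p l hl => by simpa using hC p l hl⟩
  | succ n ih =>
    obtain ⟨⟨C, hC⟩, h2, h3⟩ := h
    refine ⟨⟨C, fun p l hl => by simpa using hC p l hl⟩,
      fun p l hl => (h2 p l hl).hasDerivAt.ofReal_comp.differentiableAt, ?_⟩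
    refine congr hO (ih h3) fun p l hl => ?_
    exact (h2 p l hl).hasDerivAt.ofReal_comp.deriv.symm

theorem mul (hO : IsOpen O) {G K : ι → ℝ → ℂ} (h : SymbBdd O n G) (h' : SymbBdd O n K) :
    SymbBdd O n fun p l => G p l * K p l := by
  have hb : ∀ {C D : ℝ}, (∀ p, ∀ l ∈ O, ‖G p l‖ ≤ C) → (∀ p, ∀ l ∈ O, ‖K p l‖ ≤ D) →
      ∀ p, ∀ l ∈ O, ‖G p l * K p l‖ ≤ C * D := by
    intro C D hC hD p l hl
    rw [norm_mul]
    exact mul_le_mul (hC p l hl) (hD p l hl) (norm_nonneg _) ((norm_nonneg _).trans (hC p l hl))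
  induction n generalizing G K with
  | zero =>
    obtain ⟨C, hC⟩ := h
    obtain ⟨D, hD⟩ := h'
    exact ⟨C * D, hb hC hD⟩
  | succ n ih =>
    have k := h.of_succ
    have k' := h'.of_succ
    obtain ⟨⟨C, hC⟩, h2, h3⟩ := h
    obtain ⟨⟨D, hD⟩, h2', h3'⟩ := h'
    refine ⟨⟨C * D, hb hC hD⟩, fun p l hl => (h2 p l hl).mul (h2' p l hl), ?_⟩
    have hm : ∀ {G K : ι → ℝ → ℂ}, SymbBdd O n G → SymbBdd O n K →
        SymbBdd O n fun p l => G p l * K p l := by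
      intro G K hG hK
      refine ih hG hK fun {C D} hC hD p l hl => ?_
      rw [norm_mul]
      exact mul_le_mul (hC p l hl) (hD p l hl) (norm_nonneg _) ((norm_nonneg _).trans (hC p l hl))
    refine congr hO (add hO (hm h3 k') (hm k h3')) fun p l hl => ?_
    exact (deriv_fun_mul (h2 p l hl) (h2' p l hl)).symm

/-- The derivative of the inverse contains the inverse only undifferentiated, so the induction
hypothesis one order lower controls it. -/
theorem inv (hO : IsOpen O) {G : ι → ℝ → ℂ} (h : SymbBdd O n G) {c : ℝ} (hc : 0 < c)
    (hG : ∀ p, ∀ l ∈ O, c ≤ ‖G p l‖) : SymbBdd O n fun p l => (G p l)⁻¹ := by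
  have hb : ∀ p, ∀ l ∈ O, ‖(G p l)⁻¹‖ ≤ c⁻¹ := by
    intro p l hl
    rw [norm_inv]
    exact inv_anti₀ hc (hG p l hl)
  induction n with
  | zero => exact ⟨c⁻¹, hb⟩
  | succ n ih =>
    have hi := ih h.of_succ
    obtain ⟨_, h2, h3⟩ := h
    have hne : ∀ p, ∀ l ∈ O, G p l ≠ 0 := fun p l hl h0 => by
      have := hG p l hl
      rw [h0, norm_zero] at this
      linarith
    refine ⟨⟨c⁻¹, hb⟩, fun p l hl => (h2 p l hl).inv (hne p l hl), ?_⟩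
    refine congr hO (mul hO (const_smul hO (c := fun _ => (-1 : ℝ)) (M := 1) (by simp) h3)
      (mul hO hi hi)) fun p l hl => ?_
    have := ((h2 p l hl).hasDerivAt.inv (hne p l hl)).deriv
    change _ = deriv (G p)⁻¹ l
    rw [this]
    have := hne p l hl
    simp
    field_simp

/-- Repeated integration by parts in an oscillatory integral without stationary points. -/
theorem norm_integral_exp_le {Z : Set ℝ} (hO : IsOpen O) (hZ : IsCompact Z)
    (hZO : Z ⊆ O) {S u : ι → ℝ → ℝ} {lam : ι → ℝ} (hlam : ∀ p, 0 < lam p)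
    (hS : ∀ p, ∀ l ∈ O, HasDerivAt (S p) (lam p * u p l) l) (hu : SymbBdd O n u) {c : ℝ}
    (hc : 0 < c) (huc : ∀ p, ∀ l ∈ O, c ≤ |u p l|) {G : ι → ℝ → ℂ} (hG : SymbBdd O n G)
    (hGZ : ∀ p, ∀ l ∉ Z, G p l = 0) :
    ∃ C, ∀ p, ‖∫ l, G p l * Complex.exp (Complex.I * S p l)‖ ≤ C * (lam p)⁻¹ ^ n := by
  induction n generalizing G with
  | zero =>
    obtain ⟨C, hC⟩ := hG
    refine ⟨C * volume.real Z, fun p => ?_⟩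
    rw [← setIntegral_eq_integral_of_forall_compl_eq_zero (s := Z)
      fun l hl => by rw [hGZ p l hl, zero_mul], pow_zero, mul_one]
    refine norm_setIntegral_le_of_norm_le_const hZ.measure_lt_top fun l hl => ?_
    rw [norm_mul, mul_comm Complex.I, Complex.norm_exp_ofReal_mul_I, mul_one]
    exact hC p l (hZO hl)
  | succ n ih =>
    have huinv : SymbBdd O (n + 1) fun p l => ((u p l : ℂ))⁻¹ :=
      inv hO (ofReal hO hu) hc fun p l hl => by simpa using huc p l hl
    -- For `A = G / u` the derivative of `A e^{iS}` is `A' e^{iS} + iλ G e^{iS}`. Integration trades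
    -- one order of the symbol class for one factor of `lam⁻¹`.
    have hA : SymbBdd O (n + 1) fun p l => G p l * ((u p l : ℂ))⁻¹ := mul hO hG huinv
    set A : ι → ℝ → ℂ := fun p l => G p l * ((u p l : ℂ))⁻¹ with hAdef
    have hA0 : ∀ p, ∀ l ∉ Z, A p =ᶠ[𝓝 l] fun _ => 0 := by
      intro p l hl
      filter_upwards [hZ.isClosed.isOpen_compl.mem_nhds hl] with x hx
      simp [hAdef, hGZ p x hx]
    have hA1 : ∀ p, ∀ l ∉ Z, deriv (A p) l = 0 := fun p l hl => by
      rw [(hA0 p l hl).deriv_eq, deriv_const]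
    have hAd : ∀ p l, HasDerivAt (A p) (deriv (A p) l) l := by
      intro p l
      by_cases hl : l ∈ Z
      · exact (hA.2.1 p l (hZO hl)).hasDerivAt
      · rw [hA1 p l hl]
        exact (hasDerivAt_const l (0 : ℂ)).congr_of_eventuallyEq (hA0 p l hl)
    obtain ⟨C, hC⟩ := ih hu.of_succ hA.2.2 hA1
    refine ⟨C, fun p => ?_⟩
    have hlam' : (lam p : ℂ) ≠ 0 := by exact_mod_cast (hlam p).ne'
    set B : ℝ → ℂ := fun l => A p l * Complex.exp (Complex.I * S p l) with hB
    have hcc : ∀ K : ℝ → ℂ, (∀ l ∈ O, ContinuousAt K l) → (∀ l ∉ Z, K l = 0) →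
        Continuous K := by
      intro K h1 h2
      rw [continuous_iff_continuousAt]
      intro l
      by_cases hl : l ∈ Z
      · exact h1 l (hZO hl)
      · refine continuousAt_const.congr (f := fun _ => (0 : ℂ)) ?_
        filter_upwards [hZ.isClosed.isOpen_compl.mem_nhds hl] with x hx
        exact (h2 x hx).symm
    have hcont : ∀ K : ℝ → ℂ, (∀ l ∈ O, ContinuousAt K l) → (∀ l ∉ Z, K l = 0) →
        Integrable K := fun K h1 h2 =>
      (hcc K h1 h2).integrable_of_hasCompactSupport (HasCompactSupport.intro hZ h2)
    have hSc : ∀ l ∈ O, ContinuousAt (fun l => Complex.exp (Complex.I * S p l)) l := fun l hl =>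
      ((hS p l hl).ofReal_comp.const_mul Complex.I).cexp.continuousAt
    have hBd : ∀ l, HasDerivAt B (deriv (A p) l * Complex.exp (Complex.I * S p l) +
        Complex.I * lam p * (G p l * Complex.exp (Complex.I * S p l))) l := by
      intro l
      by_cases hl : l ∈ Z
      · have hu0 : (u p l : ℂ) ≠ 0 := by
          have := huc p l (hZO hl)
          intro h
          rw [Complex.ofReal_eq_zero.1 h, abs_zero] at this
          linarith
        refine ((hAd p l).mul ((hS p l (hZO hl)).ofReal_comp.const_mul Complex.I).cexp).congr_deriv ?_
        simp only [hAdef, Complex.ofReal_mul]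
        field_simp
      · have h0 : B =ᶠ[𝓝 l] fun _ => 0 := (hA0 p l hl).mono fun x hx => by simp [hB, hx]
        rw [hA1 p l hl, hGZ p l hl, zero_mul, mul_zero, add_zero]
        exact (hasDerivAt_const l (0 : ℂ)).congr_of_eventuallyEq h0
    have cG : Continuous fun l => G p l * Complex.exp (Complex.I * S p l) :=
      hcc _ (fun l hl => (hG.2.1 p l hl).continuousAt.mul (hSc l hl))
        fun l hl => by rw [hGZ p l hl, zero_mul]
    have i1 : Integrable fun l => G p l * Complex.exp (Complex.I * S p l) :=
      cG.integrable_of_hasCompactSupport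
        (HasCompactSupport.intro hZ fun l hl => by rw [hGZ p l hl, zero_mul])
    have i2 : Integrable B := hcont _ (fun l _ => (hBd l).continuousAt)
      fun l hl => by rw [hB]; simp [(hA0 p l hl).eq_of_nhds]
    have i3 : Integrable fun l => deriv (A p) l * Complex.exp (Complex.I * S p l) := by
      obtain ⟨D, hD⟩ := hA.2.2.bdd
      -- At the last order the class gives no continuity of `deriv (A p)`, so measurability is read
      -- off from `deriv B`.
      have hm : Measurable fun l => deriv (A p) l * Complex.exp (Complex.I * S p l) := by
        have : (fun l => deriv (A p) l * Complex.exp (Complex.I * S p l)) = fun l =>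
            deriv B l - Complex.I * lam p * (G p l * Complex.exp (Complex.I * S p l)) := by
          ext l
          rw [(hBd l).deriv]
          ring
        rw [this]
        exact (measurable_deriv B).sub (cG.measurable.const_mul _)
      refine IntegrableOn.integrable_of_forall_notMem_eq_zero (s := Z) ?_
        fun l hl => by rw [hA1 p l hl, zero_mul]
      refine Measure.integrableOn_of_bounded hZ.measure_lt_top.ne hm.aestronglyMeasurable (M := D) ?_
      refine (ae_restrict_mem hZ.measurableSet).mono fun l hl => ?_
      rw [norm_mul, mul_comm Complex.I, Complex.norm_exp_ofReal_mul_I, mul_one]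
      exact hD p l (hZO hl)
    have h0 := integral_eq_zero_of_hasDerivAt_of_integrable hBd (i3.add (i1.const_mul _)) i2
    rw [integral_add i3 (i1.const_mul _), integral_const_mul] at h0
    have h1 : ∫ l, G p l * Complex.exp (Complex.I * S p l) =
        -(Complex.I * lam p)⁻¹ * ∫ l, deriv (A p) l * Complex.exp (Complex.I * S p l) := by
      have hI := Complex.I_ne_zero
      rw [eq_neg_of_add_eq_zero_left h0]
      field_simp
    rw [h1, norm_mul, norm_neg, norm_inv, norm_mul, Complex.norm_I, one_mul, Complex.norm_real,
      Real.norm_of_nonneg (hlam p).le, pow_succ]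
    calc (lam p)⁻¹ * ‖∫ l, deriv (A p) l * Complex.exp (Complex.I * S p l)‖
        ≤ (lam p)⁻¹ * (C * (lam p)⁻¹ ^ n) := by
          gcongr
          · exact (inv_pos.2 (hlam p)).le
          · exact hC p
      _ = _ := by ring

end SymbBdd

/-- The Riemann–Lebesgue lemma for a phase without critical points. -/
theorem tendsto_integral_exp_atTop {L : Set ℝ} (hL : IsOpen L) {G : ℝ → ℂ} (hG : ContDiff ℝ ∞ G)
    (hGc : HasCompactSupport G) (hGL : tsupport G ⊆ L) {S : ℝ → ℝ} (hS : ContDiffOn ℝ ∞ S L)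
    (hS1 : ∀ l ∈ L, deriv S l ≠ 0) :
    Tendsto (fun t : ℝ => ∫ l, G l * Complex.exp (Complex.I * ((t * S l : ℝ) : ℂ))) atTop (𝓝 0) := by
  obtain ⟨O, hO, hGO, hOL, hOc⟩ := exists_open_between_and_isCompact_closure hGc.isCompact hL hGL
  have hdS : ContDiffOn ℝ ∞ (deriv S) L := hS.deriv_of_isOpen hL (by simp)
  obtain ⟨c, hc, hcS⟩ : ∃ c > 0, ∀ l ∈ closure O, c ≤ |deriv S l| := by
    rcases (closure O).eq_empty_or_nonempty with h | h
    · exact ⟨1, one_pos, by simp [h]⟩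
    · obtain ⟨l₀, h₀, hmin⟩ := hOc.exists_isMinOn h (hdS.continuousOn.mono hOL).abs
      exact ⟨_, abs_pos.2 (hS1 l₀ (hOL h₀)), fun l hl => hmin hl⟩
  obtain ⟨C, hC⟩ := SymbBdd.norm_integral_exp_le (ι := {t : ℝ // 1 ≤ t}) (n := 1) hO
    hGc.isCompact hGO (S := fun t l => t.1 * S l) (u := fun _ => deriv S) (lam := fun t => t.1)
    (fun t => lt_of_lt_of_le one_pos t.2)
    (fun t l hl => (((hS.differentiableOn (by simp)).differentiableAt
      (hL.mem_nhds (hOL (subset_closure hl)))).hasDerivAt.const_mul t.1))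
    (SymbBdd.of_contDiffOn hL hdS hOc hOL subset_closure) hc
    (fun _ l hl => hcS l (subset_closure hl)) (G := fun _ => G)
    (SymbBdd.of_contDiffOn hL hG.contDiffOn hOc hOL subset_closure)
    (fun _ l hl => image_eq_zero_of_notMem_tsupport hl)
  refine squeeze_zero_norm' (a := fun t => C * t⁻¹) ?_ ?_
  · filter_upwards [eventually_ge_atTop 1] with t ht
    simpa using hC ⟨t, ht⟩
  · simpa using tendsto_inv_atTop_zero.const_mul C

end SymbolClass

/-! ### Phases, change of variables, and reduction of uniform statements to sequences. -/

section PhaseSetting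

/-- The hypotheses on the phases `ω x_n + Φ_n - θ(ω) t`. -/
structure PhaseSetting (L : Set ℝ) (omega theta : ℝ → ℝ) (x : ℕ → ℝ) (Phi : ℕ → ℝ → ℝ) :
    Prop where
  isOpen : IsOpen L
  ordConnected : L.OrdConnected
  omega_smooth : ContDiffOn ℝ ∞ omega L
  omega_pos : ∀ l ∈ L, 0 < deriv omega l
  theta_smooth : ContDiffOn ℝ ∞ theta (omega '' L)
  theta_pos : ∀ mu ∈ omega '' L, 0 < deriv theta mu
  theta_ne : ∀ mu ∈ omega '' L, deriv (deriv theta) mu ≠ 0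
  x_strictMono : StrictMono x
  x_tendsto : Tendsto x atTop atTop
  Phi_smooth : ∀ n, ContDiffOn ℝ ∞ (Phi n) L
  Phi_low : ∀ K ⊆ L, IsCompact K → ∀ k ∈ ({1, 2} : Set ℕ), ∀ r > 0, ∀ᶠ n in atTop, ∀ l ∈ K,
    |iteratedDeriv k (Phi n) l| ≤ r * x n
  Phi_high : ∀ K ⊆ L, IsCompact K → ∀ k : ℕ, 3 ≤ k → ∃ C : ℝ, ∀ᶠ n in atTop, ∀ l ∈ K,
    |iteratedDeriv k (Phi n) l| ≤ C * x n

/-- A compact subset of an open interval lies in the interior of a compact subinterval. -/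
theorem exists_Icc_subset_of_isCompact {L Z : Set ℝ} (hL : IsOpen L) (hL' : L.OrdConnected)
    (hZ : IsCompact Z) (hZL : Z ⊆ L) : ∃ α β, Z ⊆ Set.Ioo α β ∧ Set.Icc α β ⊆ L := by
  rcases Z.eq_empty_or_nonempty with h | h
  · exact ⟨1, 0, by simp [h], by simp⟩
  · obtain ⟨m, hm, hm'⟩ := hZ.exists_isLeast h
    obtain ⟨M, hM, hM'⟩ := hZ.exists_isGreatest h
    obtain ⟨e, he, hme⟩ := Metric.isOpen_iff.1 hL m (hZL hm)
    obtain ⟨e', he', hMe⟩ := Metric.isOpen_iff.1 hL M (hZL hM)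
    refine ⟨m - e / 2, M + e' / 2, fun z hz => ⟨?_, ?_⟩, hL'.out ?_ ?_⟩
    · linarith [hm' hz]
    · linarith [hM' hz]
    · refine hme ?_
      rw [Metric.mem_ball, Real.dist_eq, abs_lt]
      constructor <;> linarith
    · refine hMe ?_
      rw [Metric.mem_ball, Real.dist_eq, abs_lt]
      constructor <;> linarith

namespace PhaseSetting

variable {L : Set ℝ} {omega theta : ℝ → ℝ} {x : ℕ → ℝ} {Phi : ℕ → ℝ → ℝ}

theorem hasStrictDerivAt_omega (h : PhaseSetting L omega theta x Phi) {l : ℝ} (hl : l ∈ L) :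
    HasStrictDerivAt omega (deriv omega l) l :=
  (h.omega_smooth.contDiffAt (h.isOpen.mem_nhds hl)).hasStrictDerivAt (by simp)

theorem strictMonoOn_omega (h : PhaseSetting L omega theta x Phi) : StrictMonoOn omega L := by
  refine strictMonoOn_of_deriv_pos h.ordConnected.convex h.omega_smooth.continuousOn fun l hl => ?_
  exact h.omega_pos l (interior_subset hl)

theorem leftInvOn_omega (h : PhaseSetting L omega theta x Phi) :
    Set.LeftInvOn (Function.invFunOn omega L) omega L :=
  h.strictMonoOn_omega.injOn.leftInvOn_invFunOn

theorem hasStrictDerivAt_invFunOn_omega (h : PhaseSetting L omega theta x Phi) {l : ℝ}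
    (hl : l ∈ L) :
    HasStrictDerivAt (Function.invFunOn omega L) (deriv omega l)⁻¹ (omega l) :=
  (h.hasStrictDerivAt_omega hl).to_local_left_inverse (h.omega_pos l hl).ne'
    (by filter_upwards [h.isOpen.mem_nhds hl] with y hy using h.leftInvOn_omega hy)

theorem isOpen_image (h : PhaseSetting L omega theta x Phi) : IsOpen (omega '' L) := by
  rw [isOpen_iff_mem_nhds]
  rintro _ ⟨l, hl, rfl⟩
  rw [← (h.hasStrictDerivAt_omega hl).map_nhds_eq (h.omega_pos l hl).ne']
  exact image_mem_map (h.isOpen.mem_nhds hl)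

theorem ordConnected_image (h : PhaseSetting L omega theta x Phi) : (omega '' L).OrdConnected :=
  (h.ordConnected.isPreconnected.image _ h.omega_smooth.continuousOn).ordConnected

/-- `θ'(ω(l))` -/
noncomputable def slope (omega theta : ℝ → ℝ) (l : ℝ) : ℝ := deriv theta (omega l)

theorem deriv_theta_smooth (h : PhaseSetting L omega theta x Phi) :
    ContDiffOn ℝ ∞ (deriv theta) (omega '' L) :=
  h.theta_smooth.deriv_of_isOpen h.isOpen_image (by simp)

theorem hasStrictDerivAt_deriv_theta (h : PhaseSetting L omega theta x Phi) {mu : ℝ}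
    (hmu : mu ∈ omega '' L) : HasStrictDerivAt (deriv theta) (deriv (deriv theta) mu) mu :=
  (h.deriv_theta_smooth.contDiffAt (h.isOpen_image.mem_nhds hmu)).hasStrictDerivAt (by simp)

theorem slope_smooth (h : PhaseSetting L omega theta x Phi) :
    ContDiffOn ℝ ∞ (slope omega theta) L :=
  h.deriv_theta_smooth.comp h.omega_smooth (Set.mapsTo_image omega L)

theorem slope_pos (h : PhaseSetting L omega theta x Phi) {l : ℝ} (hl : l ∈ L) :
    0 < slope omega theta l := h.theta_pos _ ⟨l, hl, rfl⟩

theorem hasStrictDerivAt_slope (h : PhaseSetting L omega theta x Phi) {l : ℝ} (hl : l ∈ L) :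
    HasStrictDerivAt (slope omega theta) (deriv (deriv theta) (omega l) * deriv omega l) l :=
  (h.hasStrictDerivAt_deriv_theta ⟨l, hl, rfl⟩).comp l (h.hasStrictDerivAt_omega hl)

theorem deriv_slope (h : PhaseSetting L omega theta x Phi) {l : ℝ} (hl : l ∈ L) :
    deriv (slope omega theta) l = deriv (deriv theta) (omega l) * deriv omega l :=
  (h.hasStrictDerivAt_slope hl).hasDerivAt.deriv

theorem deriv_slope_ne_zero (h : PhaseSetting L omega theta x Phi) {l : ℝ} (hl : l ∈ L) :
    deriv (slope omega theta) l ≠ 0 := by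
  rw [h.deriv_slope hl]
  exact mul_ne_zero (h.theta_ne _ ⟨l, hl, rfl⟩) (h.omega_pos l hl).ne'

theorem injOn_deriv_theta (h : PhaseSetting L omega theta x Phi) :
    Set.InjOn (deriv theta) (omega '' L) := by
  have key : ∀ a ∈ omega '' L, ∀ b ∈ omega '' L, a < b → deriv theta a ≠ deriv theta b := by
    intro a ha b hb hab heq
    have hsub := h.ordConnected_image.out ha hb
    obtain ⟨c, hc, hc'⟩ := exists_deriv_eq_zero hab
      (h.deriv_theta_smooth.continuousOn.mono hsub) heq
    exact h.theta_ne c (hsub (Set.Ioo_subset_Icc_self hc)) hc'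
  intro a ha b hb heq
  rcases lt_trichotomy a b with hab | hab | hab
  · exact absurd heq (key a ha b hb hab)
  · exact hab
  · exact absurd heq.symm (key b hb a ha hab)

theorem derivInv_slope (h : PhaseSetting L omega theta x Phi) {l : ℝ} (hl : l ∈ L) :
    derivInv theta (omega '' L) (slope omega theta l) = omega l :=
  h.injOn_deriv_theta.leftInvOn_invFunOn ⟨l, hl, rfl⟩

theorem hasStrictDerivAt_derivInv (h : PhaseSetting L omega theta x Phi) {l : ℝ} (hl : l ∈ L) :
    HasStrictDerivAt (derivInv theta (omega '' L)) (deriv (deriv theta) (omega l))⁻¹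
      (slope omega theta l) :=
  (h.hasStrictDerivAt_deriv_theta ⟨l, hl, rfl⟩).to_local_left_inverse
    (h.theta_ne _ ⟨l, hl, rfl⟩)
    (by filter_upwards [h.isOpen_image.mem_nhds ⟨l, hl, rfl⟩] with y hy using
      h.injOn_deriv_theta.leftInvOn_invFunOn hy)

theorem image_deriv_theta : deriv theta '' (omega '' L) = slope omega theta '' L := by
  rw [Set.image_image]
  rfl

/-- The point `l ∈ L` at which `θ'(ω(l)) = ξ`. -/
noncomputable def slopeInv (L : Set ℝ) (omega theta : ℝ → ℝ) (xi : ℝ) : ℝ :=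
  Function.invFunOn omega L (derivInv theta (omega '' L) xi)

theorem slopeInv_slope (h : PhaseSetting L omega theta x Phi) {l : ℝ} (hl : l ∈ L) :
    slopeInv L omega theta (slope omega theta l) = l := by
  rw [slopeInv, h.derivInv_slope hl, h.leftInvOn_omega hl]

theorem continuousAt_slopeInv (h : PhaseSetting L omega theta x Phi) {l : ℝ} (hl : l ∈ L) :
    ContinuousAt (slopeInv L omega theta) (slope omega theta l) := by
  refine ContinuousAt.comp (f := derivInv theta (omega '' L)) ?_
    (h.hasStrictDerivAt_derivInv hl).hasDerivAt.continuousAt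
  rw [h.derivInv_slope hl]
  exact (h.hasStrictDerivAt_invFunOn_omega hl).hasDerivAt.continuousAt

theorem phaseMu_omega (h : PhaseSetting L omega theta x Phi) (n : ℕ) {l : ℝ} (hl : l ∈ L) :
    phaseMu L omega Phi n (omega l) = Phi n l := by
  rw [phaseMu, h.leftInvOn_omega hl]

/-- `φ_n'(ω(l))` -/
noncomputable def phaseSlope (omega : ℝ → ℝ) (Phi : ℕ → ℝ → ℝ) (n : ℕ) (l : ℝ) : ℝ :=
  deriv (Phi n) l / deriv omega l

theorem hasDerivAt_Phi (h : PhaseSetting L omega theta x Phi) (n : ℕ) {l : ℝ} (hl : l ∈ L) :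
    HasDerivAt (Phi n) (deriv (Phi n) l) l :=
  (((h.Phi_smooth n).differentiableOn (by simp)).differentiableAt
    (h.isOpen.mem_nhds hl)).hasDerivAt

theorem deriv_phaseMu (h : PhaseSetting L omega theta x Phi) (n : ℕ) {l : ℝ} (hl : l ∈ L) :
    deriv (phaseMu L omega Phi n) (omega l) = phaseSlope omega Phi n l := by
  have h1 := (h.hasStrictDerivAt_invFunOn_omega hl).hasDerivAt
  have h2 : HasDerivAt (Phi n) (deriv (Phi n) l) (Function.invFunOn omega L (omega l)) := by
    rw [h.leftInvOn_omega hl]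
    exact h.hasDerivAt_Phi n hl
  exact (h2.comp (omega l) h1).deriv

theorem deriv_omega_smooth (h : PhaseSetting L omega theta x Phi) :
    ContDiffOn ℝ ∞ (deriv omega) L := h.omega_smooth.deriv_of_isOpen h.isOpen (by simp)

theorem hasDerivAt_deriv_omega (h : PhaseSetting L omega theta x Phi) {l : ℝ} (hl : l ∈ L) :
    HasDerivAt (deriv omega) (deriv (deriv omega) l) l :=
  ((h.deriv_omega_smooth.differentiableOn (by simp)).differentiableAt
    (h.isOpen.mem_nhds hl)).hasDerivAt

theorem phaseSlope_smooth (h : PhaseSetting L omega theta x Phi) (n : ℕ) :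
    ContDiffOn ℝ ∞ (phaseSlope omega Phi n) L :=
  ((h.Phi_smooth n).deriv_of_isOpen h.isOpen (by simp)).div h.deriv_omega_smooth
    fun l hl => (h.omega_pos l hl).ne'

theorem hasDerivAt_phaseSlope (h : PhaseSetting L omega theta x Phi) (n : ℕ) {l : ℝ}
    (hl : l ∈ L) :
    HasDerivAt (phaseSlope omega Phi n) (deriv (phaseSlope omega Phi n) l) l :=
  (((h.phaseSlope_smooth n).differentiableOn (by simp)).differentiableAt
    (h.isOpen.mem_nhds hl)).hasDerivAt

theorem deriv_phaseSlope (h : PhaseSetting L omega theta x Phi) (n : ℕ) {l : ℝ} (hl : l ∈ L) :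
    deriv (phaseSlope omega Phi n) l = (iteratedDeriv 2 (Phi n) l * deriv omega l -
      iteratedDeriv 1 (Phi n) l * deriv (deriv omega) l) / deriv omega l ^ 2 := by
  have h1 : HasDerivAt (deriv (Phi n)) (deriv (deriv (Phi n)) l) l :=
    ((((h.Phi_smooth n).deriv_of_isOpen h.isOpen (m := ∞) (by simp)).differentiableOn
      (by simp)).differentiableAt (h.isOpen.mem_nhds hl)).hasDerivAt
  rw [iteratedDeriv_succ, iteratedDeriv_one]
  exact (h1.div (h.hasDerivAt_deriv_omega hl) (h.omega_pos l hl).ne').deriv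

theorem exists_omega_lower (h : PhaseSetting L omega theta x Phi) {K : Set ℝ} (hK : IsCompact K)
    (hKL : K ⊆ L) : ∃ c > 0, ∀ l ∈ K, c ≤ deriv omega l := by
  rcases K.eq_empty_or_nonempty with h0 | h0
  · exact ⟨1, one_pos, by simp [h0]⟩
  · obtain ⟨l₀, h₀, hmin⟩ := hK.exists_isMinOn h0 (h.deriv_omega_smooth.continuousOn.mono hKL)
    exact ⟨_, h.omega_pos l₀ (hKL h₀), fun l hl => hmin hl⟩

/-- The assumption $\Phi_n',\Phi_n''=o(x_n)$ passes to the variable $\mu=\omega(\lambda)$ because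
`deriv omega` is bounded below on compact sets. -/
theorem phaseSlope_small (h : PhaseSetting L omega theta x Phi) {K : Set ℝ} (hK : IsCompact K)
    (hKL : K ⊆ L) {r : ℝ} (hr : 0 < r) : ∀ᶠ n in atTop, ∀ l ∈ K,
      |phaseSlope omega Phi n l| ≤ r * x n ∧ |deriv (phaseSlope omega Phi n) l| ≤ r * x n := by
  obtain ⟨c, hc, hcK⟩ := h.exists_omega_lower hK hKL
  obtain ⟨M, hM⟩ := hK.exists_bound_of_continuousOn (h.deriv_omega_smooth.continuousOn.mono hKL)
  obtain ⟨M', hM'⟩ := hK.exists_bound_of_continuousOn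
    ((h.deriv_omega_smooth.deriv_of_isOpen h.isOpen (m := ∞) (by simp)).continuousOn.mono hKL)
  set A := max (max M M') 1 with hA
  have hA1 : 1 ≤ A := le_max_right _ _
  have hA0 : 0 < A := by linarith
  -- The first entry serves the quotient itself; the second absorbs the two terms of the quotient
  -- rule over the squared denominator.
  set d := min (r * c) (r * c ^ 2 / (2 * A)) with hd
  have hd0 : 0 < d := by positivity
  filter_upwards [h.Phi_low K hKL hK 1 (by simp) d hd0, h.Phi_low K hKL hK 2 (by simp) d hd0,
    h.x_tendsto.eventually_gt_atTop 0] with n h1 h2 hx l hl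
  have hw := hcK l hl
  have hw0 : 0 < deriv omega l := hc.trans_le hw
  constructor
  · rw [phaseSlope, abs_div, abs_of_pos hw0, div_le_iff₀ hw0]
    have := h1 l hl
    rw [iteratedDeriv_one] at this
    calc _ ≤ d * x n := this
      _ ≤ r * c * x n := by gcongr; exact min_le_left _ _
      _ ≤ r * x n * deriv omega l := by nlinarith [mul_pos hr hx]
  · rw [h.deriv_phaseSlope n (hKL hl), abs_div, abs_of_pos (by positivity : 0 < deriv omega l ^ 2),
      div_le_iff₀ (by positivity)]
    have b1 : |deriv omega l| ≤ A := (hM l hl).trans ((le_max_left _ _).trans (le_max_left _ _))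
    have b2 : |deriv (deriv omega) l| ≤ A :=
      (hM' l hl).trans ((le_max_right _ _).trans (le_max_left _ _))
    calc _ ≤ |iteratedDeriv 2 (Phi n) l| * |deriv omega l| +
          |iteratedDeriv 1 (Phi n) l| * |deriv (deriv omega) l| := by
          rw [← abs_mul, ← abs_mul]
          exact abs_sub _ _
      _ ≤ d * x n * A + d * x n * A := by
          have := h1 l hl
          have := h2 l hl
          gcongr
      _ = d * (2 * A) * x n := by ring
      _ ≤ r * c ^ 2 / (2 * A) * (2 * A) * x n := by gcongr; exact min_le_right _ _
      _ = r * c ^ 2 * x n := by field_simp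
      _ ≤ r * deriv omega l ^ 2 * x n := by gcongr
      _ = _ := by ring

/-- A compactness principle: a property holds for large `t`, uniformly in `n` with `x_n / t ∈ K`,
if it holds somewhere along any sequence with convergent ratios. -/
theorem eventually_of_seq (h : PhaseSetting L omega theta x Phi) {K : Set ℝ} (hK : IsCompact K)
    (hKL : K ⊆ slope omega theta '' L)
    {P : ℕ → ℝ → Prop}
    (hP : ∀ (n : ℕ → ℕ) (t : ℕ → ℝ), ∀ l₀ ∈ L, (∀ j, 0 < t j) → Tendsto t atTop atTop →
      Tendsto n atTop atTop → slope omega theta l₀ ∈ K → (∀ j, x (n j) / t j ∈ K) →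
      Tendsto (fun j => x (n j) / t j) atTop (𝓝 (slope omega theta l₀)) →
      ∃ j, P (n j) (t j)) :
    ∀ᶠ t in atTop, ∀ n, x n / t ∈ K → P n t := by
  -- Failure yields counterexamples with `t ≥ j + 1` for every `j`; along a convergent subsequence
  -- of ratios a single good index contradicts them.
  by_contra hc
  rw [not_eventually, frequently_atTop] at hc
  have hc' : ∀ j : ℕ, ∃ t : ℝ, (j : ℝ) + 1 ≤ t ∧ ∃ n, x n / t ∈ K ∧ ¬ P n t := by
    intro j
    obtain ⟨t, ht, h'⟩ := hc (j + 1)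
    push Not at h'
    exact ⟨t, ht, h'⟩
  choose t ht n hn hnP using hc'
  obtain ⟨xi, hxi, φ, hφ, hlim⟩ := hK.tendsto_subseq hn
  obtain ⟨l₀, hl₀, rfl⟩ := hKL hxi
  have htt : Tendsto t atTop atTop :=
    tendsto_atTop_mono ht (tendsto_atTop_add_const_right _ _ tendsto_natCast_atTop_atTop)
  have htφ := htt.comp hφ.tendsto_atTop
  have ht0 : ∀ j, 0 < t j := fun j => lt_of_lt_of_le (by positivity) (ht j)
  -- The limiting ratio is positive, so `x (n j)` tends to infinity with `t j`; hence so does the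
  -- index, and the assumptions for large `n` become available.
  have hxn : Tendsto (fun j => x (n (φ j))) atTop atTop := by
    have := hlim.pos_mul_atTop (h.slope_pos hl₀) htφ
    refine this.congr fun j => ?_
    simp only [Function.comp]
    exact div_mul_cancel₀ _ (ht0 _).ne'
  have hnn : Tendsto (fun j => n (φ j)) atTop atTop := by
    rw [tendsto_atTop]
    intro N
    filter_upwards [hxn.eventually_ge_atTop (x N)] with j hj
    exact h.x_strictMono.le_iff_le.1 hj
  obtain ⟨j, hj⟩ := hP (n ∘ φ) (t ∘ φ) l₀ hl₀ (fun j => ht0 _) htφ hnn hxi (fun j => hn _) hlim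
  exact hnP _ hj

end PhaseSetting

end PhaseSetting

/-! ### Stationary phase along sequences with convergent ratios. -/

section StationaryPhase

/-- A quadratic Taylor estimate. -/
theorem taylor_quadratic_bound {p p1 p2 : ℝ → ℝ} {a e R s : ℝ} (he : 0 ≤ e) (hs : |s| ≤ R)
    (hp : ∀ y, |y| ≤ R → HasDerivAt p (p1 y) y) (hp1 : ∀ y, |y| ≤ R → HasDerivAt p1 (p2 y) y)
    (h0 : p 0 = 0) (h1 : p1 0 = 0) (h2 : ∀ y, |y| ≤ R → |p2 y - a| ≤ e) :
    |p1 s - a * s| ≤ e * R ∧ |p s - a * s ^ 2 / 2| ≤ e * R * R := by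
  have hR : 0 ≤ R := (abs_nonneg s).trans hs
  have hmem : ∀ y, y ∈ Set.Icc (-R) R ↔ |y| ≤ R := fun y => abs_le.symm
  have hfirst : ∀ y, |y| ≤ R → |p1 y - a * y| ≤ e * R := by
    intro y hy
    have := (convex_Icc (-R) R).norm_image_sub_le_of_norm_hasDerivWithin_le
      (f := fun y => p1 y - a * y) (f' := fun y => p2 y - a) (C := e) (x := 0) (y := y)
      (fun y hy => by
        exact (((hp1 y ((hmem y).1 hy)).sub ((hasDerivAt_id y).const_mul a)).congr_deriv
          (by simp)).hasDerivWithinAt)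
      (fun y hy => h2 y ((hmem y).1 hy)) ((hmem 0).2 (by simpa using hR)) ((hmem y).2 hy)
    simp only [h1, mul_zero, sub_zero, Real.norm_eq_abs] at this
    exact this.trans (by gcongr)
  refine ⟨hfirst s hs, ?_⟩
  have := (convex_Icc (-R) R).norm_image_sub_le_of_norm_hasDerivWithin_le
    (f := fun y => p y - a * y ^ 2 / 2) (f' := fun y => p1 y - a * y) (C := e * R) (x := 0) (y := s)
    (fun y hy => by
      refine ((hp y ((hmem y).1 hy)).sub
        (((hasDerivAt_pow 2 y).const_mul a).div_const 2)).hasDerivWithinAt.congr_deriv ?_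
      simp
      ring)
    (fun y hy => hfirst y ((hmem y).1 hy)) ((hmem 0).2 (by simpa using hR)) ((hmem s).2 hs)
  simp only [h0, sub_zero, Real.norm_eq_abs] at this
  norm_num at this
  exact this.trans (by gcongr)

namespace PhaseSetting

variable {L : Set ℝ} {omega theta : ℝ → ℝ} {x : ℕ → ℝ} {Phi : ℕ → ℝ → ℝ}

/-- The derivative of the phase `ω x_n + Φ_n - θ(ω) t`, divided by `ω'`. -/
noncomputable def reducedDeriv (omega theta : ℝ → ℝ) (x : ℕ → ℝ) (Phi : ℕ → ℝ → ℝ) (n : ℕ)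
    (t l : ℝ) : ℝ :=
  x n + phaseSlope omega Phi n l - slope omega theta l * t

/-- The phase `ω x_n + Φ_n - θ(ω) t`. -/
noncomputable def phase (omega theta : ℝ → ℝ) (x : ℕ → ℝ) (Phi : ℕ → ℝ → ℝ) (n : ℕ)
    (t l : ℝ) : ℝ :=
  omega l * x n + Phi n l - theta (omega l) * t

theorem hasDerivAt_phase (h : PhaseSetting L omega theta x Phi) (n : ℕ) (t : ℝ) {l : ℝ}
    (hl : l ∈ L) :
    HasDerivAt (phase omega theta x Phi n t)
      (deriv omega l * reducedDeriv omega theta x Phi n t l) l := by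
  have hth : HasDerivAt theta (deriv theta (omega l)) (omega l) :=
    ((h.theta_smooth.differentiableOn (by simp)).differentiableAt
      (h.isOpen_image.mem_nhds ⟨l, hl, rfl⟩)).hasDerivAt
  have hw := (h.hasStrictDerivAt_omega hl).hasDerivAt
  have hne := (h.omega_pos l hl).ne'
  refine (((hw.mul_const (x n)).add (h.hasDerivAt_Phi n hl)).sub
    ((hth.comp l hw).mul_const t)).congr_deriv ?_
  simp only [reducedDeriv, phaseSlope, slope]
  field_simp

theorem hasDerivAt_reducedDeriv (h : PhaseSetting L omega theta x Phi) (n : ℕ) (t : ℝ) {l : ℝ}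
    (hl : l ∈ L) :
    HasDerivAt (reducedDeriv omega theta x Phi n t)
      (deriv (phaseSlope omega Phi n) l - deriv (slope omega theta) l * t) l := by
  have h1 := (h.hasStrictDerivAt_slope hl).hasDerivAt
  rw [← h.deriv_slope hl] at h1
  exact ((h.hasDerivAt_phaseSlope n hl).const_add (x n)).sub (h1.mul_const t)

/-- Sequences `n_j → ∞`, `t_j → ∞` with `x_{n_j} / t_j → θ'(ω(l₀))`. -/
structure RatioSeq (L : Set ℝ) (omega theta : ℝ → ℝ) (x : ℕ → ℝ) (n : ℕ → ℕ) (t : ℕ → ℝ)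
    (l₀ : ℝ) : Prop where
  mem : l₀ ∈ L
  t_pos : ∀ j, 0 < t j
  t_tendsto : Tendsto t atTop atTop
  n_tendsto : Tendsto n atTop atTop
  ratio_tendsto : Tendsto (fun j => x (n j) / t j) atTop (𝓝 (slope omega theta l₀))

variable {n : ℕ → ℕ} {t : ℕ → ℝ} {l₀ : ℝ}

theorem RatioSeq.phaseSlope_small (hs : RatioSeq L omega theta x n t l₀)
    (h : PhaseSetting L omega theta x Phi) {K : Set ℝ} (hK : IsCompact K) (hKL : K ⊆ L) {r : ℝ}
    (hr : 0 < r) : ∀ᶠ j in atTop, ∀ l ∈ K, |phaseSlope omega Phi (n j) l / t j| ≤ r ∧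
      |deriv (phaseSlope omega Phi (n j)) l / t j| ≤ r := by
  have hpos := h.slope_pos hs.mem
  set xi := slope omega theta l₀
  have hr' : 0 < r / (xi + 1) := by positivity
  filter_upwards [hs.n_tendsto.eventually (h.phaseSlope_small hK hKL hr'),
    hs.ratio_tendsto.eventually_le_const (lt_add_one xi)] with j h1 h2 l hl
  have ht := hs.t_pos j
  have key : r / (xi + 1) * x (n j) ≤ r * t j := by
    rw [div_le_iff₀ ht] at h2
    calc r / (xi + 1) * x (n j) ≤ r / (xi + 1) * ((xi + 1) * t j) := by gcongr
      _ = r * t j := by field_simp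
  rw [abs_div, abs_div, abs_of_pos ht, div_le_iff₀ ht, div_le_iff₀ ht]
  exact ⟨(h1 l hl).1.trans key, (h1 l hl).2.trans key⟩

theorem RatioSeq.tendsto_prod (hs : RatioSeq L omega theta x n t l₀)
    (h : PhaseSetting L omega theta x Phi) :
    Tendsto (fun p : ℕ × ℝ => phaseSlope omega Phi (n p.1) p.2 / t p.1) (atTop ×ˢ 𝓝 l₀) (𝓝 0) ∧
    Tendsto (fun p : ℕ × ℝ => deriv (phaseSlope omega Phi (n p.1)) p.2 / t p.1)
      (atTop ×ˢ 𝓝 l₀) (𝓝 0) := by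
  obtain ⟨K, hK, hKL, hKc⟩ := local_compact_nhds (h.isOpen.mem_nhds hs.mem)
  have key : ∀ r > 0, ∀ᶠ p : ℕ × ℝ in atTop ×ˢ 𝓝 l₀,
      |phaseSlope omega Phi (n p.1) p.2 / t p.1| < r ∧
      |deriv (phaseSlope omega Phi (n p.1)) p.2 / t p.1| < r := by
    intro r hr
    refine ((hs.phaseSlope_small h hKc hKL (half_pos hr)).prod_mk hK).mono ?_
    rintro ⟨j, l⟩ ⟨h1, h2⟩
    have := h1 l h2
    exact ⟨by linarith [this.1], by linarith [this.2]⟩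
  constructor <;> refine Metric.tendsto_nhds.2 fun r hr => ?_
  · exact (key r hr).mono fun p hp => by simpa [abs_div] using hp.1
  · exact (key r hr).mono fun p hp => by simpa [abs_div] using hp.2

/-- The second derivative of the phase at the stationary point of the limit phase, divided
by `t`. -/
noncomputable def limitHessian (omega theta : ℝ → ℝ) (l : ℝ) : ℝ :=
  -(deriv omega l * deriv (slope omega theta) l)

/-- This is the second derivative of the phase divided by `t`. The term with `deriv (deriv omega)`
disappears because the reduced derivative over `t` vanishes in the limit. The limit is joint in
index and point, as it is used at points moving towards `l₀`. -/
theorem RatioSeq.tendsto_hessian (hs : RatioSeq L omega theta x n t l₀)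
    (h : PhaseSetting L omega theta x Phi) :
    Tendsto (fun p : ℕ × ℝ => deriv (deriv omega) p.2 *
        (reducedDeriv omega theta x Phi (n p.1) (t p.1) p.2 / t p.1) + deriv omega p.2 *
        ((deriv (phaseSlope omega Phi (n p.1)) p.2 - deriv (slope omega theta) p.2 * t p.1) / t p.1))
      (atTop ×ˢ 𝓝 l₀) (𝓝 (limitHessian omega theta l₀)) := by
  obtain ⟨q1, q2⟩ := hs.tendsto_prod h
  have hn := h.isOpen.mem_nhds hs.mem
  have c1 : Tendsto (fun p : ℕ × ℝ => deriv omega p.2) (atTop ×ˢ 𝓝 l₀) (𝓝 (deriv omega l₀)) :=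
    (h.deriv_omega_smooth.continuousOn.continuousAt hn).tendsto.comp tendsto_snd
  have c2 : Tendsto (fun p : ℕ × ℝ => deriv (deriv omega) p.2) (atTop ×ˢ 𝓝 l₀)
      (𝓝 (deriv (deriv omega) l₀)) :=
    ((h.deriv_omega_smooth.deriv_of_isOpen h.isOpen (m := ∞) (by simp)).continuousOn.continuousAt
      hn).tendsto.comp tendsto_snd
  have c3 : Tendsto (fun p : ℕ × ℝ => slope omega theta p.2) (atTop ×ˢ 𝓝 l₀)
      (𝓝 (slope omega theta l₀)) :=
    (h.slope_smooth.continuousOn.continuousAt hn).tendsto.comp tendsto_snd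
  have c4 : Tendsto (fun p : ℕ × ℝ => deriv (slope omega theta) p.2) (atTop ×ˢ 𝓝 l₀)
      (𝓝 (deriv (slope omega theta) l₀)) :=
    ((h.slope_smooth.deriv_of_isOpen h.isOpen (m := ∞) (by simp)).continuousOn.continuousAt
      hn).tendsto.comp tendsto_snd
  have c5 : Tendsto (fun p : ℕ × ℝ => x (n p.1) / t p.1) (atTop ×ˢ 𝓝 l₀)
      (𝓝 (slope omega theta l₀)) := hs.ratio_tendsto.comp tendsto_fst
  have hlim := (c2.mul ((c5.add q1).sub c3)).add (c1.mul (q2.sub c4))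
  have e : deriv (deriv omega) l₀ * (slope omega theta l₀ + 0 - slope omega theta l₀) +
      deriv omega l₀ * (0 - deriv (slope omega theta) l₀) = limitHessian omega theta l₀ := by
    rw [limitHessian]; ring
  rw [e] at hlim
  refine hlim.congr fun p => ?_
  have := (hs.t_pos p.1).ne'
  simp only [reducedDeriv]
  field_simp

theorem limitHessian_ne_zero (h : PhaseSetting L omega theta x Phi) {l : ℝ} (hl : l ∈ L) :
    limitHessian omega theta l ≠ 0 :=
  neg_ne_zero.2 (mul_ne_zero (h.omega_pos l hl).ne' (h.deriv_slope_ne_zero hl))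

/-- The stationary phase method along a sequence. -/
theorem RatioSeq.stationary_phase (hs : RatioSeq L omega theta x n t l₀)
    (h : PhaseSetting L omega theta x Phi) {G : ℝ → ℂ} (hG : ContDiff ℝ ∞ G)
    (hGc : HasCompactSupport G) (hGL : tsupport G ⊆ L) {y : ℕ → ℝ}
    (hy : Tendsto y atTop (𝓝 l₀))
    (hstat : ∀ᶠ j in atTop, reducedDeriv omega theta x Phi (n j) (t j) (y j) = 0) :
    Tendsto (fun j => ((√(t j) : ℝ) : ℂ) *
      Complex.exp (-(Complex.I * phase omega theta x Phi (n j) (t j) (y j))) *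
      ∫ l, G l * Complex.exp (Complex.I * phase omega theta x Phi (n j) (t j) l))
      atTop (𝓝 (G l₀ * fresnelConst (limitHessian omega theta l₀))) := by
  -- The substitution `l = y j + r j * s` with `r j ^ 2 * t j = 1` gives the phase a second
  -- derivative of order one.
  set r : ℕ → ℝ := fun j => (√(t j))⁻¹ with hr
  have hr0 : ∀ j, 0 < r j := fun j => inv_pos.2 (Real.sqrt_pos.2 (hs.t_pos j))
  have hrt : ∀ j, r j * r j * t j = 1 := by
    intro j
    have h1 := Real.mul_self_sqrt (hs.t_pos j).le
    have h2 := (Real.sqrt_pos.2 (hs.t_pos j)).ne'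
    simp only [hr]
    rw [← mul_inv, h1]
    exact inv_mul_cancel₀ (hs.t_pos j).ne'
  have hrl : Tendsto r atTop (𝓝 0) :=
    tendsto_inv_atTop_zero.comp (Real.tendsto_sqrt_atTop.comp hs.t_tendsto)
  have hls : ∀ s, Tendsto (fun j => y j + r j * s) atTop (𝓝 l₀) := fun s => by
    simpa using hy.add (hrl.mul_const s)
  -- a compact interval containing everything of interest
  obtain ⟨α, β, hZ, hQ⟩ := exists_Icc_subset_of_isCompact h.isOpen h.ordConnected
    (hGc.isCompact.union isCompact_singleton) (Set.union_subset hGL (Set.singleton_subset_iff.2 hs.mem))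
  have hZG : tsupport G ⊆ Set.Ioo α β := Set.subset_union_left.trans hZ
  have hl₀ : l₀ ∈ Set.Ioo α β := hZ (Or.inr rfl)
  have hQo : Set.Ioo α β ⊆ L := Set.Ioo_subset_Icc_self.trans hQ
  have hQc : IsCompact (Set.Icc α β) := isCompact_Icc
  obtain ⟨w, hw, hwQ⟩ := h.exists_omega_lower hQc hQ
  obtain ⟨W, hW⟩ := hQc.exists_bound_of_continuousOn (h.deriv_omega_smooth.continuousOn.mono hQ)
  obtain ⟨W', hW'⟩ := hQc.exists_bound_of_continuousOn
    ((h.deriv_omega_smooth.deriv_of_isOpen h.isOpen (m := ∞) (by simp)).continuousOn.mono hQ)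
  have hdT : ContinuousOn (deriv (slope omega theta)) (Set.Icc α β) :=
    (h.slope_smooth.deriv_of_isOpen h.isOpen (m := ∞) (by simp)).continuousOn.mono hQ
  obtain ⟨M, hM⟩ := hQc.exists_bound_of_continuousOn hdT
  obtain ⟨c, hc, hcQ⟩ : ∃ c > 0, ∀ l ∈ Set.Icc α β, c ≤ |deriv (slope omega theta) l| := by
    obtain ⟨l₁, h₁, hmin⟩ := hQc.exists_isMinOn ⟨l₀, Set.Ioo_subset_Icc_self hl₀⟩ hdT.abs
    exact ⟨_, abs_pos.2 (h.deriv_slope_ne_zero (hQ h₁)), fun l hl => hmin hl⟩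
  set D : ℕ → ℝ → ℝ := fun j l => reducedDeriv omega theta x Phi (n j) (t j) l / t j with hD
  set D1 : ℕ → ℝ → ℝ := fun j l =>
    (deriv (phaseSlope omega Phi (n j)) l - deriv (slope omega theta) l * t j) / t j with hD1
  have hDd : ∀ j, ∀ l ∈ L, HasDerivAt (D j) (D1 j l) l := fun j l hl =>
    (h.hasDerivAt_reducedDeriv (n j) (t j) hl).div_const (t j)
  have hD1b : ∀ᶠ j in atTop, ∀ l ∈ Set.Icc α β, c / 2 ≤ |D1 j l| ∧ |D1 j l| ≤ M + c / 2 := by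
    filter_upwards [hs.phaseSlope_small h hQc hQ (half_pos hc)] with j hj l hl
    have e : D1 j l = deriv (phaseSlope omega Phi (n j)) l / t j - deriv (slope omega theta) l := by
      have := (hs.t_pos j).ne'
      simp only [hD1]
      field_simp
    have h1 := (hj l hl).2
    have h2 := hcQ l hl
    have h3 := hM l hl
    rw [Real.norm_eq_abs] at h3
    rw [e]
    have h4 := abs_sub_abs_le_abs_sub (deriv (slope omega theta) l)
      (deriv (phaseSlope omega Phi (n j)) l / t j)
    have h5 := abs_sub (deriv (phaseSlope omega Phi (n j)) l / t j) (deriv (slope omega theta) l)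
    rw [abs_sub_comm] at h4
    constructor <;> linarith
  have hM0 : 0 ≤ M := (norm_nonneg _).trans (hM l₀ (Set.Ioo_subset_Icc_self hl₀))
  have hW0 : 0 ≤ W := (norm_nonneg _).trans (hW l₀ (Set.Ioo_subset_Icc_self hl₀))
  have hW0' : 0 ≤ W' := (norm_nonneg _).trans (hW' l₀ (Set.Ioo_subset_Icc_self hl₀))
  have hyQ : ∀ᶠ j in atTop, y j ∈ Set.Ioo α β := hy.eventually (isOpen_Ioo.mem_nhds hl₀)
  -- Since `D j` vanishes at `y j` and its derivative is bounded away from zero, the mean value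
  -- theorem makes it comparable with the distance to `y j` on the whole interval, not only near the
  -- limit point.
  have hDb : ∀ᶠ j in atTop, ∀ l ∈ Set.Icc α β, c / 2 * |l - y j| ≤ |D j l| ∧
      |D j l| ≤ (M + c / 2) * |l - y j| := by
    filter_upwards [hD1b, hyQ, hstat] with j h1 h2 h3 l hl
    have hz : D j (y j) = 0 := by simp only [hD, h3, zero_div]
    have hcont : ContinuousOn (D j) (Set.Icc α β) := fun l hl =>
      (hDd j l (hQ hl)).continuousAt.continuousWithinAt
    have key : ∃ ζ ∈ Set.Icc α β, D j l = D1 j ζ * (l - y j) := by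
      have hy' := Set.Ioo_subset_Icc_self h2
      rcases lt_trichotomy l (y j) with hlt | heq | hgt
      · have hsub : Set.Icc l (y j) ⊆ Set.Icc α β := Set.Icc_subset_Icc hl.1 hy'.2
        obtain ⟨ζ, hζ, e⟩ := exists_hasDerivAt_eq_slope (D j) (D1 j) hlt (hcont.mono hsub)
          fun u hu => hDd j u (hQ (hsub (Set.Ioo_subset_Icc_self hu)))
        refine ⟨ζ, hsub (Set.Ioo_subset_Icc_self hζ), ?_⟩
        rw [e, hz]
        have : y j - l ≠ 0 := by linarith
        field_simp
        ring
      · exact ⟨y j, hy', by rw [heq, hz, sub_self, mul_zero]⟩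
      · have hsub : Set.Icc (y j) l ⊆ Set.Icc α β := Set.Icc_subset_Icc hy'.1 hl.2
        obtain ⟨ζ, hζ, e⟩ := exists_hasDerivAt_eq_slope (D j) (D1 j) hgt (hcont.mono hsub)
          fun u hu => hDd j u (hQ (hsub (Set.Ioo_subset_Icc_self hu)))
        refine ⟨ζ, hsub (Set.Ioo_subset_Icc_self hζ), ?_⟩
        rw [e, hz]
        have : l - y j ≠ 0 := by linarith
        field_simp
        ring
    obtain ⟨ζ, hζ, e⟩ := key
    rw [e, abs_mul]
    obtain ⟨b1, b2⟩ := h1 ζ hζ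
    exact ⟨by gcongr, by gcongr⟩
  -- the rescaled amplitudes and phases
  have hGd : ∀ l, HasDerivAt G (deriv G l) l := fun l =>
    (hG.differentiable (by simp) l).hasDerivAt
  have hdG : Continuous (deriv G) := hG.continuous_deriv (by simp)
  obtain ⟨B0, hB0⟩ := hGc.exists_bound_of_continuous hG.continuous
  obtain ⟨Y, hY⟩ := hy.norm.bddAbove_range
  have hY' : ∀ j, |y j| ≤ Y := fun j => hY ⟨j, rfl⟩
  -- Serves the bound on `s * G1`: there `s * r j = l - y j`, which is at most `|l| + Y`.
  obtain ⟨B1, hB1⟩ : ∃ B, ∀ l, ‖(((|l| + Y : ℝ)) : ℂ) * deriv G l‖ ≤ B := by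
    refine HasCompactSupport.exists_bound_of_continuous (hGc.deriv.mul_left) ?_
    fun_prop
  set A := max B0 (max B1 (max (W * (M + c / 2)) (W' * ((M + c / 2) * (β - α)) + W * (M + c / 2))))
    with hA
  have hA0 : B0 ≤ A := le_max_left _ _
  have hA1 : B1 ≤ A := (le_max_left _ _).trans (le_max_right _ _)
  have hA2 : W * (M + c / 2) ≤ A :=
    (le_max_left _ _).trans ((le_max_right _ _).trans (le_max_right _ _))
  have hA3 : W' * ((M + c / 2) * (β - α)) + W * (M + c / 2) ≤ A :=
    (le_max_right _ _).trans ((le_max_right _ _).trans (le_max_right _ _))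
  set S : ℕ → ℝ → ℝ := fun j => phase omega theta x Phi (n j) (t j) with hS
  set P : ℕ → ℝ → ℝ := fun j s => S j (y j + r j * s) - S j (y j) with hP
  set P1 : ℕ → ℝ → ℝ := fun j s => r j * t j * (deriv omega (y j + r j * s) *
    D j (y j + r j * s)) with hP1
  set P2 : ℕ → ℝ → ℝ := fun j s => deriv (deriv omega) (y j + r j * s) * D j (y j + r j * s) +
    deriv omega (y j + r j * s) * D1 j (y j + r j * s) with hP2
  have haff : ∀ j s, HasDerivAt (fun s => y j + r j * s) (r j) s := fun j s => by
    simpa using ((hasDerivAt_id s).const_mul (r j)).const_add (y j)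
  have hPd : ∀ j s, y j + r j * s ∈ L → HasDerivAt (P j) (P1 j s) s := by
    intro j s hl
    refine (((h.hasDerivAt_phase (n j) (t j) hl).comp s (haff j s)).sub_const _).congr_deriv ?_
    have := (hs.t_pos j).ne'
    simp only [hP1, hD]
    field_simp
  have hP1d : ∀ j s, y j + r j * s ∈ L → HasDerivAt (P1 j) (P2 j s) s := by
    intro j s hl
    refine ((((h.hasDerivAt_deriv_omega hl).mul (hDd j _ hl)).comp s (haff j s)).const_mul
      (r j * t j)).congr_deriv ?_
    simp only [hP2]
    linear_combination (deriv (deriv omega) (y j + r j * s) * D j (y j + r j * s) +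
      deriv omega (y j + r j * s) * D1 j (y j + r j * s)) * hrt j
  have hHess : ∀ e > 0, ∃ d > 0, ∀ᶠ j in atTop, ∀ l, |l - l₀| < d →
      |deriv (deriv omega) l * D j l + deriv omega l * D1 j l - limitHessian omega theta l₀| < e := by
    intro e he
    have := Metric.tendsto_nhds.1 (hs.tendsto_hessian h) e he
    obtain ⟨pa, ha, pb, hb, hab⟩ := eventually_prod_iff.1 this
    obtain ⟨d, hd, hball⟩ := Metric.eventually_nhds_iff.1 hb
    exact ⟨d, hd, ha.mono fun j hj l hl => hab hj (hball hl)⟩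
  have hunif : ∀ R : ℝ, ∀ d > 0, ∀ᶠ j in atTop, ∀ s, |s| ≤ R → |y j + r j * s - l₀| < d := by
    intro R d hd
    have h1 : ∀ᶠ j in atTop, |y j - l₀| < d / 2 := by
      simpa [Real.dist_eq] using Metric.tendsto_nhds.1 hy (d / 2) (half_pos hd)
    have h2 : ∀ᶠ j in atTop, r j * |R| < d / 2 :=
      Tendsto.eventually_lt_const (half_pos hd) (by simpa using hrl.mul_const |R|)
    filter_upwards [h1, h2] with j h1 h2 s hsR
    have h3 : |r j * s| ≤ r j * |R| := by
      rw [abs_mul, abs_of_pos (hr0 j)]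
      have := hr0 j
      have := hsR.trans (le_abs_self R)
      gcongr
    have h4 := abs_add_le (y j - l₀) (r j * s)
    have : y j + r j * s - l₀ = y j - l₀ + r j * s := by ring
    rw [this]
    linarith
  obtain ⟨d₀, hd₀, hd₀L⟩ := Metric.isOpen_iff.1 h.isOpen l₀ hs.mem
  -- The rescaled phase and its derivative vanish at zero, so convergence of the second derivative
  -- on a bounded range of `s` determines all three limits.
  have hTaylor : ∀ s, ∀ e > 0, ∀ᶠ j in atTop, |P2 j s - limitHessian omega theta l₀| < e ∧
      |P1 j s - limitHessian omega theta l₀ * s| ≤ e * |s| ∧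
      |P j s - limitHessian omega theta l₀ * s ^ 2 / 2| ≤ e * |s| * |s| := by
    intro s e he
    obtain ⟨d, hd, hdj⟩ := hHess e he
    filter_upwards [hdj, hunif |s| d hd, hunif |s| d₀ hd₀, hstat] with j h1 h2 h3 h4
    have hb : ∀ u, |u| ≤ |s| → |P2 j u - limitHessian omega theta l₀| < e := fun u hu =>
      h1 _ (h2 u hu)
    have hL : ∀ u, |u| ≤ |s| → y j + r j * u ∈ L := fun u hu => hd₀L (by
      rw [Metric.mem_ball, Real.dist_eq]; exact h3 u hu)
    refine ⟨hb s le_rfl, taylor_quadratic_bound he.le le_rfl (fun u hu => hPd j u (hL u hu))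
      (fun u hu => hP1d j u (hL u hu)) ?_ ?_ fun u hu => (hb u hu).le⟩
    · simp [hP]
    · simp [hP1, hD, h4]
  have hsqueeze : ∀ {f : ℕ → ℝ} {z K : ℝ}, 0 ≤ K → (∀ e > 0, ∀ᶠ j in atTop, |f j - z| ≤ e * K) →
      Tendsto f atTop (𝓝 z) := by
    intro f z K hK hf
    refine Metric.tendsto_nhds.2 fun e he => ?_
    filter_upwards [hf (e / (K + 1)) (by positivity)] with j hj
    rw [Real.dist_eq]
    refine hj.trans_lt ?_
    rw [div_mul_eq_mul_div, div_lt_iff₀ (by positivity)]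
    linarith
  have main := tendsto_integral_phase (G := fun j s => G (y j + r j * s))
    (G1 := fun j s => deriv G (y j + r j * s) * r j) (p := P) (p1 := P1) (p2 := P2)
    (c := w * (c / 2)) (C := A) (a := limitHessian omega theta l₀) (G0 := G l₀)
    (h.limitHessian_ne_zero hs.mem) (by positivity) ?_ ?_ ?_ ?_ ?_ ?_ ?_ ?_ ?_ ?_
  -- Undoing the substitution: the Jacobian `(r j)⁻¹` supplies the factor `√(t j)`.
  · refine main.congr fun j => ?_
    have hsq : 0 < √(t j) := Real.sqrt_pos.2 (hs.t_pos j)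
    have e1 : ∀ s : ℝ, G (y j + r j * s) * Complex.exp (Complex.I * P j s) =
        (fun s => Complex.exp (-(Complex.I * S j (y j))) *
          (G (y j + s) * Complex.exp (Complex.I * S j (y j + s)))) (r j * s) := by
      intro s
      simp only [hP]
      rw [mul_left_comm, ← Complex.exp_add]
      congr 2
      push_cast
      ring
    simp only [e1]
    rw [Measure.integral_comp_mul_left (fun s => Complex.exp (-(Complex.I * S j (y j))) *
          (G (y j + s) * Complex.exp (Complex.I * S j (y j + s)))) (r j), integral_const_mul,
      integral_add_left_eq_self (fun s => G s * Complex.exp (Complex.I * S j s)) (y j)]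
    simp only [hr, inv_inv, abs_of_pos hsq, Complex.real_smul, hS]
    ring
  · intro j s
    have := (hGd (y j + r j * s)).scomp s (haff j s)
    refine this.congr_deriv ?_
    rw [Complex.real_smul, mul_comm]
  · filter_upwards [hDb, hD1b, hyQ] with j h1 h2 h3 s
    by_cases hl : y j + r j * s ∈ tsupport G
    · right
      have hl' := hZG hl
      have hlQ := Set.Ioo_subset_Icc_self hl'
      have hlL := hQ hlQ
      obtain ⟨b1, b2⟩ := h1 _ hlQ
      obtain ⟨b3, b4⟩ := h2 _ hlQ
      have hw1 := hwQ _ hlQ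
      have hw2 := hW _ hlQ
      have hw3 := hW' _ hlQ
      rw [Real.norm_eq_abs] at hw2 hw3
      have hwp : 0 < deriv omega (y j + r j * s) := hw.trans_le hw1
      have hdiff : |y j + r j * s - y j| = r j * |s| := by
        rw [add_sub_cancel_left, abs_mul, abs_of_pos (hr0 j)]
      have hrtp : 0 < r j * t j := mul_pos (hr0 j) (hs.t_pos j)
      have e1 : |P1 j s| = r j * t j * (|deriv omega (y j + r j * s)| *
          |D j (y j + r j * s)|) := by
        simp only [hP1]
        rw [abs_mul, abs_of_pos hrtp, abs_mul]
      have hone : ∀ K : ℝ, r j * t j * (K * (r j * |s|)) = K * |s| := fun K => by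
        linear_combination K * |s| * hrt j
      refine ⟨hPd j s hlL, hP1d j s hlL, ?_, ?_, ?_⟩
      · rw [e1, ← hone, mul_assoc w]
        rw [hdiff] at b1
        gcongr
        exact hw1.trans (le_abs_self _)
      · rw [e1]
        rw [hdiff] at b2
        calc r j * t j * (|deriv omega (y j + r j * s)| * |D j (y j + r j * s)|)
            ≤ r j * t j * (W * ((M + c / 2) * (r j * |s|))) := by gcongr
          _ = W * (M + c / 2) * |s| := by rw [← mul_assoc W, hone]
          _ ≤ A * |s| := by gcongr
      · have hlen : |y j + r j * s - y j| ≤ β - α := by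
          rw [abs_le]
          constructor <;> linarith [hl'.1, hl'.2, h3.1, h3.2]
        calc |P2 j s| ≤ |deriv (deriv omega) (y j + r j * s)| * |D j (y j + r j * s)| +
              |deriv omega (y j + r j * s)| * |D1 j (y j + r j * s)| := by
              rw [← abs_mul, ← abs_mul]
              exact abs_add_le _ _
          _ ≤ W' * ((M + c / 2) * (β - α)) + W * (M + c / 2) := by
              have := b2.trans (mul_le_mul_of_nonneg_left hlen (by positivity))
              gcongr
          _ ≤ A := hA3
    · left
      have hev := notMem_tsupport_iff_eventuallyEq.1 hl
      exact (haff j s).continuousAt.tendsto.eventually hev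
  · exact fun j s => (hB0 _).trans hA0
  · intro j s
    refine le_trans ?_ ((hB1 (y j + r j * s)).trans hA1)
    rw [norm_mul, norm_mul, norm_mul, Complex.norm_real, Complex.norm_real, Complex.norm_real,
      Real.norm_eq_abs, Real.norm_eq_abs, Real.norm_eq_abs]
    have h1 : |s| * |r j| ≤ |(|y j + r j * s| + Y)| := by
      rw [← abs_mul]
      have : s * r j = (y j + r j * s) - y j := by ring
      rw [this]
      exact (abs_sub _ _).trans ((add_le_add le_rfl (hY' j)).trans (le_abs_self _))
    calc |s| * (‖deriv G (y j + r j * s)‖ * |r j|) = |s| * |r j| * ‖deriv G (y j + r j * s)‖ := by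
          ring
      _ ≤ _ := by gcongr
  · intro j
    exact (((hG.continuous.integrable_of_hasCompactSupport hGc).comp_add_left (y j)).comp_mul_left'
      (hr0 j).ne')
  · exact fun s => (hG.continuous.tendsto _).comp (hls s)
  · intro s
    have := ((hdG.tendsto _).comp (hls s)).mul ((Complex.continuous_ofReal.tendsto _).comp hrl)
    simpa using this
  · intro s
    refine hsqueeze (K := |s| * |s|) (by positivity) fun e he => (hTaylor s e he).mono fun j hj => ?_
    rw [← mul_assoc]
    exact hj.2.2
  · intro s
    exact hsqueeze (abs_nonneg s) fun e he => (hTaylor s e he).mono fun j hj => hj.2.1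
  · intro s
    refine hsqueeze (K := 1) zero_le_one fun e he => (hTaylor s e he).mono fun j hj => ?_
    rw [mul_one]
    exact hj.1.le

end PhaseSetting

end StationaryPhase

/-! ### Stationary branches and the uniform leading term. -/

section Branch

namespace PhaseSetting

variable {L : Set ℝ} {omega theta : ℝ → ℝ} {x : ℕ → ℝ} {Phi : ℕ → ℝ → ℝ}
  {n : ℕ → ℕ} {t : ℕ → ℝ} {l₀ : ℝ}

theorem stationary_iff (h : PhaseSetting L omega theta x Phi) (n : ℕ) (t : ℝ) {l : ℝ}
    (hl : l ∈ L) :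
    x n + deriv (phaseMu L omega Phi n) (omega l) - deriv theta (omega l) * t = 0 ↔
      reducedDeriv omega theta x Phi n t l = 0 := by
  rw [h.deriv_phaseMu n hl]
  rfl

/-- At fixed `l` the reduced derivative over `t` tends to `slope l₀ - slope l`. As `slope` is
strictly monotone, this has opposite signs at the ends of a small interval around `l₀`, and the
intermediate value theorem gives a zero. -/
theorem RatioSeq.exists_stationary (hs : RatioSeq L omega theta x n t l₀)
    (h : PhaseSetting L omega theta x Phi) {r : ℝ} (hr : 0 < r) :
    ∀ᶠ j in atTop, ∃ l ∈ L, reducedDeriv omega theta x Phi (n j) (t j) l = 0 ∧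
      |omega l - derivInv theta (omega '' L) (x (n j) / t j)| < r := by
  have hn := h.isOpen.mem_nhds hs.mem
  have hw : ∀ᶠ l in 𝓝 l₀, |omega l - omega l₀| < r / 2 := by
    have := (h.hasStrictDerivAt_omega hs.mem).hasDerivAt.continuousAt
    simpa [Real.dist_eq] using Metric.tendsto_nhds.1 this (r / 2) (half_pos hr)
  obtain ⟨d, hd, hball⟩ := Metric.eventually_nhds_iff.1 (hw.and (eventually_mem_set.2 hn))
  have hab : l₀ - d / 2 < l₀ + d / 2 := by linarith
  set a := l₀ - d / 2 with ha
  set b := l₀ + d / 2 with hb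
  have hIcc : ∀ l ∈ Set.Icc a b, |omega l - omega l₀| < r / 2 ∧ l ∈ L := by
    intro l hl
    refine hball ?_
    rw [Real.dist_eq, abs_lt]
    constructor <;> linarith [hl.1, hl.2]
  have hsub : Set.Icc a b ⊆ L := fun l hl => (hIcc l hl).2
  have hl₀ : l₀ ∈ Set.Icc a b := ⟨by linarith, by linarith⟩
  have ham : a ∈ Set.Icc a b := ⟨le_rfl, hab.le⟩
  have hbm : b ∈ Set.Icc a b := ⟨hab.le, le_rfl⟩
  have hinj : Set.InjOn (slope omega theta) (Set.Icc a b) := fun u hu v hv huv =>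
    h.strictMonoOn_omega.injOn (hsub hu) (hsub hv)
      (h.injOn_deriv_theta ⟨u, hsub hu, rfl⟩ ⟨v, hsub hv, rfl⟩ huv)
  have hlim : ∀ l ∈ L, Tendsto (fun j => reducedDeriv omega theta x Phi (n j) (t j) l / t j) atTop
      (𝓝 (slope omega theta l₀ - slope omega theta l)) := by
    intro l hl
    have hq : Tendsto (fun j => phaseSlope omega Phi (n j) l / t j) atTop (𝓝 0) := by
      refine Metric.tendsto_nhds.2 fun e he => ?_
      filter_upwards [hs.phaseSlope_small h (isCompact_singleton (x := l))
        (Set.singleton_subset_iff.2 hl) (half_pos he)] with j hj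
      rw [Real.dist_eq, sub_zero]
      linarith [(hj l rfl).1]
    have := (hs.ratio_tendsto.add hq).sub_const (slope omega theta l)
    rw [add_zero] at this
    refine this.congr fun j => ?_
    have := (hs.t_pos j).ne'
    simp only [reducedDeriv]
    field_simp
  have hcont : ∀ j, ContinuousOn (reducedDeriv omega theta x Phi (n j) (t j)) (Set.Icc a b) :=
    fun j l hl =>
      (h.hasDerivAt_reducedDeriv (n j) (t j) (hsub hl)).continuousAt.continuousWithinAt
  have hzero : ∀ᶠ j in atTop, ∃ l ∈ Set.Icc a b,
      reducedDeriv omega theta x Phi (n j) (t j) l = 0 := by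
    rcases ContinuousOn.strictMonoOn_of_injOn_Icc' hab.le
      (h.slope_smooth.continuousOn.mono hsub) hinj with hm | hm
    · have h1 := hm ham hl₀ (by linarith)
      have h2 := hm hl₀ hbm (by linarith)
      filter_upwards [(hlim a (hsub ham)).eventually_const_lt (sub_pos.2 h1),
        (hlim b (hsub hbm)).eventually_lt_const (sub_neg.2 h2)] with j k1 k2
      have k1' := (div_pos_iff_of_pos_right (hs.t_pos j)).1 k1
      have k2' := (div_neg_iff.1 k2).resolve_left (fun k => absurd (hs.t_pos j) (not_lt.2 k.2.le))
      obtain ⟨l, hl, e⟩ := intermediate_value_Icc' hab.le (hcont j) ⟨k2'.1.le, k1'.le⟩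
      exact ⟨l, hl, e⟩
    · have h1 := hm ham hl₀ (by linarith)
      have h2 := hm hl₀ hbm (by linarith)
      filter_upwards [(hlim a (hsub ham)).eventually_lt_const (sub_neg.2 h1),
        (hlim b (hsub hbm)).eventually_const_lt (sub_pos.2 h2)] with j k1 k2
      have k1' := (div_neg_iff.1 k1).resolve_left (fun k => absurd (hs.t_pos j) (not_lt.2 k.2.le))
      have k2' := (div_pos_iff_of_pos_right (hs.t_pos j)).1 k2
      obtain ⟨l, hl, e⟩ := intermediate_value_Icc hab.le (hcont j) ⟨k1'.1.le, k2'.le⟩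
      exact ⟨l, hl, e⟩
  have hh : ∀ᶠ j in atTop, |derivInv theta (omega '' L) (x (n j) / t j) - omega l₀| < r / 2 := by
    have h1 := (h.hasStrictDerivAt_derivInv hs.mem).hasDerivAt.continuousAt.tendsto.comp
      hs.ratio_tendsto
    rw [h.derivInv_slope hs.mem] at h1
    simpa [Real.dist_eq] using Metric.tendsto_nhds.1 h1 (r / 2) (half_pos hr)
  filter_upwards [hzero, hh] with j ⟨l, hl, e⟩ k
  refine ⟨l, hsub hl, e, ?_⟩
  have k1 := (hIcc l hl).1
  have : omega l - derivInv theta (omega '' L) (x (n j) / t j) = (omega l - omega l₀) -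
      (derivInv theta (omega '' L) (x (n j) / t j) - omega l₀) := by ring
  rw [this]
  exact (abs_sub _ _).trans_lt (by linarith)

/-- One choice must serve all compact sets and all accuracies at once. For each `n` and `t` a
solution is taken whose distance to `h(x_n/t)` is within `1 / t` of the infimum over all solutions;
any solution found close to that point then forces the chosen one to be close. Without solutions the
value is irrelevant and set to `0`. -/
theorem exists_isStationaryBranch (h : PhaseSetting L omega theta x Phi) :
    ∃ m, IsStationaryBranch theta (omega '' L) (phaseMu L omega Phi) x m := by
  let Sol : ℕ → ℝ → Set ℝ := fun n t => {mu | mu ∈ omega '' L ∧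
    x n + deriv (phaseMu L omega Phi n) mu - deriv theta mu * t = 0}
  let dst : ℕ → ℝ → ℝ → ℝ := fun n t mu => |mu - derivInv theta (omega '' L) (x n / t)|
  have hchoice : ∀ n t, ∃ mu, 0 < t → (Sol n t).Nonempty →
      mu ∈ Sol n t ∧ ∀ nu ∈ Sol n t, dst n t mu ≤ dst n t nu + 1 / t := by
    intro n t
    by_cases hc : 0 < t ∧ (Sol n t).Nonempty
    · obtain ⟨ht, hne⟩ := hc
      have hb : BddBelow (dst n t '' Sol n t) :=
        ⟨0, by rintro _ ⟨mu, _, rfl⟩; exact abs_nonneg _⟩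
      obtain ⟨_, ⟨mu, hmu, rfl⟩, hlt⟩ := exists_lt_of_csInf_lt (hne.image (dst n t))
        (lt_add_of_pos_right (sInf (dst n t '' Sol n t)) (one_div_pos.2 ht))
      refine ⟨mu, fun _ _ => ⟨hmu, fun nu hnu => ?_⟩⟩
      have := csInf_le hb ⟨nu, hnu, rfl⟩
      linarith
    · exact ⟨0, fun ht hne => absurd ⟨ht, hne⟩ hc⟩
  choose m hm using hchoice
  have key : ∀ K ⊆ deriv theta '' (omega '' L), IsCompact K → ∀ r > 0, ∀ᶠ t in atTop,
      ∀ n, x n / t ∈ K → m n t ∈ Sol n t ∧ dst n t (m n t) < r := by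
    intro K hKL hK r hr
    rw [image_deriv_theta] at hKL
    have h1 := h.eventually_of_seq hK hKL (P := fun n t => ∃ l ∈ L,
      reducedDeriv omega theta x Phi n t l = 0 ∧
      |omega l - derivInv theta (omega '' L) (x n / t)| < r / 2) (by
        intro n t l₀ hl₀ ht htt hnn _ _ hlim
        exact (RatioSeq.exists_stationary ⟨hl₀, ht, htt, hnn, hlim⟩ h (half_pos hr)).exists)
    filter_upwards [h1, eventually_gt_atTop 0, eventually_gt_atTop (2 / r)] with t h1 ht ht2 n hn
    obtain ⟨l, hl, e, hd⟩ := h1 n hn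
    have hsol : omega l ∈ Sol n t := ⟨⟨l, hl, rfl⟩, (h.stationary_iff n t hl).2 e⟩
    obtain ⟨k1, k2⟩ := hm n t ht ⟨_, hsol⟩
    refine ⟨k1, (k2 _ hsol).trans_lt ?_⟩
    have : 1 / t < r / 2 := by
      rw [div_lt_iff₀ hr] at ht2
      rw [div_lt_iff₀ ht]
      linarith
    have hd' : dst n t (omega l) < r / 2 := hd
    linarith
  refine ⟨m, fun K hKL hK => ?_, fun K hKL hK r hr => ?_⟩
  · exact (key K hKL hK 1 one_pos).mono fun t ht n hn => (ht n hn).1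
  · exact (key K hKL hK r hr).mono fun t ht n hn => (ht n hn).2

/-- Along a sequence, a stationary branch converges to the stationary point of the limit phase. -/
theorem RatioSeq.branch (hs : RatioSeq L omega theta x n t l₀)
    (h : PhaseSetting L omega theta x Phi) {m : ℕ → ℝ → ℝ}
    (hm : IsStationaryBranch theta (omega '' L) (phaseMu L omega Phi) x m) {K : Set ℝ}
    (hK : IsCompact K) (hKL : K ⊆ slope omega theta '' L) (hnK : ∀ j, x (n j) / t j ∈ K) :
    (∀ᶠ j in atTop, Function.invFunOn omega L (m (n j) (t j)) ∈ L ∧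
      omega (Function.invFunOn omega L (m (n j) (t j))) = m (n j) (t j) ∧
      reducedDeriv omega theta x Phi (n j) (t j) (Function.invFunOn omega L (m (n j) (t j))) = 0) ∧
    Tendsto (fun j => Function.invFunOn omega L (m (n j) (t j))) atTop (𝓝 l₀) := by
  rw [← image_deriv_theta] at hKL
  constructor
  · filter_upwards [hs.t_tendsto.eventually (hm.stationary K hKL hK)] with j hj
    obtain ⟨k1, k2⟩ := hj (n j) (hnK j)
    have e1 := Function.invFunOn_mem k1
    have e2 := Function.invFunOn_eq k1
    refine ⟨e1, e2, ?_⟩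
    rw [← h.stationary_iff _ _ e1, e2]
    exact k2
  · have h1 := (h.hasStrictDerivAt_derivInv hs.mem).hasDerivAt.continuousAt.tendsto.comp
      hs.ratio_tendsto
    rw [h.derivInv_slope hs.mem] at h1
    have h2 : Tendsto (fun j => m (n j) (t j) - derivInv theta (omega '' L) (x (n j) / t j))
        atTop (𝓝 0) := by
      refine Metric.tendsto_nhds.2 fun e he => ?_
      filter_upwards [hs.t_tendsto.eventually (hm.asymp K hKL hK e he)] with j hj
      rw [Real.dist_eq, sub_zero]
      exact hj (n j) (hnK j)
    have h3 : Tendsto (fun j => m (n j) (t j)) atTop (𝓝 (omega l₀)) := by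
      have := h2.add h1
      rw [zero_add] at this
      exact this.congr fun j => by simp
    have h4 := (h.hasStrictDerivAt_invFunOn_omega hs.mem).hasDerivAt.continuousAt.tendsto
    rw [h.leftInvOn_omega hs.mem] at h4
    exact h4.comp h3

theorem sign_deriv_deriv_theta (h : PhaseSetting L omega theta x Phi) {mu nu : ℝ}
    (hmu : mu ∈ omega '' L) (hnu : nu ∈ omega '' L) :
    Real.sign (deriv (deriv theta) mu) = Real.sign (deriv (deriv theta) nu) := by
  have hc : ContinuousOn (deriv (deriv theta)) (omega '' L) :=
    (h.deriv_theta_smooth.deriv_of_isOpen h.isOpen_image (m := ∞) (by simp)).continuousOn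
  have hpre : IsPreconnected (omega '' L) := h.ordConnected_image.isPreconnected
  have key : ∀ a ∈ omega '' L, ∀ b ∈ omega '' L, deriv (deriv theta) a < 0 →
      ¬ 0 < deriv (deriv theta) b := by
    intro a ha b hb h1 h2
    obtain ⟨c, hc, h0⟩ := hpre.intermediate_value ha hb hc ⟨h1.le, h2.le⟩
    exact h.theta_ne c hc h0
  rcases (h.theta_ne mu hmu).lt_or_gt with h1 | h1 <;> rcases (h.theta_ne nu hnu).lt_or_gt with h2 | h2
  · rw [Real.sign_of_neg h1, Real.sign_of_neg h2]
  · exact absurd h2 (key _ hmu _ hnu h1)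
  · exact absurd h1 (key _ hnu _ hmu h2)
  · rw [Real.sign_of_pos h1, Real.sign_of_pos h2]

/-- The amplitude `κ √τ f` in the spectral variable. -/
noncomputable def ampl (kappa tau : ℝ → ℝ) (f : ℝ → ℂ) (l : ℝ) : ℂ :=
  ((kappa l * √(tau l) : ℝ) : ℂ) * f l

variable {kappa tau : ℝ → ℝ} {f : ℝ → ℂ}

/-- Expresses the amplitude in the spectral variable, using that `h'` is the reciprocal of `θ''`. -/
theorem calF_slope (h : PhaseSetting L omega theta x Phi) {l : ℝ} (hl : l ∈ L) :
    calF theta (omega '' L) (amplMu L omega kappa tau f) (slope omega theta l) =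
      ((√|(deriv (deriv theta) (omega l))⁻¹| * (deriv omega l)⁻¹ : ℝ) : ℂ) *
        ampl kappa tau f l := by
  rw [calF, (h.hasStrictDerivAt_derivInv hl).hasDerivAt.deriv, h.derivInv_slope hl]
  simp only [amplMu, h.leftInvOn_omega hl, ampl]
  push_cast
  ring

theorem continuousAt_density (h : PhaseSetting L omega theta x Phi) (hl₀ : l₀ ∈ L) :
    ContinuousAt (fun l => √|(deriv (deriv theta) (omega l))⁻¹| * (deriv omega l)⁻¹) l₀ := by
  have hn := h.isOpen.mem_nhds hl₀
  have c1 : ContinuousAt (deriv omega) l₀ := h.deriv_omega_smooth.continuousOn.continuousAt hn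
  have c2 : ContinuousAt (fun l => deriv (deriv theta) (omega l)) l₀ :=
    ContinuousAt.comp (f := omega)
      ((h.deriv_theta_smooth.deriv_of_isOpen h.isOpen_image (m := ∞) (by simp)).continuousOn.continuousAt
        (h.isOpen_image.mem_nhds ⟨l₀, hl₀, rfl⟩))
      (h.hasStrictDerivAt_omega hl₀).hasDerivAt.continuousAt
  exact ((c2.inv₀ (h.theta_ne _ ⟨l₀, hl₀, rfl⟩)).abs.sqrt).mul (c1.inv₀ (h.omega_pos l₀ hl₀).ne')

theorem tendsto_calF (h : PhaseSetting L omega theta x Phi) (hG : Continuous (ampl kappa tau f))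
    (hl₀ : l₀ ∈ L) {xi : ℕ → ℝ} (hxi : ∀ j, xi j ∈ slope omega theta '' L)
    (hlim : Tendsto xi atTop (𝓝 (slope omega theta l₀))) :
    Tendsto (fun j => calF theta (omega '' L) (amplMu L omega kappa tau f) (xi j)) atTop
      (𝓝 (calF theta (omega '' L) (amplMu L omega kappa tau f) (slope omega theta l₀))) := by
  have h1 : ContinuousAt (fun l => ((√|(deriv (deriv theta) (omega l))⁻¹| * (deriv omega l)⁻¹ : ℝ) : ℂ)
      * ampl kappa tau f l) l₀ :=
    (Complex.continuous_ofReal.continuousAt.comp (h.continuousAt_density hl₀)).mul hG.continuousAt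
  have h2 := (h.continuousAt_slopeInv hl₀).tendsto.comp hlim
  rw [h.slopeInv_slope hl₀] at h2
  rw [h.calF_slope hl₀]
  refine (h1.tendsto.comp h2).congr fun j => ?_
  obtain ⟨l, hl, e⟩ := hxi j
  simp only [Function.comp]
  rw [← e, h.slopeInv_slope hl, h.calF_slope hl]

/-- The limiting second derivative is $-\theta''\omega'^2$. Its modulus produces
$|\theta''|^{-1/2}\omega'^{-1}$, the factors of `calF`; its negative sign turns the Fresnel phase
into $e^{-\pi i\tau/4}$. -/
theorem ampl_mul_fresnelConst (h : PhaseSetting L omega theta x Phi) (hl₀ : l₀ ∈ L) {mu₀ : ℝ}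
    (hmu₀ : mu₀ ∈ omega '' L) :
    ampl kappa tau f l₀ * fresnelConst (limitHessian omega theta l₀) =
      ((√(2 * Real.pi) : ℝ) : ℂ) *
        Complex.exp (-(Real.pi * Complex.I * Real.sign (deriv (deriv theta) mu₀) / 4)) *
        calF theta (omega '' L) (amplMu L omega kappa tau f) (slope omega theta l₀) := by
  have hw := h.omega_pos l₀ hl₀
  have hth := h.theta_ne _ ⟨l₀, hl₀, rfl⟩
  rw [h.calF_slope hl₀, fresnelConst_eq (h.limitHessian_ne_zero hl₀),
    h.sign_deriv_deriv_theta hmu₀ ⟨l₀, hl₀, rfl⟩]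
  have e0 : limitHessian omega theta l₀ = -(deriv (deriv theta) (omega l₀) * deriv omega l₀ ^ 2) := by
    rw [limitHessian, h.deriv_slope hl₀]; ring
  have e1 : |limitHessian omega theta l₀| =
      |deriv (deriv theta) (omega l₀)| * deriv omega l₀ ^ 2 := by
    rw [e0, abs_neg, abs_mul, abs_of_pos (pow_pos hw 2)]
  have e2 : Real.sign (limitHessian omega theta l₀) =
      -Real.sign (deriv (deriv theta) (omega l₀)) := by
    rcases hth.lt_or_gt with h1 | h1
    · rw [Real.sign_of_neg h1, e0, Real.sign_of_pos, neg_neg]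
      have := mul_pos (neg_pos.2 h1) (pow_pos hw 2)
      linarith
    · rw [Real.sign_of_pos h1, e0, Real.sign_of_neg]
      have := mul_pos h1 (pow_pos hw 2)
      linarith
  have e3 : √(2 * Real.pi / |limitHessian omega theta l₀|) =
      √(2 * Real.pi) * (√|(deriv (deriv theta) (omega l₀))⁻¹| * (deriv omega l₀)⁻¹) := by
    have h1 : (deriv omega l₀)⁻¹ = √((deriv omega l₀)⁻¹ ^ 2) := (Real.sqrt_sq (by positivity)).symm
    rw [h1, ← Real.sqrt_mul (abs_nonneg _), ← Real.sqrt_mul (by positivity), e1, abs_inv]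
    congr 1
    field_simp
  rw [e2, e3]
  have e4 : (Real.pi * Complex.I * ((-Real.sign (deriv (deriv theta) (omega l₀)) : ℝ) : ℂ) / 4 : ℂ) =
      -(Real.pi * Complex.I * Real.sign (deriv (deriv theta) (omega l₀)) / 4) := by
    push_cast; ring
  rw [e4]
  push_cast
  ring

/-- The stationary phase method, uniformly for `x_n / t` in a compact set. -/
theorem stationary_phase_uniform (h : PhaseSetting L omega theta x Phi)
    (hG : ContDiff ℝ ∞ (ampl kappa tau f)) (hGc : HasCompactSupport (ampl kappa tau f))
    (hGL : tsupport (ampl kappa tau f) ⊆ L) {m : ℕ → ℝ → ℝ}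
    (hm : IsStationaryBranch theta (omega '' L) (phaseMu L omega Phi) x m) {K : Set ℝ}
    (hK : IsCompact K) (hKL : K ⊆ slope omega theta '' L) {mu₀ : ℝ} (hmu₀ : mu₀ ∈ omega '' L)
    (v : ℕ → ℝ) (hv : ∀ n, 0 < v n) {e : ℝ} (he : 0 < e) :
    ∀ᶠ t in atTop, ∀ n, x n / t ∈ K →
      ‖(v n : ℂ) * (∫ l, ampl kappa tau f l * Complex.exp (Complex.I * phase omega theta x Phi n t l))
        - leadingTerm theta (omega '' L) (amplMu L omega kappa tau f) (phaseMu L omega Phi) x v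
                m (Real.sign (deriv (deriv theta) mu₀)) n t‖ ≤ e * v n * (√t)⁻¹ := by
  set c₀ : ℂ := ((√(2 * Real.pi) : ℝ) : ℂ) *
        Complex.exp (-(Real.pi * Complex.I * Real.sign (deriv (deriv theta) mu₀) / 4)) with hc₀
  -- Along a sequence the normalized integral and `calF` at the actual ratio have the same limit, so
  -- their difference is small without any rate.
  have key := h.eventually_of_seq hK hKL (P := fun n t =>
    ‖((√t : ℝ) : ℂ) *
      Complex.exp (-(Complex.I * totalPhase theta (phaseMu L omega Phi) x m n t)) *
      (∫ l, ampl kappa tau f l * Complex.exp (Complex.I * phase omega theta x Phi n t l)) -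
      c₀ * calF theta (omega '' L) (amplMu L omega kappa tau f) (x n / t)‖ < e) (by
    intro n t l₀ hl₀ ht htt hnn _ hnK hlim
    have hs : RatioSeq L omega theta x n t l₀ := ⟨hl₀, ht, htt, hnn, hlim⟩
    obtain ⟨b1, b2⟩ := hs.branch h hm hK hKL hnK
    have l1 := hs.stationary_phase h hG hGc hGL b2 (b1.mono fun j hj => hj.2.2)
    rw [h.ampl_mul_fresnelConst hl₀ hmu₀] at l1
    have l2 := l1.sub ((h.tendsto_calF hG.continuous hl₀ (fun j => hKL (hnK j)) hlim).const_mul c₀)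
    rw [sub_self] at l2
    have l3 := (l2.norm.eventually_lt_const (by rw [norm_zero]; exact he)).and b1
    obtain ⟨j, hj1, hj2, hj3, -⟩ := l3.exists
    refine ⟨j, ?_⟩
    have e1 : totalPhase theta (phaseMu L omega Phi) x m (n j) (t j) =
        phase omega theta x Phi (n j) (t j) (Function.invFunOn omega L (m (n j) (t j))) := by
      rw [totalPhase, phase, ← h.phaseMu_omega _ hj2, hj3]
    rw [e1]
    exact hj1)
  filter_upwards [key, eventually_gt_atTop 0] with t ht ht0 n hn
  have h1 := (ht n hn).le
  have hsq : 0 < √t := Real.sqrt_pos.2 ht0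
  set X := ∫ l, ampl kappa tau f l * Complex.exp (Complex.I * phase omega theta x Phi n t l)
  set Ψ := totalPhase theta (phaseMu L omega Phi) x m n t
  have hmem : x n / t ∈ deriv theta '' (omega '' L) := by
    rw [image_deriv_theta]; exact hKL hn
  have e1 : (v n : ℂ) * X - leadingTerm theta (omega '' L) (amplMu L omega kappa tau f)
      (phaseMu L omega Phi) x v m (Real.sign (deriv (deriv theta) mu₀)) n t =
      ((v n * (√t)⁻¹ : ℝ) : ℂ) * (Complex.exp (Complex.I * Ψ) *
        (((√t : ℝ) : ℂ) * Complex.exp (-(Complex.I * Ψ)) * X -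
        c₀ * calF theta (omega '' L) (amplMu L omega kappa tau f) (x n / t))) := by
    have ht' : t ^ (-(1 / 2) : ℝ) = (√t)⁻¹ := by
      rw [Real.rpow_neg ht0.le, Real.sqrt_eq_rpow]
    rw [leadingTerm, Set.indicator_of_mem hmem, ht', Complex.exp_neg (Complex.I * Ψ)]
    have h2 := Complex.exp_ne_zero (Complex.I * Ψ)
    have h3 : ((√t : ℝ) : ℂ) ≠ 0 := by exact_mod_cast hsq.ne'
    simp only [hc₀]
    push_cast
    field_simp
    ring
  rw [e1, norm_mul, norm_mul, Complex.norm_real, mul_comm Complex.I, Complex.norm_exp_ofReal_mul_I,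
    one_mul, Real.norm_of_nonneg (mul_nonneg (hv n).le (inv_pos.2 hsq).le)]
  rw [mul_comm Complex.I] at h1
  calc _ ≤ v n * (√t)⁻¹ * e := by
        have := hv n
        gcongr
    _ = _ := by ring

end PhaseSetting

end Branch

/-! ### Rapid decay away from stationary points, uniformly in `n` and `t`. -/

section Nonstationary

namespace PhaseSetting

variable {L : Set ℝ} {omega theta : ℝ → ℝ} {x : ℕ → ℝ} {Phi : ℕ → ℝ → ℝ}

/-- Here the little-o bounds on the first two derivatives are used only as big-O bounds, so that
finitely many orders share one constant. -/
theorem iteratedDeriv_Phi_bound (h : PhaseSetting L omega theta x Phi) {K : Set ℝ}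
    (hK : IsCompact K) (hKL : K ⊆ L) (N : ℕ) :
    ∃ C, ∀ᶠ n in atTop, ∀ k, 1 ≤ k → k ≤ N → ∀ l ∈ K, |iteratedDeriv k (Phi n) l| ≤ C * x n := by
  induction N with
  | zero => exact ⟨0, Eventually.of_forall fun n k h1 h2 => by omega⟩
  | succ N ih =>
    obtain ⟨C, hC⟩ := ih
    obtain ⟨D, hD⟩ : ∃ D, ∀ᶠ n in atTop, ∀ l ∈ K, |iteratedDeriv (N + 1) (Phi n) l| ≤ D * x n := by
      rcases Nat.lt_or_ge N 2 with hN | hN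
      · refine ⟨1, h.Phi_low K hKL hK (N + 1) ?_ 1 one_pos⟩
        interval_cases N <;> simp
      · exact h.Phi_high K hKL hK (N + 1) (by omega)
    refine ⟨max C D, ?_⟩
    filter_upwards [hC, hD, h.x_tendsto.eventually_ge_atTop 0] with n h1 h2 hx k hk1 hk2 l hl
    rcases Nat.lt_or_ge k (N + 1) with hk | hk
    · refine (h1 k hk1 (by omega) l hl).trans ?_
      gcongr
      exact le_max_left _ _
    · obtain rfl : k = N + 1 := by omega
      refine (h2 l hl).trans ?_
      gcongr
      exact le_max_right _ _

/-- The phase `σ (ω x_n + Φ_n) - θ(ω) t`, with a sign `σ`. -/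
noncomputable def signedPhase (omega theta : ℝ → ℝ) (x : ℕ → ℝ) (Phi : ℕ → ℝ → ℝ) (σ : ℝ) (n : ℕ)
    (t l : ℝ) : ℝ :=
  σ * (omega l * x n + Phi n l) - theta (omega l) * t

/-- Oscillatory integrals without stationary points decay rapidly. -/
theorem nonstationary (h : PhaseSetting L omega theta x Phi) {G : ℝ → ℂ} (hG : ContDiff ℝ ∞ G)
    (hGc : HasCompactSupport G) {O : Set ℝ} (hO : IsOpen O) (hGO : tsupport G ⊆ O)
    (hOc : IsCompact (closure O)) (hOL : closure O ⊆ L) {σ : ℝ} (hσ : |σ| ≤ 1) {c : ℝ} (hc : 0 < c)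
    (N : ℕ) :
    ∃ C n₀, ∀ n ≥ n₀, ∀ t ≥ 1,
      (∀ l ∈ O, c * (x n + t) ≤ |σ * (x n + phaseSlope omega Phi n l) - slope omega theta l * t|) →
      ‖∫ l, G l * Complex.exp (Complex.I * signedPhase omega theta x Phi σ n t l)‖ ≤
        C * (x n + t)⁻¹ ^ N := by
  obtain ⟨D, hD⟩ := h.iteratedDeriv_Phi_bound hOc hOL (N + 1)
  obtain ⟨n₀, hn₀⟩ := eventually_atTop.1 (hD.and (h.x_tendsto.eventually_ge_atTop 1))
  obtain ⟨w, hw, hwO⟩ := h.exists_omega_lower hOc hOL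
  -- The pair of index and time is the symbol parameter; the lower bound on the phase derivative is
  -- part of the parameter set, so constants do not depend on the pair.
  let ι := {p : ℕ × ℝ // n₀ ≤ p.1 ∧ 1 ≤ p.2 ∧ ∀ l ∈ O, c * (x p.1 + p.2) ≤
    |σ * (x p.1 + phaseSlope omega Phi p.1 l) - slope omega theta l * p.2|}
  have hx1 : ∀ p : ι, 1 ≤ x p.1.1 := fun p => (hn₀ _ p.2.1).2
  have ht1 : ∀ p : ι, 1 ≤ p.1.2 := fun p => p.2.2.1
  have hlam : ∀ p : ι, 0 < x p.1.1 + p.1.2 := fun p => by linarith [hx1 p, ht1 p]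
  have hdθ : ContDiffOn ℝ ∞ (fun l => slope omega theta l * deriv omega l) L :=
    h.slope_smooth.mul h.deriv_omega_smooth
  have hOL' : O ⊆ L := subset_closure.trans hOL
  -- The phase derivative divided by the large parameter `x n + t`, arranged as fixed smooth
  -- functions and $x_n^{-1}\Phi_n'$ with coefficients bounded by one.
  let u : ι → ℝ → ℝ := fun p l => (σ * x p.1.1 / (x p.1.1 + p.1.2)) • deriv omega l +
    ((σ * x p.1.1 / (x p.1.1 + p.1.2)) • ((x p.1.1)⁻¹ * deriv (Phi p.1.1) l) +
      (-(p.1.2 / (x p.1.1 + p.1.2))) • (slope omega theta l * deriv omega l))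
  have hu_eq : ∀ p : ι, ∀ l ∈ O, (x p.1.1 + p.1.2) * u p l = deriv omega l *
      (σ * (x p.1.1 + phaseSlope omega Phi p.1.1 l) - slope omega theta l * p.1.2) := by
    intro p l hl
    have h1 := (hlam p).ne'
    have h2 : x p.1.1 ≠ 0 := by linarith [hx1 p]
    have h3 := (h.omega_pos l (hOL' hl)).ne'
    simp only [u, smul_eq_mul, phaseSlope]
    field_simp
    ring
  have hcoef1 : ∀ p : ι, |σ * x p.1.1 / (x p.1.1 + p.1.2)| ≤ 1 := by
    intro p
    have hx := hx1 p
    have ht := ht1 p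
    rw [abs_div, abs_mul, abs_of_pos (hlam p), abs_of_pos (by linarith : 0 < x p.1.1),
      div_le_one (hlam p)]
    nlinarith
  have hcoef2 : ∀ p : ι, |-(p.1.2 / (x p.1.1 + p.1.2))| ≤ 1 := by
    intro p
    have hx := hx1 p
    have ht := ht1 p
    rw [abs_neg, abs_div, abs_of_pos (hlam p), abs_of_pos (by linarith : 0 < p.1.2),
      div_le_one (hlam p)]
    linarith
  have hPhi : SymbBdd O N fun (p : ι) l => (x p.1.1)⁻¹ * deriv (Phi p.1.1) l := by
    refine SymbBdd.of_iteratedDeriv hO (fun p => ?_) fun k hk => ⟨D, fun p l hl => ?_⟩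
    · exact contDiffOn_const.mul
        (((h.Phi_smooth p.1.1).deriv_of_isOpen h.isOpen (by simp)).mono hOL')
    · have hx := hx1 p
      have hx0 : 0 < x p.1.1 := by linarith
      rw [iteratedDeriv_const_mul_field, ← iteratedDeriv_succ', norm_mul, norm_inv,
        Real.norm_of_nonneg hx0.le, Real.norm_eq_abs, inv_mul_le_iff₀ hx0, mul_comm]
      exact (hn₀ _ p.2.1).1 (k + 1) (by omega) (by omega) l (subset_closure hl)
  have hu : SymbBdd O N u :=
    SymbBdd.add hO (SymbBdd.const_smul hO hcoef1
        (SymbBdd.of_contDiffOn h.isOpen h.deriv_omega_smooth hOc hOL subset_closure))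
      (SymbBdd.add hO (SymbBdd.const_smul hO hcoef1 hPhi)
        (SymbBdd.const_smul hO hcoef2
          (SymbBdd.of_contDiffOn h.isOpen hdθ hOc hOL subset_closure)))
  obtain ⟨C, hC⟩ := SymbBdd.norm_integral_exp_le (ι := ι) (n := N) hO hGc.isCompact hGO
    (S := fun p => signedPhase omega theta x Phi σ p.1.1 p.1.2) (u := u)
    (lam := fun p => x p.1.1 + p.1.2) hlam (fun p l hl => by
      have hl' := hOL' hl
      have hth : HasDerivAt theta (deriv theta (omega l)) (omega l) :=
        ((h.theta_smooth.differentiableOn (by simp)).differentiableAt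
          (h.isOpen_image.mem_nhds ⟨l, hl', rfl⟩)).hasDerivAt
      have hwd := (h.hasStrictDerivAt_omega hl').hasDerivAt
      have hne := (h.omega_pos l hl').ne'
      rw [hu_eq p l hl]
      refine ((((hwd.mul_const (x p.1.1)).add (h.hasDerivAt_Phi _ hl')).const_mul σ).sub
        ((hth.comp l hwd).mul_const p.1.2)).congr_deriv ?_
      simp only [phaseSlope, slope]
      field_simp) hu (c := w * c) (by positivity) (fun p l hl => by
      have h1 : |u p l| = |deriv omega l| * |σ * (x p.1.1 + phaseSlope omega Phi p.1.1 l) -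
          slope omega theta l * p.1.2| / (x p.1.1 + p.1.2) := by
        rw [← abs_mul, ← hu_eq p l hl, abs_mul, abs_of_pos (hlam p)]
        have := (hlam p).ne'
        field_simp
      rw [h1, le_div_iff₀ (hlam p), mul_assoc]
      have h2 := hwO l (subset_closure hl)
      have h3 := p.2.2.2 l hl
      have h4 := mul_pos hc (hlam p)
      exact mul_le_mul (h2.trans (le_abs_self _)) h3 h4.le (abs_nonneg _))
    (G := fun _ => G) (SymbBdd.of_contDiffOn h.isOpen hG.contDiffOn hOc hOL subset_closure)
    (fun _ l hl => image_eq_zero_of_notMem_tsupport hl)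
  exact ⟨C, n₀, fun n hn t ht hl => hC ⟨(n, t), hn, ht, hl⟩⟩

/-- The case `σ = -1`: there are never stationary points. -/
theorem nonstationary_neg (h : PhaseSetting L omega theta x Phi) {G : ℝ → ℂ} (hG : ContDiff ℝ ∞ G)
    (hGc : HasCompactSupport G) (hGL : tsupport G ⊆ L) (N : ℕ) :
    ∃ C n₀, ∀ n ≥ n₀, ∀ t ≥ 1,
      ‖∫ l, G l * Complex.exp (Complex.I * signedPhase omega theta x Phi (-1) n t l)‖ ≤
        C * (x n + t)⁻¹ ^ N := by
  obtain ⟨O, hO, hGO, hOL, hOc⟩ := exists_open_between_and_isCompact_closure hGc.isCompact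
    h.isOpen hGL
  obtain ⟨s, hs, hsO⟩ : ∃ s > 0, ∀ l ∈ closure O, s ≤ slope omega theta l := by
    rcases (closure O).eq_empty_or_nonempty with h0 | h0
    · exact ⟨1, one_pos, by simp [h0]⟩
    · obtain ⟨l₀, hl₀, hmin⟩ := hOc.exists_isMinOn h0 (h.slope_smooth.continuousOn.mono hOL)
      exact ⟨_, h.slope_pos (hOL hl₀), fun l hl => hmin hl⟩
  -- All main terms have the same sign: half of `x n` absorbs the correction from `Phi`, and `s`
  -- bounds the slope from below.
  obtain ⟨C, n₀, hC⟩ := h.nonstationary hG hGc hO hGO hOc hOL (σ := -1) (by simp)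
    (c := min (1 / 2) s) (by positivity) N
  obtain ⟨n₁, hn₁⟩ := eventually_atTop.1 ((h.phaseSlope_small hOc hOL (r := 1 / 2)
    (by norm_num)).and (h.x_tendsto.eventually_ge_atTop 1))
  refine ⟨C, max n₀ n₁, fun n hn t ht => hC n ((le_max_left _ _).trans hn) t ht fun l hl => ?_⟩
  obtain ⟨k1, k2⟩ := hn₁ n ((le_max_right _ _).trans hn)
  have k3 := abs_le.1 (k1 l (subset_closure hl)).1
  have k4 := hsO l (subset_closure hl)
  rw [← abs_neg]
  refine le_trans ?_ (le_abs_self _)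
  have k5 : min (1 / 2) s ≤ 1 / 2 := min_le_left _ _
  have k6 : min (1 / 2) s ≤ s := min_le_right _ _
  nlinarith [mul_le_mul_of_nonneg_right k5 (by linarith : 0 ≤ x n),
    mul_le_mul_of_nonneg_right (k6.trans k4) (by linarith : 0 ≤ t)]

/-- The case `σ = 1`, away from the region where there are stationary points in the support of the
amplitude. -/
theorem nonstationary_pos (h : PhaseSetting L omega theta x Phi) {G : ℝ → ℂ} (hG : ContDiff ℝ ∞ G)
    (hGc : HasCompactSupport G) {α β : ℝ} (hGαβ : tsupport G ⊆ Set.Ioo α β)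
    (hL : Set.Icc α β ⊆ L) (N : ℕ) :
    ∃ C n₀, ∀ n ≥ n₀, ∀ t ≥ 1, x n / t ∉ slope omega theta '' Set.Icc α β →
      ‖∫ l, G l * Complex.exp (Complex.I * signedPhase omega theta x Phi 1 n t l)‖ ≤
        C * (x n + t)⁻¹ ^ N := by
  obtain ⟨O, hO, hGO, hOα, hOc⟩ := exists_open_between_and_isCompact_closure hGc.isCompact
    isOpen_Ioo hGαβ
  have hIL : Set.Ioo α β ⊆ L := Set.Ioo_subset_Icc_self.trans hL
  have hOL : closure O ⊆ L := hOα.trans hIL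
  have hopen : IsOpen (slope omega theta '' Set.Ioo α β) := by
    rw [isOpen_iff_mem_nhds]
    rintro _ ⟨l, hl, rfl⟩
    have h1 := h.hasStrictDerivAt_slope (hIL hl)
    have h2 := h.deriv_slope_ne_zero (hIL hl)
    rw [h.deriv_slope (hIL hl)] at h2
    rw [← h1.map_nhds_eq h2]
    exact image_mem_map (isOpen_Ioo.mem_nhds hl)
  have hSO : IsCompact (slope omega theta '' closure O) :=
    hOc.image_of_continuousOn (h.slope_smooth.continuousOn.mono hOL)
  -- The slopes on `closure O` form a compact subset of the open set of slopes on `Ioo α β`; a ratio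
  -- outside the larger image therefore stays at distance more than `d` from them.
  obtain ⟨d, hd, hdO⟩ := hSO.exists_cthickening_subset_open hopen (Set.image_mono hOα)
  obtain ⟨M, hM⟩ := hOc.exists_bound_of_continuousOn (h.slope_smooth.continuousOn.mono hOL)
  -- With `A > d` the distance to a slope, `1 ≤ A / d` and `x n / t ≤ A + |M| ≤ A * (1 + |M| / d)`;
  -- adding gives the constant. The factor `2` elsewhere leaves half for the correction from `Phi`.
  set B := 1 / d + 1 + |M| / d with hB
  have hB0 : 0 < B := by positivity
  obtain ⟨C, n₀, hC⟩ := h.nonstationary hG hGc hO hGO hOc hOL (σ := 1) (by simp)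
    (c := 1 / (2 * B)) (by positivity) N
  obtain ⟨n₁, hn₁⟩ := eventually_atTop.1 ((h.phaseSlope_small hOc hOL (r := 1 / (2 * B))
    (by positivity)).and (h.x_tendsto.eventually_ge_atTop 1))
  refine ⟨C, max n₀ n₁, fun n hn t ht hnt => hC n ((le_max_left _ _).trans hn) t ht fun l hl => ?_⟩
  obtain ⟨k1, k2⟩ := hn₁ n ((le_max_right _ _).trans hn)
  have k3 := (k1 l (subset_closure hl)).1
  have ht0 : 0 < t := by linarith
  have hx0 : 0 < x n := by linarith
  have hfar : d < |x n / t - slope omega theta l| := by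
    by_contra hc
    push Not at hc
    refine hnt (Set.image_mono Set.Ioo_subset_Icc_self (hdO ?_))
    exact Metric.mem_cthickening_of_dist_le _ _ _ _ ⟨l, subset_closure hl, rfl⟩ hc
  have hM' : |slope omega theta l| ≤ |M| := (hM l (subset_closure hl)).trans (le_abs_self M)
  set A := |x n / t - slope omega theta l| with hA
  have hA1 : 1 + x n / t ≤ B * A := by
    have e1 : x n / t ≤ A + |slope omega theta l| := by
      have := abs_add_le (x n / t - slope omega theta l) (slope omega theta l)
      rw [sub_add_cancel] at this
      exact (le_abs_self _).trans this
    have e2 : 1 ≤ 1 / d * A := by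
      rw [div_mul_eq_mul_div, one_mul, one_le_div hd]
      exact hfar.le
    have e3 : |M| ≤ |M| / d * A := by
      rw [div_mul_eq_mul_div, le_div_iff₀ hd]
      exact mul_le_mul_of_nonneg_left hfar.le (abs_nonneg _)
    simp only [hB]
    nlinarith
  have hA2 : |x n - slope omega theta l * t| = A * t := by
    have : x n - slope omega theta l * t = (x n / t - slope omega theta l) * t := by
      field_simp
    rw [this, abs_mul, abs_of_pos ht0]
  have hA3 : x n + t ≤ B * (A * t) := by
    have := mul_le_mul_of_nonneg_right hA1 ht0.le
    rw [add_mul, div_mul_cancel₀ _ ht0.ne'] at this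
    linarith
  have hA4 : 1 / B * (x n + t) ≤ A * t := by
    rw [div_mul_eq_mul_div, one_mul, div_le_iff₀ hB0]
    linarith
  have hA5 : 1 / (2 * B) = 1 / B / 2 := by field_simp
  have e : 1 * (x n + phaseSlope omega Phi n l) - slope omega theta l * t =
      (x n - slope omega theta l * t) - (-phaseSlope omega Phi n l) := by ring
  rw [e]
  refine le_trans ?_ (abs_sub_abs_le_abs_sub _ _)
  rw [abs_neg, hA2]
  rw [hA5] at k3 ⊢
  have : 0 < 1 / B := by positivity
  nlinarith

end PhaseSetting

end Nonstationary

/-! ### Families of sequences that become small in `ℓ²`. -/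

section SquareSummable

/-- Families of sequences which are eventually square summable with `ℓ²` norm tending to zero. -/
def L2Small (c : ℝ → ℕ → ℂ) : Prop :=
  (∀ᶠ t in atTop, Summable fun n => ‖c t n‖ ^ 2) ∧
    Tendsto (fun t => ∑' n, ‖c t n‖ ^ 2) atTop (𝓝 0)

theorem norm_add_sq_le_two (z w : ℂ) : ‖z + w‖ ^ 2 ≤ 2 * ‖z‖ ^ 2 + 2 * ‖w‖ ^ 2 := by
  have h1 := norm_add_le z w
  have h2 := norm_nonneg (z + w)
  nlinarith [sq_nonneg (‖z‖ - ‖w‖)]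

theorem L2Small.of_forall_pos {c : ℝ → ℕ → ℂ}
    (h : ∀ e > 0, ∀ᶠ t in atTop, (Summable fun n => ‖c t n‖ ^ 2) ∧ ∑' n, ‖c t n‖ ^ 2 ≤ e) :
    L2Small c := by
  refine ⟨(h 1 one_pos).mono fun t ht => ht.1, Metric.tendsto_nhds.2 fun e he => ?_⟩
  filter_upwards [h (e / 2) (half_pos he)] with t ht
  rw [Real.dist_eq, sub_zero, abs_of_nonneg (tsum_nonneg fun n => sq_nonneg _)]
  linarith [ht.2]

theorem L2Small.add {c d : ℝ → ℕ → ℂ} (hc : L2Small c) (hd : L2Small d) :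
    L2Small fun t n => c t n + d t n := by
  have hs : ∀ᶠ t in atTop, (Summable fun n => ‖c t n + d t n‖ ^ 2) ∧
      ∑' n, ‖c t n + d t n‖ ^ 2 ≤ 2 * ∑' n, ‖c t n‖ ^ 2 + 2 * ∑' n, ‖d t n‖ ^ 2 := by
    filter_upwards [hc.1, hd.1] with t h1 h2
    have h3 := (h1.mul_left 2).add (h2.mul_left 2)
    have h4 : Summable fun n => ‖c t n + d t n‖ ^ 2 :=
      Summable.of_nonneg_of_le (fun n => sq_nonneg _) (fun n => norm_add_sq_le_two _ _) h3
    refine ⟨h4, ?_⟩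
    rw [← tsum_mul_left, ← tsum_mul_left, ← (h1.mul_left 2).tsum_add (h2.mul_left 2)]
    exact h4.tsum_le_tsum (fun n => norm_add_sq_le_two _ _) h3
  refine ⟨hs.mono fun t ht => ht.1, ?_⟩
  refine squeeze_zero' (Eventually.of_forall fun t => tsum_nonneg fun n => sq_nonneg _)
    (hs.mono fun t ht => ht.2) ?_
  simpa using (hc.2.const_mul 2).add (hd.2.const_mul 2)

/-- Dominated convergence for series; the finitely many indices without a majorant are eventually
bounded by one, by pointwise convergence. -/
theorem L2Small.of_dominated {c : ℝ → ℕ → ℂ} (hc : ∀ n, Tendsto (fun t => c t n) atTop (𝓝 0))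
    {d : ℕ → ℝ} (hd : Summable d) (n₀ : ℕ)
    (h : ∀ᶠ t in atTop, ∀ n ≥ n₀, ‖c t n‖ ^ 2 ≤ d n) : L2Small c := by
  set D : ℕ → ℝ := fun n => if n < n₀ then 1 else d n with hD
  have hDs : Summable D := by
    rw [← summable_nat_add_iff n₀]
    refine ((summable_nat_add_iff n₀).2 hd).congr fun n => ?_
    simp [hD]
  have hlim : ∀ n, Tendsto (fun t => ‖c t n‖ ^ 2) atTop (𝓝 0) := fun n => by
    simpa using (hc n).norm.pow 2
  have hfin : ∀ᶠ t in atTop, ∀ n ∈ Finset.range n₀, ‖c t n‖ ^ 2 ≤ 1 :=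
    (Finset.eventually_all _).2 fun n _ => (hlim n).eventually_le_const one_pos
  have hb : ∀ᶠ t in atTop, ∀ n, ‖c t n‖ ^ 2 ≤ D n := by
    filter_upwards [h, hfin] with t h1 h2 n
    by_cases hn : n < n₀
    · simpa [hD, hn] using h2 n (Finset.mem_range.2 hn)
    · simpa [hD, hn] using h1 n (not_lt.1 hn)
  refine ⟨hb.mono fun t ht => Summable.of_nonneg_of_le (fun n => sq_nonneg _) ht hDs, ?_⟩
  have := tendsto_tsum_of_dominated_convergence (𝓕 := atTop) (f := fun t n => ‖c t n‖ ^ 2)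
    (g := fun _ => (0 : ℝ)) hDs hlim (hb.mono fun t ht n => by
      rw [Real.norm_of_nonneg (sq_nonneg _)]; exact ht n)
  simpa using this

theorem EllTwo.summable (u : EllTwo) : Summable fun n => ‖u n‖ ^ 2 := by
  have := (memℓp_gen_iff (by norm_num : (0 : ℝ) < (2 : ℝ≥0∞).toReal)).1 (lp.memℓp u)
  simpa using this

theorem EllTwo.tsum_norm_sq (u : EllTwo) : ∑' n, ‖u n‖ ^ 2 = ‖u‖ ^ 2 := by
  have := lp.norm_rpow_eq_tsum (by norm_num : (0 : ℝ) < (2 : ℝ≥0∞).toReal) u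
  simpa using this.symm

theorem EllTwo.memlp_of_summable {c : ℕ → ℂ} (h : Summable fun n => ‖c n‖ ^ 2) :
    Memℓp (E := fun _ : ℕ => ℂ) c 2 := by
  rw [memℓp_gen_iff (by norm_num : (0 : ℝ) < (2 : ℝ≥0∞).toReal)]
  simpa using h

/-- Cauchy–Schwarz against the constant one, obtained by expanding the nonnegative integral of `(V *
|g| - m) ^ 2`. -/
theorem sq_setIntegral_abs_le {g : ℝ → ℝ} {Z : Set ℝ} (hZ : IsCompact Z) (hg : ContinuousOn g Z) :
    (∫ l in Z, |g l|) ^ 2 ≤ volume.real Z * ∫ l in Z, g l ^ 2 := by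
  set V := volume.real Z
  set m := ∫ l in Z, |g l|
  have hV : 0 ≤ V := measureReal_nonneg
  have i1 : IntegrableOn (fun l => |g l|) Z := hg.abs.integrableOn_compact hZ
  have i2 : IntegrableOn (fun l => g l ^ 2) Z := (hg.pow 2).integrableOn_compact hZ
  have i3 : IntegrableOn (fun _ : ℝ => m ^ 2) Z := integrableOn_const hZ.measure_lt_top.ne
  rcases hV.eq_or_lt with h0 | h0
  · have hz : volume Z = 0 := by
      have := (measureReal_eq_zero_iff hZ.measure_lt_top.ne).1 h0.symm
      exact this
    have : m = 0 := by simp only [m]; rw [Measure.restrict_eq_zero.2 hz]; simp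
    rw [this, ← h0]
    simp
  · have h1 : 0 ≤ ∫ l in Z, (V * |g l| - m) ^ 2 := integral_nonneg fun l => sq_nonneg _
    have h2 : ∫ l in Z, (V * |g l| - m) ^ 2 =
        V ^ 2 * (∫ l in Z, g l ^ 2) - 2 * V * m * m + V * m ^ 2 := by
      have : ∀ l, (V * |g l| - m) ^ 2 = V ^ 2 * g l ^ 2 - 2 * V * m * |g l| + m ^ 2 := fun l => by
        rw [← sq_abs (g l)]; ring
      simp only [this]
      rw [integral_add (by exact (i2.const_mul (V ^ 2)).sub (i1.const_mul (2 * V * m))) i3,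
        integral_sub (i2.const_mul _) (i1.const_mul _), integral_const_mul, integral_const_mul,
        setIntegral_const, smul_eq_mul]
    rw [h2] at h1
    nlinarith

end SquareSummable

/-! ### Decomposition of the evolution and its negligible pieces. -/

section Evolution

namespace PhaseSetting

variable {L : Set ℝ} {omega theta : ℝ → ℝ} {x v : ℕ → ℝ} {Phi : ℕ → ℝ → ℝ} {kappa tau : ℝ → ℝ}
  {P : ℕ → ℝ → ℝ} {f : ℝ → ℂ}

/-- The contribution of one of the two exponentials in the leading term of `P_n`. -/
noncomputable def oscInt (omega theta : ℝ → ℝ) (x : ℕ → ℝ) (Phi : ℕ → ℝ → ℝ) (G : ℝ → ℂ) (σ : ℝ)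
    (n : ℕ) (t : ℝ) : ℂ :=
  ∫ l, G l * Complex.exp (Complex.I * signedPhase omega theta x Phi σ n t l)

/-- The remainder `ε_n` in the asymptotics of `P_n`. -/
noncomputable def remTerm (P : ℕ → ℝ → ℝ) (kappa omega : ℝ → ℝ) (x v : ℕ → ℝ) (Phi : ℕ → ℝ → ℝ)
    (n : ℕ) (l : ℝ) : ℝ :=
  P n l - 2 * kappa l * v n * Real.cos (omega l * x n + Phi n l)

/-- The contribution of `ε_n`. -/
noncomputable def remInt (P : ℕ → ℝ → ℝ) (kappa omega theta : ℝ → ℝ) (x v : ℕ → ℝ)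
    (Phi : ℕ → ℝ → ℝ) (tau : ℝ → ℝ) (f : ℝ → ℂ) (n : ℕ) (t : ℝ) : ℂ :=
  ∫ l, ((remTerm P kappa omega x v Phi n l * √(tau l) : ℝ) : ℂ) * f l *
    Complex.exp (Complex.I * ((t * -theta (omega l) : ℝ) : ℂ))

/-- For fixed `n` everything except `exp (-iθ(ω)t)` is an amplitude, and `θ ∘ ω` has no critical
points. This supplies the pointwise limits for dominated convergence. -/
theorem tendsto_fixed_index (h : PhaseSetting L omega theta x Phi) (hf : ContDiff ℝ ∞ f)
    (hfc : HasCompactSupport f) (hfL : tsupport f ⊆ L) {g : ℝ → ℂ} (hg : ContDiffOn ℝ ∞ g L) :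
    Tendsto (fun t : ℝ => ∫ l, g l * f l *
      Complex.exp (Complex.I * ((t * -theta (omega l) : ℝ) : ℂ))) atTop (𝓝 0) := by
  have hS : ContDiffOn ℝ ∞ (fun l => -theta (omega l)) L :=
    (h.theta_smooth.comp h.omega_smooth (Set.mapsTo_image omega L)).neg
  refine tendsto_integral_exp_atTop h.isOpen (contDiff_mul_of_tsupport_subset h.isOpen hg hf hfL)
    hfc.mul_left ((tsupport_mul_subset_right).trans hfL) hS fun l hl => ?_
  have hth : HasDerivAt theta (deriv theta (omega l)) (omega l) :=
    ((h.theta_smooth.differentiableOn (by simp)).differentiableAt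
      (h.isOpen_image.mem_nhds ⟨l, hl, rfl⟩)).hasDerivAt
  have := ((hth.comp l (h.hasStrictDerivAt_omega hl).hasDerivAt).neg).deriv
  change deriv (-(theta ∘ omega)) l ≠ 0
  rw [this]
  exact neg_ne_zero.2 (mul_ne_zero (h.theta_pos _ ⟨l, hl, rfl⟩).ne' (h.omega_pos l hl).ne')

/-- The assumptions on the amplitudes. -/
structure AmplSetting (L : Set ℝ) (kappa tau : ℝ → ℝ) : Prop where
  kappa_smooth : ContDiffOn ℝ ∞ kappa L
  kappa_pos : ∀ l ∈ L, 0 < kappa l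
  tau_smooth : ContDiffOn ℝ ∞ tau L
  tau_pos : ∀ l ∈ L, 0 < tau l

theorem AmplSetting.sqrt_smooth (ha : AmplSetting L kappa tau) :
    ContDiffOn ℝ ∞ (fun l => √(tau l)) L :=
  ha.tau_smooth.sqrt fun l hl => (ha.tau_pos l hl).ne'

theorem AmplSetting.smooth (ha : AmplSetting L kappa tau) :
    ContDiffOn ℝ ∞ (fun l => ((kappa l * √(tau l) : ℝ) : ℂ)) L :=
  Complex.ofRealCLM.contDiff.comp_contDiffOn (ha.kappa_smooth.mul ha.sqrt_smooth)

theorem AmplSetting.contDiff_ampl (ha : AmplSetting L kappa tau) (hL : IsOpen L)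
    (hf : ContDiff ℝ ∞ f) (hfL : tsupport f ⊆ L) : ContDiff ℝ ∞ (ampl kappa tau f) :=
  contDiff_mul_of_tsupport_subset hL ha.smooth hf hfL

theorem hasCompactSupport_ampl (hfc : HasCompactSupport f) :
    HasCompactSupport (ampl kappa tau f) := hfc.mul_left

theorem tsupport_ampl_subset : tsupport (ampl kappa tau f) ⊆ tsupport f :=
  tsupport_mul_subset_right

theorem tendsto_oscInt (h : PhaseSetting L omega theta x Phi) (ha : AmplSetting L kappa tau)
    (hf : ContDiff ℝ ∞ f) (hfc : HasCompactSupport f) (hfL : tsupport f ⊆ L) (σ : ℝ) (n : ℕ) :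
    Tendsto (fun t => oscInt omega theta x Phi (ampl kappa tau f) σ n t) atTop (𝓝 0) := by
  have hph : ContDiffOn ℝ ∞ (fun l => ((σ * (omega l * x n + Phi n l) : ℝ) : ℂ)) L :=
    Complex.ofRealCLM.contDiff.comp_contDiffOn
      (contDiffOn_const.mul ((h.omega_smooth.mul contDiffOn_const).add (h.Phi_smooth n)))
  have hg : ContDiffOn ℝ ∞ (fun l => ((kappa l * √(tau l) : ℝ) : ℂ) *
      Complex.exp (Complex.I * ((σ * (omega l * x n + Phi n l) : ℝ) : ℂ))) L :=
    ha.smooth.mul (Complex.contDiff_exp.comp_contDiffOn (contDiffOn_const.mul hph))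
  refine (h.tendsto_fixed_index hf hfc hfL hg).congr fun t => ?_
  rw [oscInt]
  congr 1
  ext l
  have e : Complex.exp (Complex.I * signedPhase omega theta x Phi σ n t l) =
      Complex.exp (Complex.I * ((σ * (omega l * x n + Phi n l) : ℝ) : ℂ)) *
      Complex.exp (Complex.I * ((t * -theta (omega l) : ℝ) : ℂ)) := by
    rw [← Complex.exp_add, signedPhase]
    congr 1
    push_cast
    ring
  rw [e, ampl]
  ring

theorem remTerm_smooth (h : PhaseSetting L omega theta x Phi) (ha : AmplSetting L kappa tau)
    (hP : ∀ n, ContDiff ℝ ∞ (P n)) (n : ℕ) :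
    ContDiffOn ℝ ∞ (remTerm P kappa omega x v Phi n) L :=
  (hP n).contDiffOn.sub (((contDiffOn_const.mul ha.kappa_smooth).mul contDiffOn_const).mul
    (Real.contDiff_cos.comp_contDiffOn
      ((h.omega_smooth.mul contDiffOn_const).add (h.Phi_smooth n))))

theorem evolution_decomposition (h : PhaseSetting L omega theta x Phi)
    (ha : AmplSetting L kappa tau) (hP : ∀ n, ContDiff ℝ ∞ (P n))
    (hf : ContDiff ℝ ∞ f) (hfc : HasCompactSupport f) (hfL : tsupport f ⊆ L) {Theta : ℝ → ℝ}
    (hTheta : Set.EqOn Theta (theta ∘ omega) L) (n : ℕ) (t : ℝ) :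
    ∫ l in L, ((P n l * √(tau l) : ℝ) : ℂ) * f l * Complex.exp (-(Complex.I * Theta l * t)) =
      remInt P kappa omega theta x v Phi tau f n t +
        (v n * oscInt omega theta x Phi (ampl kappa tau f) 1 n t +
        v n * oscInt omega theta x Phi (ampl kappa tau f) (-1) n t) := by
  have hf0 : ∀ l ∉ L, f l = 0 := fun l hl => image_eq_zero_of_notMem_tsupport fun h => hl (hfL h)
  have hint : ∀ g : ℝ → ℂ, ContinuousOn g L → Integrable fun l => g l * f l := by
    intro g hg
    have h1 : ContDiff ℝ 0 fun l => g l * f l :=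
      contDiff_mul_of_tsupport_subset h.isOpen (contDiffOn_zero.2 hg) (hf.of_le (by simp)) hfL
    exact h1.continuous.integrable_of_hasCompactSupport hfc.mul_left
  have hth : ContinuousOn (fun l => theta (omega l)) L :=
    h.theta_smooth.continuousOn.comp h.omega_smooth.continuousOn (Set.mapsTo_image omega L)
  have hcexp : ∀ s : ℝ → ℝ, ContinuousOn s L →
      ContinuousOn (fun l => Complex.exp (Complex.I * (s l : ℂ))) L := fun s hs =>
    (continuousOn_const.mul (Complex.continuous_ofReal.comp_continuousOn hs)).cexp
  have hsp : ∀ σ : ℝ, ContinuousOn (signedPhase omega theta x Phi σ n t) L := fun σ =>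
    (continuousOn_const.mul ((h.omega_smooth.continuousOn.mul continuousOn_const).add
      (h.Phi_smooth n).continuousOn)).sub (hth.mul continuousOn_const)
  have i1 : Integrable fun l => ((remTerm P kappa omega x v Phi n l * √(tau l) : ℝ) : ℂ) * f l *
      Complex.exp (Complex.I * ((t * -theta (omega l) : ℝ) : ℂ)) := by
    have := hint (fun l => ((remTerm P kappa omega x v Phi n l * √(tau l) : ℝ) : ℂ) *
      Complex.exp (Complex.I * ((t * -theta (omega l) : ℝ) : ℂ)))
      ((Complex.continuous_ofReal.comp_continuousOn ((h.remTerm_smooth ha hP n).continuousOn.mul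
        ha.sqrt_smooth.continuousOn)).mul (hcexp _ (continuousOn_const.mul hth.neg)))
    refine this.congr (Eventually.of_forall fun l => ?_)
    simp only
    ring
  have i2 : ∀ σ : ℝ, Integrable fun l => (v n : ℂ) * (ampl kappa tau f l *
      Complex.exp (Complex.I * signedPhase omega theta x Phi σ n t l)) := by
    intro σ
    have := (hint (fun l => ((kappa l * √(tau l) : ℝ) : ℂ) *
      Complex.exp (Complex.I * signedPhase omega theta x Phi σ n t l))
      (ha.smooth.continuousOn.mul (hcexp _ (hsp σ)))).const_mul (v n : ℂ)
    refine this.congr (Eventually.of_forall fun l => ?_)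
    simp only [ampl]
    ring
  rw [setIntegral_eq_integral_of_forall_compl_eq_zero fun l hl => by simp [hf0 l hl]]
  rw [remInt, oscInt, oscInt, ← integral_const_mul, ← integral_const_mul,
    ← integral_add (i2 1) (i2 (-1)), ← integral_add i1 (by exact (i2 1).add (i2 (-1)))]
  congr 1
  ext l
  by_cases hl : l ∈ L
  · have e0 : Complex.exp (-(Complex.I * Theta l * t)) =
        Complex.exp (Complex.I * ((t * -theta (omega l) : ℝ) : ℂ)) := by
      rw [hTheta hl]
      congr 1
      simp only [Function.comp]
      push_cast
      ring
    have e1 : ∀ σ : ℝ, Complex.exp (Complex.I * signedPhase omega theta x Phi σ n t l) =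
        Complex.exp (((σ * (omega l * x n + Phi n l) : ℝ) : ℂ) * Complex.I) *
        Complex.exp (Complex.I * ((t * -theta (omega l) : ℝ) : ℂ)) := by
      intro σ
      rw [← Complex.exp_add, signedPhase]
      congr 1
      push_cast
      ring
    have e2 : (P n l : ℂ) = (remTerm P kappa omega x v Phi n l : ℂ) + kappa l * v n *
        (Complex.exp (((1 * (omega l * x n + Phi n l) : ℝ) : ℂ) * Complex.I) +
        Complex.exp ((((-1) * (omega l * x n + Phi n l) : ℝ) : ℂ) * Complex.I)) := by
      have := Complex.two_cos ((omega l * x n + Phi n l : ℝ) : ℂ)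
      rw [one_mul, neg_one_mul, Complex.ofReal_neg, ← this, remTerm]
      push_cast
      ring
    rw [e0, e1, e1]
    simp only [ampl]
    push_cast at e2 ⊢
    rw [e2]
    ring
  · simp [hf0 l hl, ampl]

/-- Cauchy–Schwarz bounds each squared term, independently of `t`, by a multiple of
$\int\epsilon_n^2$ over the support of `f`. These are summable because $\sum\epsilon_n^2$ is bounded
there. -/
theorem remInt_l2Small (h : PhaseSetting L omega theta x Phi) (ha : AmplSetting L kappa tau)
    (hP : ∀ n, ContDiff ℝ ∞ (P n))
    (hrem : ∀ K ⊆ L, IsCompact K → ∃ C : ℝ, ∀ l ∈ K,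
      Summable (fun n => |remTerm P kappa omega x v Phi n l| ^ 2) ∧
      ∑' n, |remTerm P kappa omega x v Phi n l| ^ 2 ≤ C)
    (hf : ContDiff ℝ ∞ f) (hfc : HasCompactSupport f) (hfL : tsupport f ⊆ L) :
    L2Small fun t n => remInt P kappa omega theta x v Phi tau f n t := by
  have hsm := h.remTerm_smooth (v := v) ha hP
  set ε := remTerm P kappa omega x v Phi
  obtain ⟨C, hC⟩ := hrem _ hfL hfc.isCompact
  set Z := tsupport f
  have hZ : IsCompact Z := hfc.isCompact
  have hεc : ∀ n, ContinuousOn (ε n) Z := fun n => (hsm n).continuousOn.mono hfL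
  obtain ⟨M, hM⟩ : ∃ M, ∀ l ∈ Z, ‖((√(tau l) : ℝ) : ℂ) * f l‖ ≤ M :=
    hZ.exists_bound_of_continuousOn
      ((Complex.continuous_ofReal.comp_continuousOn (ha.sqrt_smooth.continuousOn.mono hfL)).mul
        hf.continuous.continuousOn)
  have hbound : ∀ t n, ‖remInt P kappa omega theta x v Phi tau f n t‖ ^ 2 ≤
      M ^ 2 * volume.real Z * ∫ l in Z, ε n l ^ 2 := by
    intro t n
    have h1 : ‖remInt P kappa omega theta x v Phi tau f n t‖ ≤ ∫ l in Z, M * |ε n l| := by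
      rw [remInt, ← setIntegral_eq_integral_of_forall_compl_eq_zero (s := Z) fun l hl => by
        rw [image_eq_zero_of_notMem_tsupport hl]; simp]
      refine norm_integral_le_of_norm_le (((hεc n).abs.integrableOn_compact hZ).const_mul M) ?_
      refine (ae_restrict_mem hZ.measurableSet).mono fun l hl => ?_
      rw [norm_mul, mul_comm Complex.I, Complex.norm_exp_ofReal_mul_I, mul_one, Complex.ofReal_mul,
        mul_assoc, norm_mul, Complex.norm_real, Real.norm_eq_abs, mul_comm]
      exact mul_le_mul_of_nonneg_right (hM l hl) (abs_nonneg _)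
    rw [integral_const_mul] at h1
    calc _ ≤ (M * ∫ l in Z, |ε n l|) ^ 2 := by gcongr
      _ = M ^ 2 * (∫ l in Z, |ε n l|) ^ 2 := by ring
      _ ≤ M ^ 2 * (volume.real Z * ∫ l in Z, ε n l ^ 2) := by
        gcongr
        exact sq_setIntegral_abs_le hZ (hεc n)
      _ = _ := by ring
  have hsum : Summable fun n => ∫ l in Z, ε n l ^ 2 := by
    refine summable_of_sum_le (c := ∫ l in Z, C)
      (fun n => integral_nonneg fun l => sq_nonneg _) fun s => ?_
    have hi : ∀ n ∈ s, IntegrableOn (fun l => ε n l ^ 2) Z := fun n _ =>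
      ((hεc n).pow 2).integrableOn_compact hZ
    rw [← integral_finsetSum s hi]
    refine setIntegral_mono_on (integrable_finsetSum s hi)
      (integrableOn_const hZ.measure_lt_top.ne) hZ.measurableSet fun l hl => ?_
    obtain ⟨k1, k2⟩ := hC l hl
    simp only [sq_abs] at k1 k2
    exact (k1.sum_le_tsum s fun n _ => sq_nonneg _).trans k2
  refine L2Small.of_dominated (fun n => ?_) (hsum.mul_left (M ^ 2 * volume.real Z)) 0
    (Eventually.of_forall fun t n _ => hbound t n)
  exact h.tendsto_fixed_index hf hfc hfL (g := fun l => ((ε n l * √(tau l) : ℝ) : ℂ))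
    (Complex.ofRealCLM.contDiff.comp_contDiffOn ((hsm n).mul ha.sqrt_smooth))

/-- Rapidly decaying contributions are small in `ℓ²`. -/
theorem l2Small_of_decay (h : PhaseSetting L omega theta x Phi)
    (hv : ∃ k : ℝ, 0 < k ∧ Summable fun n => v n ^ 2 * x n ^ (-(2 * k)))
    {c : ℝ → ℕ → ℂ} (hlim : ∀ n, Tendsto (fun t => c t n) atTop (𝓝 0))
    (hc : ∀ N : ℕ, ∃ C n₀, ∀ n ≥ n₀, ∀ t ≥ 1, ‖c t n‖ ≤ C * (x n + t)⁻¹ ^ N) :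
    L2Small fun t n => (v n : ℂ) * c t n := by
  obtain ⟨k, hk, hsum⟩ := hv
  -- For `x n ≥ 1` and `N ≥ k` the decay is at most `x n ^ (-k)`, so the summability assumption on
  -- `v` is the majorant.
  obtain ⟨N, hN⟩ := exists_nat_ge k
  obtain ⟨C, n₀, hC⟩ := hc N
  obtain ⟨n₁, hn₁⟩ := eventually_atTop.1 (h.x_tendsto.eventually_ge_atTop 1)
  refine L2Small.of_dominated (fun n => by simpa using (hlim n).const_mul (v n : ℂ))
    (hsum.mul_left (C ^ 2)) (max n₀ n₁) ?_
  filter_upwards [eventually_ge_atTop 1] with t ht n hn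
  have hx := hn₁ n ((le_max_right _ _).trans hn)
  have hx0 : 0 < x n := by linarith
  have h1 := hC n ((le_max_left _ _).trans hn) t ht
  have h2 : (x n + t)⁻¹ ^ N ≤ x n ^ (-k) := by
    calc (x n + t)⁻¹ ^ N ≤ (x n)⁻¹ ^ N := by
          gcongr
          linarith
      _ = x n ^ (-(N : ℝ)) := by
          rw [Real.rpow_neg hx0.le, Real.rpow_natCast, inv_pow]
      _ ≤ x n ^ (-k) := Real.rpow_le_rpow_of_exponent_le hx (by linarith)
  have h3 : ‖c t n‖ ≤ |C| * x n ^ (-k) := by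
    refine h1.trans ?_
    have : 0 ≤ (x n + t)⁻¹ ^ N := by positivity
    calc C * (x n + t)⁻¹ ^ N ≤ |C| * (x n + t)⁻¹ ^ N := by gcongr; exact le_abs_self C
      _ ≤ _ := by gcongr
  have h4 : (x n ^ (-k)) ^ 2 = x n ^ (-(2 * k)) := by
    rw [← Real.rpow_natCast, ← Real.rpow_mul hx0.le]
    congr 1
    push_cast
    ring
  rw [norm_mul, mul_pow, Complex.norm_real, Real.norm_eq_abs, sq_abs]
  calc v n ^ 2 * ‖c t n‖ ^ 2 ≤ v n ^ 2 * (|C| * x n ^ (-k)) ^ 2 := by gcongr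
    _ = C ^ 2 * (v n ^ 2 * x n ^ (-(2 * k))) := by rw [mul_pow, h4, sq_abs]; ring

theorem oscInt_neg_l2Small (h : PhaseSetting L omega theta x Phi) (ha : AmplSetting L kappa tau)
    (hv : ∃ k : ℝ, 0 < k ∧ Summable fun n => v n ^ 2 * x n ^ (-(2 * k)))
    (hf : ContDiff ℝ ∞ f) (hfc : HasCompactSupport f) (hfL : tsupport f ⊆ L) :
    L2Small fun t n => (v n : ℂ) * oscInt omega theta x Phi (ampl kappa tau f) (-1) n t :=
  h.l2Small_of_decay hv (fun n => h.tendsto_oscInt ha hf hfc hfL (-1) n) fun N =>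
    h.nonstationary_neg (ha.contDiff_ampl h.isOpen hf hfL) (hasCompactSupport_ampl hfc)
      (tsupport_ampl_subset.trans hfL) N

open Classical in
theorem oscInt_far_l2Small (h : PhaseSetting L omega theta x Phi) (ha : AmplSetting L kappa tau)
    (hv : ∃ k : ℝ, 0 < k ∧ Summable fun n => v n ^ 2 * x n ^ (-(2 * k)))
    (hf : ContDiff ℝ ∞ f) (hfc : HasCompactSupport f) {α β : ℝ}
    (hfαβ : tsupport f ⊆ Set.Ioo α β) (hL : Set.Icc α β ⊆ L) :
    L2Small fun t n => if x n / t ∈ slope omega theta '' Set.Icc α β then 0 else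
      (v n : ℂ) * oscInt omega theta x Phi (ampl kappa tau f) 1 n t := by
  have hfL : tsupport f ⊆ L := (hfαβ.trans Set.Ioo_subset_Icc_self).trans hL
  have := h.l2Small_of_decay hv (c := fun t n =>
    if x n / t ∈ slope omega theta '' Set.Icc α β then 0 else
      oscInt omega theta x Phi (ampl kappa tau f) 1 n t) (fun n => ?_) fun N => ?_
  · simpa only [mul_ite, mul_zero] using this
  · refine squeeze_zero_norm (a := fun t => ‖oscInt omega theta x Phi (ampl kappa tau f) 1 n t‖)
      (fun t => ?_) (by simpa using (h.tendsto_oscInt ha hf hfc hfL 1 n).norm)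
    split_ifs
    · simp
    · exact le_rfl
  · obtain ⟨C, n₀, hC⟩ := h.nonstationary_pos (ha.contDiff_ampl h.isOpen hf hfL)
      (hasCompactSupport_ampl hfc) (tsupport_ampl_subset.trans hfαβ) hL N
    obtain ⟨n₁, hn₁⟩ := eventually_atTop.1 (h.x_tendsto.eventually_ge_atTop 1)
    refine ⟨|C|, max n₀ n₁, fun n hn t ht => ?_⟩
    have hx := hn₁ n ((le_max_right _ _).trans hn)
    have hp : 0 ≤ (x n + t)⁻¹ ^ N := by
      have : 0 < x n + t := by linarith
      positivity
    split_ifs with hc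
    · rw [norm_zero]
      positivity
    · refine (hC n ((le_max_left _ _).trans hn) t ht hc).trans ?_
      gcongr
      exact le_abs_self C

end PhaseSetting

end Evolution

/-! ### The window bound on `v n ^ 2` and the assembly of the asymptotics. -/

/-- A smooth compactly supported function in `L` equal to one on a compact set. -/
theorem exists_smooth_one_on_compact {K L : Set ℝ} (hK : IsCompact K) (hL : IsOpen L)
    (hKL : K ⊆ L) : ∃ g : ℝ → ℂ, ContDiff ℝ ∞ g ∧ HasCompactSupport g ∧ tsupport g ⊆ L ∧
      ∀ l ∈ K, g l = 1 := by
  obtain ⟨M, hM, hKM, hML⟩ := exists_compact_between hK hL hKL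
  obtain ⟨g, hg1, hg0, -⟩ := exists_contMDiffMap_one_nhds_of_subset_interior (n := (⊤ : ℕ∞))
    (modelWithCornersSelf ℝ ℝ) hK.isClosed hKM
  have hsupp : tsupport (fun l => ((g l : ℝ) : ℂ)) ⊆ M := by
    refine closure_minimal (fun l hl => ?_) hM.isClosed
    by_contra h
    exact hl (by simp [hg0 l h])
  refine ⟨fun l => ((g l : ℝ) : ℂ), Complex.ofRealCLM.contDiff.comp g.contMDiff.contDiff,
    HasCompactSupport.intro hM fun l hl => by simp [hg0 l hl], hsupp.trans hML, fun l hl => ?_⟩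
  simp [hg1.self_of_nhdsSet l hl]

theorem norm_leadingTerm {theta : ℝ → ℝ} {D : Set ℝ} {F : ℝ → ℂ} {phi : ℕ → ℝ → ℝ} {x v : ℕ → ℝ}
    {m : ℕ → ℝ → ℝ} {s : ℝ} {n : ℕ} {t : ℝ} (ht : 0 < t) (hv : 0 ≤ v n)
    (hx : x n / t ∈ deriv theta '' D) :
    ‖leadingTerm theta D F phi x v m s n t‖ =
      √(2 * Real.pi) * v n * (√t)⁻¹ * ‖calF theta D F (x n / t)‖ := by
  have e1 : ‖Complex.exp (-(Real.pi * Complex.I * s / 4))‖ = 1 := by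
    rw [Complex.norm_exp]
    simp
  have e2 : ‖Complex.exp (Complex.I * totalPhase theta phi x m n t)‖ = 1 := by
    rw [Complex.norm_exp]
    simp
  have e3 : t ^ (-(1 / 2) : ℝ) = (√t)⁻¹ := by
    rw [Real.rpow_neg ht.le, Real.sqrt_eq_rpow]
  rw [leadingTerm, norm_mul, norm_mul, norm_mul, norm_mul, e1, e2, e3, Set.indicator_of_mem hx,
    Complex.norm_of_nonneg (by positivity), Complex.norm_of_nonneg (by positivity), mul_one, mul_one]

namespace PhaseSetting

variable {L : Set ℝ} {omega theta : ℝ → ℝ} {x v : ℕ → ℝ} {Phi : ℕ → ℝ → ℝ} {kappa tau : ℝ → ℝ}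
  {P : ℕ → ℝ → ℝ} {f : ℝ → ℂ}

theorem oscInt_one {G : ℝ → ℂ} (n : ℕ) (t : ℝ) : oscInt omega theta x Phi G 1 n t =
    ∫ l, G l * Complex.exp (Complex.I * phase omega theta x Phi n t l) := by
  simp only [oscInt, signedPhase, phase, one_mul]

theorem exists_calF_lower (h : PhaseSetting L omega theta x Phi) (ha : AmplSetting L kappa tau)
    {K : Set ℝ} (hK : IsCompact K) (hKL : K ⊆ L) (hf : ∀ l ∈ K, f l = 1) :
    ∃ c > 0, ∀ l ∈ K,
      c ≤ ‖calF theta (omega '' L) (amplMu L omega kappa tau f) (slope omega theta l)‖ := by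
  set d : ℝ → ℝ := fun l => √|(deriv (deriv theta) (omega l))⁻¹| * (deriv omega l)⁻¹ *
    (kappa l * √(tau l)) with hd
  have hpos : ∀ l ∈ L, 0 < d l := fun l hl => by
    have h1 : 0 < |(deriv (deriv theta) (omega l))⁻¹| :=
      abs_pos.2 (inv_ne_zero (h.theta_ne _ ⟨l, hl, rfl⟩))
    have h2 := h.omega_pos l hl
    have h3 := ha.kappa_pos l hl
    have h4 := ha.tau_pos l hl
    positivity
  have hc : ContinuousOn d K := fun l hl =>
    ((h.continuousAt_density (hKL hl)).mul
      ((ha.kappa_smooth.mul ha.sqrt_smooth).continuousOn.continuousAt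
        (h.isOpen.mem_nhds (hKL hl)))).continuousWithinAt
  have heq : ∀ l ∈ K,
      ‖calF theta (omega '' L) (amplMu L omega kappa tau f) (slope omega theta l)‖ = d l := by
    intro l hl
    rw [h.calF_slope (hKL hl), ampl, hf l hl, mul_one, ← Complex.ofReal_mul,
      Complex.norm_of_nonneg (hpos l (hKL hl)).le]
  rcases K.eq_empty_or_nonempty with rfl | hne
  · exact ⟨1, one_pos, by simp⟩
  · obtain ⟨l₀, hl₀, hmin⟩ := hK.exists_isMinOn hne hc
    exact ⟨d l₀, hpos _ (hKL hl₀), fun l hl => (hmin hl).trans_eq (heq l hl).symm⟩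

open Classical in
/-- The a priori bound `∑ v_n² = O(t)`, the sum being over the indices `n` with `x_n / t` in a
compact set. -/
theorem exists_sum_sq_le (h : PhaseSetting L omega theta x Phi) (ha : AmplSetting L kappa tau)
    (hP : ∀ n, ContDiff ℝ ∞ (P n))
    (hrem : ∀ K ⊆ L, IsCompact K → ∃ C : ℝ, ∀ l ∈ K,
      Summable (fun n => |remTerm P kappa omega x v Phi n l| ^ 2) ∧
      ∑' n, |remTerm P kappa omega x v Phi n l| ^ 2 ≤ C)
    (hv : ∃ k : ℝ, 0 < k ∧ Summable fun n => v n ^ 2 * x n ^ (-(2 * k))) (hv_pos : ∀ n, 0 < v n)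
    {Theta : ℝ → ℝ} (hTheta : Set.EqOn Theta (theta ∘ omega) L)
    (hevol : ∀ g : ℝ → ℂ, ContDiff ℝ ∞ g → HasCompactSupport g → tsupport g ⊆ L →
      ∃ B, ∀ t : ℝ,
        Summable (fun n => ‖∫ l in L, ((P n l * √(tau l) : ℝ) : ℂ) * g l *
          Complex.exp (-(Complex.I * Theta l * t))‖ ^ 2) ∧
        ∑' n, ‖∫ l in L, ((P n l * √(tau l) : ℝ) : ℂ) * g l *
          Complex.exp (-(Complex.I * Theta l * t))‖ ^ 2 ≤ B)
    {K : Set ℝ} (hK : IsCompact K) (hKL : K ⊆ L) :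
    ∃ B, ∀ᶠ t in atTop,
      Summable (fun n => if x n / t ∈ slope omega theta '' K then v n ^ 2 else 0) ∧
      ∑' n, (if x n / t ∈ slope omega theta '' K then v n ^ 2 else 0) ≤ B * t := by
  rcases K.eq_empty_or_nonempty with rfl | ⟨l₀, hl₀⟩
  · exact ⟨0, Eventually.of_forall fun t => by simp [summable_zero]⟩
  -- A test amplitude equal to one on `K` keeps the leading term bounded below by a multiple of `v n
  -- / √t` throughout the window.
  obtain ⟨g, hg, hgc, hgL, hg1⟩ := exists_smooth_one_on_compact hK h.isOpen hKL
  obtain ⟨c, hc, hcle⟩ := h.exists_calF_lower ha hK hKL hg1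
  obtain ⟨m, hm⟩ := h.exists_isStationaryBranch
  obtain ⟨B, hB⟩ := hevol g hg hgc hgL
  have hKc : IsCompact (slope omega theta '' K) :=
    hK.image_of_continuousOn (h.slope_smooth.continuousOn.mono hKL)
  -- Half of the lower bound for the leading term, so the stationary phase error cannot cancel it.
  set e : ℝ := √(2 * Real.pi) * c / 2 with he
  have he_pos : 0 < e := by positivity
  have hst := h.stationary_phase_uniform (ha.contDiff_ampl h.isOpen hg hgL)
    (hasCompactSupport_ampl hgc) (tsupport_ampl_subset.trans hgL) hm hKc (Set.image_mono hKL)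
    ⟨l₀, hKL hl₀, rfl⟩ v hv_pos he_pos
  have hsmall := (h.remInt_l2Small ha hP hrem hg hgc hgL).add (h.oscInt_neg_l2Small ha hv hg hgc hgL)
  -- The plus piece is the full evolution minus the small pieces. Their squared norms are at most
  -- `B` and eventually `1`, and splitting the square doubles both.
  refine ⟨(2 * B + 2) / e ^ 2, ?_⟩
  filter_upwards [hst, hsmall.1, hsmall.2.eventually_le_const one_pos, eventually_gt_atTop 0]
    with t h1 h2 h3 ht
  set ψ : ℕ → ℂ := fun n => ∫ l in L, ((P n l * √(tau l) : ℝ) : ℂ) * g l *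
          Complex.exp (-(Complex.I * Theta l * t)) with hψ
  set r : ℕ → ℂ := fun n => remInt P kappa omega theta x v Phi tau g n t +
    v n * oscInt omega theta x Phi (ampl kappa tau g) (-1) n t with hr
  have hdom : ∀ n, (if x n / t ∈ slope omega theta '' K then v n ^ 2 else 0) ≤
      t / e ^ 2 * (2 * ‖ψ n‖ ^ 2 + 2 * ‖r n‖ ^ 2) := by
    intro n
    split_ifs with hn
    · have h4 := h1 n hn
      rw [← oscInt_one] at h4
      have h5 : ((v n : ℂ) * oscInt omega theta x Phi (ampl kappa tau g) 1 n t) = ψ n + -r n := by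
        have := h.evolution_decomposition (v := v) ha hP hg hgc hgL hTheta n t
        simp only [hψ, hr, this]
        ring
      rw [h5] at h4
      have h6 : e * v n * (√t)⁻¹ ≤ ‖ψ n + -r n‖ := by
        have h7 := norm_sub_norm_le (leadingTerm theta (omega '' L) (amplMu L omega kappa tau g)
          (phaseMu L omega Phi) x v m (Real.sign (deriv (deriv theta) (omega l₀))) n t) (ψ n + -r n)
        rw [norm_sub_rev] at h7
        obtain ⟨l, hl, hle⟩ := hn
        rw [norm_leadingTerm ht (hv_pos n).le
          (by rw [image_deriv_theta, ← hle]; exact ⟨l, hKL hl, rfl⟩), ← hle] at h7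
        have h8 : √(2 * Real.pi) * v n * (√t)⁻¹ * c ≤ √(2 * Real.pi) * v n * (√t)⁻¹ *
            ‖calF theta (omega '' L) (amplMu L omega kappa tau g) (slope omega theta l)‖ := by
          have := (hv_pos n).le
          gcongr
          exact hcle l hl
        have h9 : √(2 * Real.pi) * v n * (√t)⁻¹ * c = 2 * (e * v n * (√t)⁻¹) := by rw [he]; ring
        linarith
      have h7 : (e * v n * (√t)⁻¹) ^ 2 ≤ 2 * ‖ψ n‖ ^ 2 + 2 * ‖r n‖ ^ 2 := by
        refine (pow_le_pow_left₀ (by have := (hv_pos n).le; positivity) h6 2).trans ?_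
        simpa using norm_add_sq_le_two (ψ n) (-r n)
      have h8 : (e * v n * (√t)⁻¹) ^ 2 = e ^ 2 * v n ^ 2 / t := by
        rw [mul_pow, mul_pow, inv_pow, Real.sq_sqrt ht.le, div_eq_mul_inv]
      rw [h8] at h7
      calc v n ^ 2 = t / e ^ 2 * (e ^ 2 * v n ^ 2 / t) := by field_simp
        _ ≤ _ := by gcongr
    · positivity
  have hsum : Summable fun n => t / e ^ 2 * (2 * ‖ψ n‖ ^ 2 + 2 * ‖r n‖ ^ 2) :=
    (((hB t).1.mul_left 2).add (h2.mul_left 2)).mul_left _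
  have hS := Summable.of_nonneg_of_le (fun n => by positivity) hdom hsum
  refine ⟨hS, (hS.tsum_le_tsum hdom hsum).trans ?_⟩
  rw [tsum_mul_left, ((hB t).1.mul_left 2).tsum_add (h2.mul_left 2), tsum_mul_left, tsum_mul_left]
  have h4 := (hB t).2
  calc _ ≤ t / e ^ 2 * (2 * B + 2 * 1) := by gcongr
    _ = _ := by ring

-- The uniform error is at most `e * v n / √t`. Its squares sum over the window to at most `e ^ 2 *
-- B`, which is as small as desired since `B` does not depend on `e`.
open Classical in
theorem oscInt_near_l2Small (h : PhaseSetting L omega theta x Phi) (ha : AmplSetting L kappa tau)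
    (hv_pos : ∀ n, 0 < v n) (hf : ContDiff ℝ ∞ f) (hfc : HasCompactSupport f)
    (hfL : tsupport f ⊆ L) {K : Set ℝ} (hK : IsCompact K) (hKL : K ⊆ L)
    (hsum : ∃ B, ∀ᶠ t in atTop,
      Summable (fun n => if x n / t ∈ slope omega theta '' K then v n ^ 2 else 0) ∧
      ∑' n, (if x n / t ∈ slope omega theta '' K then v n ^ 2 else 0) ≤ B * t)
    {m : ℕ → ℝ → ℝ} (hm : IsStationaryBranch theta (omega '' L) (phaseMu L omega Phi) x m)
    {mu₀ : ℝ} (hmu₀ : mu₀ ∈ omega '' L) :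
    L2Small fun t n => if x n / t ∈ slope omega theta '' K then
      (v n : ℂ) * oscInt omega theta x Phi (ampl kappa tau f) 1 n t -
        leadingTerm theta (omega '' L) (amplMu L omega kappa tau f) (phaseMu L omega Phi) x v
          m (Real.sign (deriv (deriv theta) mu₀)) n t else 0 := by
  obtain ⟨B, hB⟩ := hsum
  have hKc : IsCompact (slope omega theta '' K) :=
    hK.image_of_continuousOn (h.slope_smooth.continuousOn.mono hKL)
  refine L2Small.of_forall_pos fun η hη => ?_
  set e : ℝ := √(η / (|B| + 1)) with he
  have he_pos : 0 < e := by positivity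
  have he2 : e ^ 2 * B ≤ η := by
    rw [he, Real.sq_sqrt (by positivity), div_mul_eq_mul_div, div_le_iff₀ (by positivity)]
    have := le_abs_self B
    gcongr
    linarith
  have hst := h.stationary_phase_uniform (ha.contDiff_ampl h.isOpen hf hfL)
    (hasCompactSupport_ampl hfc) (tsupport_ampl_subset.trans hfL) hm hKc (Set.image_mono hKL)
    hmu₀ v hv_pos he_pos
  filter_upwards [hst, hB, eventually_gt_atTop 0] with t h1 h2 ht
  have hdom : ∀ n, ‖(if x n / t ∈ slope omega theta '' K then
      (v n : ℂ) * oscInt omega theta x Phi (ampl kappa tau f) 1 n t -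
        leadingTerm theta (omega '' L) (amplMu L omega kappa tau f) (phaseMu L omega Phi) x v
          m (Real.sign (deriv (deriv theta) mu₀)) n t else 0)‖ ^ 2 ≤
      e ^ 2 / t * (if x n / t ∈ slope omega theta '' K then v n ^ 2 else 0) := by
    intro n
    split_ifs with hn
    · have h3 := h1 n hn
      rw [← oscInt_one] at h3
      refine (pow_le_pow_left₀ (norm_nonneg _) h3 2).trans_eq ?_
      rw [mul_pow, mul_pow, inv_pow, Real.sq_sqrt ht.le]
      ring
    · simp
  have hS := Summable.of_nonneg_of_le (fun n => by positivity) hdom (h2.1.mul_left _)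
  refine ⟨hS, (hS.tsum_le_tsum hdom (h2.1.mul_left _)).trans ?_⟩
  rw [tsum_mul_left]
  calc _ ≤ e ^ 2 / t * (B * t) := by gcongr; exact h2.2
    _ = e ^ 2 * B := by field_simp
    _ ≤ η := he2

theorem leadingTerm_eq_zero (h : PhaseSetting L omega theta x Phi) {K : Set ℝ}
    (hfK : tsupport f ⊆ K) {m : ℕ → ℝ → ℝ} {s t : ℝ} {n : ℕ}
    (hn : x n / t ∉ slope omega theta '' K) :
    leadingTerm theta (omega '' L) (amplMu L omega kappa tau f) (phaseMu L omega Phi) x v m s n t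
      = 0 := by
  rw [leadingTerm]
  refine mul_eq_zero_of_right _ ?_
  by_cases hL : x n / t ∈ deriv theta '' (omega '' L)
  · rw [Set.indicator_of_mem hL]
    rw [image_deriv_theta] at hL
    obtain ⟨l, hl, hle⟩ := hL
    have hf0 : f l = 0 := image_eq_zero_of_notMem_tsupport fun hmem => hn ⟨l, hfK hmem, hle⟩
    rw [← hle, h.calF_slope hl, ampl, hf0]
    simp
  · exact Set.indicator_of_notMem hL _

/-- At fixed `t` only finitely many terms are nonzero: the window is bounded and `x` tends to
infinity. -/
theorem summable_leadingTerm (h : PhaseSetting L omega theta x Phi) {K : Set ℝ} (hK : IsCompact K)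
    (hKL : K ⊆ L) (hfK : tsupport f ⊆ K) {m : ℕ → ℝ → ℝ} {s t : ℝ} (ht : 0 < t) :
    Summable fun n => ‖leadingTerm theta (omega '' L) (amplMu L omega kappa tau f)
      (phaseMu L omega Phi) x v m s n t‖ ^ 2 := by
  have hKc : IsCompact (slope omega theta '' K) :=
    hK.image_of_continuousOn (h.slope_smooth.continuousOn.mono hKL)
  obtain ⟨b, hb⟩ := hKc.bddAbove
  obtain ⟨N, hN⟩ := eventually_atTop.1 (h.x_tendsto.eventually_gt_atTop (b * t))
  refine summable_of_ne_finset_zero (s := Finset.range N) fun n hn => ?_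
  rw [h.leadingTerm_eq_zero hfK fun hmem => ?_]
  · simp
  · have h1 := hb hmem
    rw [div_le_iff₀ ht] at h1
    exact absurd h1 (hN n (by simpa using hn)).not_ge

end PhaseSetting

theorem theorem4p4
    -- a self-adjoint Jacobi operator and its spectral family
    (a b : ℕ → ℝ) (ha : ∀ n, 0 < a n)
    (J : EllTwo →ₗ.[ℂ] EllTwo) (hJ : IsJacobiOperator a b J)
    (E : ProjMeasure EllTwo) (hE : E.IsSpectralFamilyOf J)
    -- an open interval on which the spectral measure is absolutely continuous with a smooth weight
    (L : Set ℝ) (hLo : IsOpen L) (hLc : L.OrdConnected)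
    (tau : ℝ → ℝ) (htau : ContDiffOn ℝ ∞ tau L) (htau_pos : ∀ l ∈ L, 0 < tau l)
    (hrho : (spectralMeasure E).restrict L =
      (volume.restrict L).withDensity (fun l => ENNReal.ofReal (tau l)))
    -- the asymptotics of the orthonormal polynomials
    (kappa omega : ℝ → ℝ) (x v : ℕ → ℝ) (Phi : ℕ → ℝ → ℝ)
    (hasy : AsymptoticAssumption (fun n l => (jacobiPoly a b n).eval l) L kappa omega x v Phi)
    -- the functions `θ` on `ω(L)` and `Θ = θ ∘ ω` on `L`
    (theta Theta : ℝ → ℝ) (htheta : ContDiffOn ℝ ∞ theta (omega '' L))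
    (htheta1 : ∀ mu ∈ omega '' L, 0 < deriv theta mu)
    (htheta2 : ∀ mu ∈ omega '' L, deriv (deriv theta) mu ≠ 0)
    (hTheta : Measurable Theta) (hTheta_eq : Set.EqOn Theta (theta ∘ omega) L)
    (f : ℝ → ℂ) (hf : ContDiff ℝ ∞ f) (hfc : HasCompactSupport f) (hfL : tsupport f ⊆ L) :
    ∃ u : EllTwo, (∀ n, u n = diagCoord a b L tau f n) ∧
      (∃ m, IsStationaryBranch theta (omega '' L) (phaseMu L omega Phi) x m) ∧
      ∀ m, IsStationaryBranch theta (omega '' L) (phaseMu L omega Phi) x m →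
        -- the (constant) sign of `θ''` may be computed at any point
        ∀ mu₀ ∈ omega '' L, ∃ rho : ℝ → EllTwo,
          (∀ t : ℝ, 0 < t → ∀ n,
            (E.integral (fun l => Complex.exp (-(Complex.I * Theta l * t))) u) n =
              leadingTerm theta (omega '' L) (amplMu L omega kappa tau f) (phaseMu L omega Phi) x v
                m (Real.sign (deriv (deriv theta) mu₀)) n t + rho t n) ∧
          Tendsto (fun t => ∑' n, ‖rho t n‖ ^ 2) atTop (𝓝 0) := by
  have h : PhaseSetting L omega theta x Phi :=
    { isOpen := hLo
      ordConnected := hLc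
      omega_smooth := hasy.omega_smooth
      omega_pos := hasy.omega_deriv_pos
      theta_smooth := htheta
      theta_pos := htheta1
      theta_ne := htheta2
      x_strictMono := hasy.x_strictMono
      x_tendsto := hasy.x_tendsto
      Phi_smooth := hasy.Phi_smooth
      Phi_low := hasy.Phi_low
      Phi_high := hasy.Phi_high }
  have hA : PhaseSetting.AmplSetting L kappa tau := ⟨hasy.kappa_smooth, hasy.kappa_pos, htau, htau_pos⟩
  have hP : ∀ n, ContDiff ℝ ∞ fun l => (jacobiPoly a b n).eval l := fun n =>
    (jacobiPoly a b n).contDiff_aeval ∞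
  obtain ⟨u, hu, -, hut⟩ :=
    exists_spectral_evolution ha hJ hE hLo htau htau_pos hrho hTheta hf hfc hfL
  refine ⟨u, hu, h.exists_isStationaryBranch, fun m hm mu₀ hmu₀ => ?_⟩
  obtain ⟨α, β, hfαβ, hαβ⟩ := exists_Icc_subset_of_isCompact hLo hLc hfc.isCompact hfL
  have hfK : tsupport f ⊆ Set.Icc α β := hfαβ.trans Set.Ioo_subset_Icc_self
  -- The required bound on the evolution of an arbitrary test amplitude is the operator bound of the
  -- functional calculus.
  have hsum := h.exists_sum_sq_le hA hP hasy.remainder hasy.summable_v hasy.v_pos hTheta_eq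
    (fun g hg hgc hgL => by
      obtain ⟨w, -, hwb, hwt⟩ :=
        exists_spectral_evolution ha hJ hE hLo htau htau_pos hrho hTheta hg hgc hgL
      refine ⟨(2 * ‖w‖) ^ 2, fun t => ?_⟩
      have key := EllTwo.summable (E.integral (fun l => Complex.exp (-(Complex.I * Theta l * t))) w)
      have key' := (EllTwo.tsum_norm_sq (E.integral
        (fun l => Complex.exp (-(Complex.I * Theta l * t))) w)).trans_le
        (pow_le_pow_left₀ (norm_nonneg _) (hwb t) 2)
      simp only [hwt t] at key key'
      exact ⟨key, key'⟩) isCompact_Icc hαβ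
  set lead : ℕ → ℝ → ℂ := leadingTerm theta (omega '' L) (amplMu L omega kappa tau f)
    (phaseMu L omega Phi) x v m (Real.sign (deriv (deriv theta) mu₀)) with hlead
  set U : ℝ → EllTwo := fun t => E.integral (fun l => Complex.exp (-(Complex.I * Theta l * t))) u
    with hU
  have hmem : ∀ t, 0 < t → Memℓp (E := fun _ : ℕ => ℂ) (fun n => U t n - lead n t) 2 :=
    fun t ht => (lp.memℓp (U t)).sub
      (EllTwo.memlp_of_summable (h.summable_leadingTerm isCompact_Icc hαβ hfK ht))
  -- Choosing the remainder as an element of `EllTwo` encodes its summability for every positive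
  -- `t`; the value for other `t` is a default.
  have hrho' : ∀ t, ∃ w : EllTwo, 0 < t → ∀ n, w n = U t n - lead n t := fun t => by
    by_cases ht : 0 < t
    · exact ⟨⟨fun n => U t n - lead n t, hmem t ht⟩, fun _ n => rfl⟩
    · exact ⟨0, fun h => absurd h ht⟩
  choose rho hrho' using hrho'
  refine ⟨rho, fun t ht n => ?_, ?_⟩
  · rw [hrho' t ht n]
    exact (add_sub_cancel _ _).symm
  -- The remainder is the sum of four small families: the contribution of $\epsilon_n$, the minus
  -- phase, and the plus phase outside and inside the window. Outside it the leading term vanishes.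
  · refine ((h.remInt_l2Small hA hP hasy.remainder hf hfc hfL).add
      ((h.oscInt_neg_l2Small hA hasy.summable_v hf hfc hfL).add
      ((h.oscInt_far_l2Small hA hasy.summable_v hf hfc hfαβ hαβ).add
      (h.oscInt_near_l2Small hA hasy.v_pos hf hfc hfL isCompact_Icc hαβ hsum hm hmu₀)))).2.congr' ?_
    filter_upwards [eventually_gt_atTop 0] with t ht
    refine tsum_congr fun n => ?_
    rw [hrho' t ht n, hU, hut t n, h.evolution_decomposition hA hP hf hfc hfL hTheta_eq n t]
    congr 2
    split_ifs with hn
    · ring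
    · rw [hlead, h.leadingTerm_eq_zero hfK hn]
      ring
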